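/- **Setting.** Let $N\ge 1$, let $\Omega_N=\{Z\in\mathbb C^{N\times N}: Z^*Z=ZZ^*\}$ be the set of normal matrices, and for $h>0$ let $\mu_h$ be the measure on $\Omega_N$ with $$\int_{\Omega_N}F\,d\mu_h=(\pi h)^{-N}\int_{U(N)}\int_{\mathbb C^N}F(U^*DU)\,e^{-\|d\|^2/h}\,dd\,dU,\qquad D=\operatorname{diag}(d_1,\dots,d_N),$$ where $dU$ is the normalized Haar measure and $dd$ the Lebesgue measure. Let $\mathcal H_h\subset L^2_{\mathbb C^N}(\Omega_N,d\mu_h)$ be the closed linear span of the functions $Z\mapsto Z^k\chi$ ($k\ge0$, $\chi\in\mathbb C^N$), with reproducing kernel $K_h(X,Y)=\sum_{k\ge0}X^kY^{*k}/(k!\,h^k)$, and let $P$ be the orthogonal projection of $L^2_{\mathbb C^N}(\Omega_N,d\mu_h)$ onto $\mathcal H_h$. For a matrix-valued function $\phi$ on $\Omega_N$ the Toeplitz operator is $T_\phi F=P(\phi F)$, defined for those $F\in\mathcal H_h$ with $\phi F\in L^2$. With $K_{X,\chi}=K_h(\cdot,X)\chi$, the Berezin transform $\widetilde T$ of an operator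 $T$ on $\mathcal H_h$ whose domain contains all $K_{X,\chi}$ is the matrix-valued function $$\widetilde T(X)=K_h(X,X)^{-1/2}\,A(X)\,K_h(X,X)^{-1/2},\qquad \chi'^*A(X)\chi=\langle TK_{X,\chi},K_{X,\chi'}\rangle .$$ For $f:\mathbb C\times\mathbb C^{N-1}\to\mathbb C$, $f=f(d_1;d_2,\dots,d_N)$, symmetric in $d_2,\dots,d_N$, put $f^\#(UDU^*)=U\operatorname{diag}_j\big(f(d_j;d_1,\dots,\widehat{d_j},\dots,d_N)\big)U^*$ and $f^\flat(z)=f(z;0,\dots,0)$; for $u:\mathbb C\to\mathbb C$ put $u^\#(UDU^*)=U\operatorname{diag}_j(u(d_j))U^*$ ($U$ unitary, $D=\operatorname{diag}(d_1,\dots,d_N)$). A function $\phi:\Omega_N\to\mathbb C^{N\times N}$ is $U$-invariant if $\phi(UZU^*)=U\phi(Z)U^*$ for all unitary $U$ and all $Z\in\Omega_N$; equivalently, $\phi=f^\#$ for a (unique) such $f$. Let $\mathcal U$ be the set of $U$-invariant functions $\phi=f^\#$ for which $f$ is $C^\infty$ on $\mathbb C^N$ and every partial derivative of $f$, of any order $\ge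 0$, is $O(e^{c\|d\|^2})$ for some constant $c$ (which may depend on the derivative). **Theorem.** There exist bidifferential operators $G_0,G_1,G_2,\dots$ on $\mathbb C^N$ (depending only on $N$) such that the following holds for all $\phi,\psi\in\mathcal U$. For all sufficiently small $h>0$ the Berezin transform of $T_\phi T_\psi$ is defined, and there are uniquely determined smooth functions $g_0,g_1,\dots$ on $\mathbb C$, for each of which the Berezin transform of $T_{g_m^\#}$ is defined for all sufficiently small $h>0$, such that $$\widetilde{T_\phi T_\psi}\approx\sum_{m=0}^\infty h^m\,\widetilde{T_{g_m^\#}}\qquad\text{as }h\searrow0,$$ that is, for every $X\in\Omega_N$ and every $M=0,1,2,\dots$, $$\widetilde{T_\phi T_\psi}(X)-\sum_{m=0}^{M}h^m\,\widetilde{T_{g_m^\#}}(X)=O(h^{M+1})\qquad\text{as } h\searrow0 .$$ Moreover, if $\phi=f^\#$ and $\psi=g^\#$, then $g_m=G_m(f,g)^\flat$ for all $m$, and $$G_0(f,g)^\flat=f^\flat g^\flat,\qquad G_1(f,g)^\flat-G_1(g,f)^\flat=\frac{i}{2\pi}\{f^\flat,g^\flat\},$$ where $\{\cdot,\cdot\}$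 is the Poisson bracket on $\mathbb C$ of the symplectic form $\omega=\frac{i}{2\pi}\partial\bar\partial|z|^2=\frac1\pi\,dx\wedge dy$, with the sign convention $\{u,v\}=X_uv$, $\omega(X_u,\cdot)=du$; explicitly $\{u,v\}=\pi\,(u_yv_x-u_xv_y)=2\pi i\,(\partial u\,\bar\partial v-\bar\partial u\,\partial v)$. -/

import Mathlib

open MeasureTheory Filter Topology Asymptotics
open scoped Matrix ContDiff InnerProductSpace

noncomputable section

namespace NormalMatrixQuantization

/-! Throughout, the matrix size is `N = n + 1`, so that `N ≥ 1`. -/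

/-- Complex `N × N` matrices, `N = n + 1`. -/
abbrev Mat (n : ℕ) : Type := Matrix (Fin (n + 1)) (Fin (n + 1)) ℂ

/-- The Hilbert space `ℂ^N`, in which the functions of the Bargmann space take their values. -/
abbrev Vec (n : ℕ) : Type := EuclideanSpace ℂ (Fin (n + 1))

/-- The coordinate space `ℂ^N` of the eigenvalues `(d_1; d_2, …, d_N)`. The distinguished
variable `d_1` is `d 0`. -/
abbrev Spec (n : ℕ) : Type := Fin (n + 1) → ℂ

/-- The unitary group `U(N)`. -/
abbrev UN (n : ℕ) : Type := Matrix.unitaryGroup (Fin (n + 1)) ℂ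

/-- The domain of all normal matrices. -/
def normalMatrices (n : ℕ) : Set (Mat n) := {Z | Zᴴ * Z = Z * Zᴴ}

/-- The action of a matrix on a vector of `ℂ^N`. -/
def act {n : ℕ} (A : Mat n) (v : Vec n) : Vec n := WithLp.toLp 2 (A *ᵥ WithLp.ofLp v)

/-! ### The measure on the normal matrices -/

instance instMeasurableSpaceMat (n : ℕ) : MeasurableSpace (Mat n) := borel _

instance instBorelSpaceMat (n : ℕ) : BorelSpace (Mat n) := ⟨rfl⟩

instance instCompactSpaceUN (n : ℕ) : CompactSpace (UN n) := by
  have hK : IsCompact (Set.pi Set.univ fun _ : Fin (n + 1) =>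
      Set.pi Set.univ fun _ : Fin (n + 1) => Metric.closedBall (0 : ℂ) 1) :=
    isCompact_univ_pi fun _ => isCompact_univ_pi fun _ => isCompact_closedBall 0 1
  have hc : IsClosed {A : Mat n | A * star A = 1} :=
    isClosed_eq (by fun_prop) continuous_const
  have h : IsCompact {A : Mat n | A * star A = 1} := by
    refine IsCompact.of_isClosed_subset (X := Mat n) hK hc ?_
    intro A hA i _ j _
    simpa using entry_norm_bound_of_unitary (Matrix.mem_unitaryGroup_iff.2 hA) i j
  have e : {A : Mat n | A * star A = 1} = (Matrix.unitaryGroup (Fin (n + 1)) ℂ : Set (Mat n)) := by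
    ext A
    exact Matrix.mem_unitaryGroup_iff.symm
  rw [e] at h
  exact isCompact_iff_compactSpace.1 h

/-- The normalized Haar measure `dU` on `U(N)`. -/
def haarUN (n : ℕ) : Measure (UN n) := Measure.haarMeasure ⊤

/-- The Gaussian measure `(π h)^{-N} exp(-‖d‖² / h) dd` on `ℂ^N`, `dd` the Lebesgue measure. -/
def gaussianSpec (n : ℕ) (h : ℝ) : Measure (Spec n) :=
  (volume : Measure (Spec n)).withDensity fun d =>
    ENNReal.ofReal (((Real.pi * h) ^ (n + 1))⁻¹ * Real.exp (-(∑ i, ‖d i‖ ^ 2) / h))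

/-- The measure `μ_h` on the normal matrices, as a measure on all matrices that is carried by the
normal ones:
`∫ F(Z) dμ_h(Z) = (π h)^{-N} ∫_{U(N)} ∫_{ℂ^N} F(U^* D U) exp(-‖D‖² / h) dU dD`. -/
def mu (n : ℕ) (h : ℝ) : Measure (Mat n) :=
  ((haarUN n).prod (gaussianSpec n h)).map fun p =>
    ((p.1 : Mat n))ᴴ * Matrix.diagonal p.2 * (p.1 : Mat n)

/-! ### The vector-valued Bargmann space, its kernel, Toeplitz operators, Berezin transform -/

/-- `L²_{ℂ^N}(Ω_N, dμ_h)`. -/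
abbrev L2 (n : ℕ) (h : ℝ) : Type := Lp (Vec n) 2 (mu n h)

/-- The space `H_h`: the closed subspace of `L²_{ℂ^N}(Ω_N, dμ_h)` spanned by the functions
`Z ↦ Z^k χ`, `k = 0, 1, 2, …`, `χ ∈ ℂ^N`. -/
def bargmann (n : ℕ) (h : ℝ) : Submodule ℂ (L2 n h) :=
  (Submodule.span ℂ {F : L2 n h | ∃ (k : ℕ) (χ : Vec n),
    F =ᵐ[mu n h] fun Z => act (Z ^ k) χ}).topologicalClosure

instance instCompleteSpaceBargmann (n : ℕ) (h : ℝ) : CompleteSpace (bargmann n h) :=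
  Submodule.topologicalClosure.completeSpace _

/-- The reproducing kernel `K_h(X, Y) = ∑_k X^k (Y^*)^k / (k! h^k)` of `H_h`. -/
def kernel {n : ℕ} (h : ℝ) (X Y : Mat n) : Mat n :=
  ∑' k : ℕ, ((Nat.factorial k : ℂ) * (h : ℂ) ^ k)⁻¹ • (X ^ k * Yᴴ ^ k)

open Classical in
/-- The element `K_{X,χ}` of `H_h` that is represented by the function `Z ↦ K_h(Z, X) χ`
(this function does represent an element of `H_h` for every `h > 0`). -/
def coherent {n : ℕ} (h : ℝ) (X : Mat n) (χ : Vec n) : bargmann n h :=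
  if H : ∃ F : bargmann n h, (F : L2 n h) =ᵐ[mu n h] fun Z => act (kernel h Z X) χ
  then H.choose else 0

/-- `F ∈ H_h` lies in the natural domain of the Toeplitz operator with symbol `φ`:
the product `φ F` is square integrable. For bounded (measurable) `φ` every `F` does. -/
def InDomain {n : ℕ} (h : ℝ) (φ : Mat n → Mat n) (F : bargmann n h) : Prop :=
  MemLp (fun Z => act (φ Z) ((F : L2 n h) Z)) 2 (mu n h)

open Classical in
/-- The Toeplitz operator `T_φ F = P(φ F)`, where `P : L² → H_h` is the orthogonal projection.
It is meaningful for `F` in the natural domain `InDomain h φ`; outside of it the value is `0`. -/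
def toeplitz {n : ℕ} (h : ℝ) (φ : Mat n → Mat n) (F : bargmann n h) : bargmann n h :=
  if H : InDomain h φ F then (bargmann n h).orthogonalProjectionOnto (MemLp.toLp _ H) else 0

/-- The inverse square root `K_h(X, X)^{-1/2}` of the positive definite matrix `K_h(X, X)`. -/
def kernelInvSqrt {n : ℕ} (h : ℝ) (X : Mat n) : Mat n :=
  cfc (fun x : ℝ => (Real.sqrt x)⁻¹) (kernel h X X)

/-- The matrix with entries `⟨T K_{X,e_b}, K_{X,e_a}⟩` (the inner product here being linear
in the first variable, while that of Mathlib is linear in the second). -/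
def preBerezin {n : ℕ} (h : ℝ) (T : bargmann n h → bargmann n h) (X : Mat n) : Mat n :=
  Matrix.of fun a b =>
    ⟪coherent h X (EuclideanSpace.single a 1), T (coherent h X (EuclideanSpace.single b 1))⟫_ℂ

/-- The Berezin transform of an operator on `H_h`. -/
def berezin {n : ℕ} (h : ℝ) (T : bargmann n h → bargmann n h) (X : Mat n) : Mat n :=
  kernelInvSqrt h X * preBerezin h T X * kernelInvSqrt h X

/-! ### `U`-invariant and spectral functions -/

/-- `φ(U Z U^*) = U φ(Z) U^*` for all unitary `U` and all normal `Z`. -/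
def IsUInvariant {n : ℕ} (φ : Mat n → Mat n) : Prop :=
  ∀ U : UN n, ∀ Z ∈ normalMatrices n,
    φ ((U : Mat n) * Z * (U : Mat n)ᴴ) = (U : Mat n) * φ Z * (U : Mat n)ᴴ

/-- `f(d_1; d_2, …, d_N)` is symmetric in the `N - 1` variables `d_2, …, d_N`. -/
def IsSymmetricTail {n : ℕ} (f : Spec n → ℂ) : Prop :=
  ∀ (σ : Equiv.Perm (Fin n)) (z : ℂ) (w : Fin n → ℂ),
    f (Fin.cons z (w ∘ σ)) = f (Fin.cons z w)

/-- The diagonal matrix with entries `f(d_j; d_1, …, d̂_j, …, d_N)` (the variable `d_j` is moved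
to the first place). -/
def sharpDiag {n : ℕ} (f : Spec n → ℂ) (d : Spec n) : Mat n :=
  Matrix.diagonal fun j => f (Fin.cons (d j) fun i => d (j.succAbove i))

open Classical in
/-- The function `f^#` on the normal matrices:
`f^#(U D U^*) = U diag_j(f(d_j; d_1, …, d̂_j, …, d_N)) U^*`. For `f` symmetric in `d_2, …, d_N`
the value does not depend on the chosen diagonalization, see `sharp_conj`. -/
def sharp {n : ℕ} (f : Spec n → ℂ) (Z : Mat n) : Mat n :=
  if H : ∃ p : UN n × Spec n, Z = (p.1 : Mat n) * Matrix.diagonal p.2 * (p.1 : Mat n)ᴴ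
  then (H.choose.1 : Mat n) * sharpDiag f H.choose.2 * (H.choose.1 : Mat n)ᴴ else 0

/-- The value of `f^#` is independent of the chosen diagonalization. -/
theorem sharp_conj {n : ℕ} {f : Spec n → ℂ} (hf : IsSymmetricTail f) (U : UN n) (d : Spec n) :
    sharp f ((U : Mat n) * Matrix.diagonal d * (U : Mat n)ᴴ) =
      (U : Mat n) * sharpDiag f d * (U : Mat n)ᴴ := by
  have H : ∃ p : UN n × Spec n, (U : Mat n) * Matrix.diagonal d * (U : Mat n)ᴴ =
      (p.1 : Mat n) * Matrix.diagonal p.2 * (p.1 : Mat n)ᴴ := ⟨(U, d), rfl⟩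
  rw [sharp, dif_pos H]
  have hs := H.choose_spec
  generalize H.choose = p at hs ⊢
  obtain ⟨V, e⟩ := p
  dsimp only at hs ⊢
  have hU : (U : Mat n)ᴴ * (U : Mat n) = 1 := Matrix.mem_unitaryGroup_iff'.1 U.2
  have hU' : (U : Mat n) * (U : Mat n)ᴴ = 1 := Matrix.mem_unitaryGroup_iff.1 U.2
  have hV : (V : Mat n)ᴴ * (V : Mat n) = 1 := Matrix.mem_unitaryGroup_iff'.1 V.2
  have hV' : (V : Mat n) * (V : Mat n)ᴴ = 1 := Matrix.mem_unitaryGroup_iff.1 V.2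
  generalize (U : Mat n) = A at *
  generalize (V : Mat n) = B at *
  -- the eigenvalues agree up to order
  have hm : Finset.univ.val.map d = Finset.univ.val.map e := by
    have h1 : (Matrix.diagonal d).charpoly = (Matrix.diagonal e).charpoly := by
      have h2 : (A * Matrix.diagonal d * Aᴴ).charpoly = (Matrix.diagonal d).charpoly := by
        rw [Matrix.charpoly_mul_comm, ← mul_assoc, hU, one_mul]
      have h3 : (B * Matrix.diagonal e * Bᴴ).charpoly = (Matrix.diagonal e).charpoly := by
        rw [Matrix.charpoly_mul_comm, ← mul_assoc, hV, one_mul]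
      rw [← h2, ← h3, hs]
    rw [Matrix.charpoly_diagonal, Matrix.charpoly_diagonal] at h1
    have h4 : ∀ x : Spec n, (∏ i, (Polynomial.X - Polynomial.C (x i))).roots =
        Finset.univ.val.map x := by
      intro x
      rw [← Polynomial.roots_multiset_prod_X_sub_C (Finset.univ.val.map x), Multiset.map_map]
      rfl
    rw [← h4, ← h4, h1]
  -- equal eigenvalues give equal values of `f`
  have key : ∀ i j, d j = e i → f (Fin.cons (d j) fun k => d (j.succAbove k)) =
      f (Fin.cons (e i) fun k => e (i.succAbove k)) := by
    intro i j hij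
    have split : ∀ (x : Spec n) (j : Fin (n + 1)), Finset.univ.val.map x =
        x j ::ₘ Finset.univ.val.map fun k => x (j.succAbove k) := by
      intro x j
      rw [Fin.univ_succAbove n j, Finset.cons_val, Multiset.map_cons, Finset.map_val,
        Multiset.map_map]
      rfl
    rw [split d j, split e i, hij] at hm
    have hm' := (Multiset.cons_inj_right _).1 hm
    have hcard : ∀ c : ℂ, Nonempty ({k // d (j.succAbove k) = c} ≃ {k // e (i.succAbove k) = c}) := by
      intro c
      have h5 := congrArg (Multiset.count c) hm'
      rw [Multiset.count_map, Multiset.count_map] at h5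
      refine ⟨Fintype.equivOfCardEq ?_⟩
      rw [Fintype.card_subtype, Fintype.card_subtype]
      simpa [Finset.card, Finset.filter_val, eq_comm] using h5
    let ec := fun c => (hcard c).some
    let σ : Equiv.Perm (Fin n) :=
      ((Equiv.sigmaFiberEquiv fun k => d (j.succAbove k)).symm.trans
        (Equiv.sigmaCongrRight ec)).trans (Equiv.sigmaFiberEquiv fun k => e (i.succAbove k))
    have hσ : (fun k => d (j.succAbove k)) = (fun k => e (i.succAbove k)) ∘ σ := by
      funext k
      exact ((ec (d (j.succAbove k))) ⟨k, rfl⟩).2.symm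
    rw [hσ, hij]
    exact hf σ _ _
  have hW : (Bᴴ * A) * Matrix.diagonal d = Matrix.diagonal e * (Bᴴ * A) := by
    calc (Bᴴ * A) * Matrix.diagonal d = Bᴴ * (A * Matrix.diagonal d * Aᴴ) * A := by
          simp only [mul_assoc, hU, mul_one]
      _ = Bᴴ * (B * Matrix.diagonal e * Bᴴ) * A := by rw [hs]
      _ = (Bᴴ * B) * Matrix.diagonal e * (Bᴴ * A) := by simp only [mul_assoc]
      _ = _ := by rw [hV, one_mul]
  have hW' : (Bᴴ * A) * sharpDiag f d = sharpDiag f e * (Bᴴ * A) := by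
    ext i j
    have h0 := congrFun (congrFun hW i) j
    rw [Matrix.mul_diagonal, Matrix.diagonal_mul] at h0
    rw [sharpDiag, sharpDiag, Matrix.mul_diagonal, Matrix.diagonal_mul]
    by_cases hz : (Bᴴ * A) i j = 0
    · rw [hz, zero_mul, mul_zero]
    · rw [key i j (mul_left_cancel₀ hz (by rw [h0, mul_comm])), mul_comm]
  calc B * sharpDiag f e * Bᴴ = B * (sharpDiag f e * (Bᴴ * A)) * Aᴴ := by
        simp only [mul_assoc, hU', mul_one]
    _ = (B * Bᴴ) * (A * sharpDiag f d * Aᴴ) := by rw [← hW']; simp only [mul_assoc]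
    _ = A * sharpDiag f d * Aᴴ := by rw [hV', one_mul]

/-- The spectral function `u^#(U D U^*) = U diag_j(u(d_j)) U^*` on the normal matrices of a
function `u` on `ℂ`; it is `f^#` for `f(d_1; d_2, …, d_N) = u(d_1)`. -/
def spectral (n : ℕ) (u : ℂ → ℂ) : Mat n → Mat n := sharp fun d : Spec n => u (d 0)

/-- `f^♭(z) = f(z; 0, …, 0)`. -/
def flat {n : ℕ} (f : Spec n → ℂ) (z : ℂ) : ℂ := f (Fin.cons z 0)

/-- The restriction of `φ` to the diagonal matrices is smooth, and each of its partial derivatives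
(of order `0, 1, 2, …`) is `O(exp(c ‖d‖²))` for some `c`. For `U`-invariant `φ = f^#` this says
that `f` is a smooth function on `ℂ^N` and that all its derivatives have this growth. -/
def IsSmoothOfGaussianGrowth {n : ℕ} (φ : Mat n → Mat n) : Prop :=
  ∀ a b, ContDiff ℝ ∞ (fun d : Spec n => φ (Matrix.diagonal d) a b) ∧
    ∀ k : ℕ, ∃ C c : ℝ, ∀ d : Spec n,
      ‖iteratedFDeriv ℝ k (fun d : Spec n => φ (Matrix.diagonal d) a b) d‖ ≤
        C * Real.exp (c * ∑ i, ‖d i‖ ^ 2)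

/-! ### Bidifferential operators, Poisson bracket -/

/-- The Wirtinger derivatives `∂/∂d_j` (for `(j, false)`) and `∂/∂d̄_j` (for `(j, true)`). -/
def wirtinger {n : ℕ} (p : Fin (n + 1) × Bool) (f : Spec n → ℂ) (d : Spec n) : ℂ :=
  (fderiv ℝ f d (Pi.single p.1 1) +
    (if p.2 then Complex.I else -Complex.I) * fderiv ℝ f d (Pi.single p.1 Complex.I)) / 2

/-- Iterated Wirtinger derivatives. -/
def iterWirtinger {n : ℕ} (l : List (Fin (n + 1) × Bool)) (f : Spec n → ℂ) : Spec n → ℂ :=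
  l.foldr wirtinger f

/-- `G` is a bidifferential operator on `ℂ^N`: on smooth functions it is a finite sum
`G(f, g) = ∑ a_{αβ} · D^α f · D^β g` with smooth coefficients `a_{αβ}`. -/
def IsBidifferential {n : ℕ} (G : (Spec n → ℂ) → (Spec n → ℂ) → Spec n → ℂ) : Prop :=
  ∃ (s : Finset (List (Fin (n + 1) × Bool) × List (Fin (n + 1) × Bool)))
    (a : List (Fin (n + 1) × Bool) × List (Fin (n + 1) × Bool) → Spec n → ℂ),
    (∀ p ∈ s, ContDiff ℝ ∞ (a p)) ∧
    ∀ f g : Spec n → ℂ, ContDiff ℝ ∞ f → ContDiff ℝ ∞ g → ∀ d,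
      G f g d = ∑ p ∈ s, a p d * iterWirtinger p.1 f d * iterWirtinger p.2 g d

/-- The Poisson bracket on `ℂ ≅ ℝ²`, `z = x + i y`, of the symplectic form
`ω = (i/2π) ∂∂̄|z|² = (1/π) dx ∧ dy`, namely `{u, v} = X_u v` where `ω(X_u, ·) = du`:
`{u, v} = π (∂u/∂y ∂v/∂x - ∂u/∂x ∂v/∂y) = 2πi (∂u ∂̄v - ∂̄u ∂v)`. -/
def poisson (u v : ℂ → ℂ) (z : ℂ) : ℂ :=
  Real.pi * (fderiv ℝ u z Complex.I * fderiv ℝ v z 1 - fderiv ℝ u z 1 * fderiv ℝ v z Complex.I)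

/-! ### The asymptotic expansion -/

/-- For all sufficiently small `h > 0`, every `K_{X,χ}` (`X` normal) lies in the domain of `T_φ`;
thus the Berezin transform of `T_φ` is defined for small `h`. -/
def ToeplitzDefined {n : ℕ} (φ : Mat n → Mat n) : Prop :=
  ∀ᶠ h in 𝓝[>] (0 : ℝ), ∀ X ∈ normalMatrices n, ∀ χ : Vec n, InDomain h φ (coherent h X χ)

/-- For all sufficiently small `h > 0`, every `K_{X,χ}` (`X` normal) lies in the domain of
`T_φ T_ψ`. -/
def ToeplitzProductDefined {n : ℕ} (φ ψ : Mat n → Mat n) : Prop :=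
  ∀ᶠ h in 𝓝[>] (0 : ℝ), ∀ X ∈ normalMatrices n, ∀ χ : Vec n,
    InDomain h ψ (coherent h X χ) ∧ InDomain h φ (toeplitz h ψ (coherent h X χ))

/-- The functions `u` on `ℂ` that are admitted as symbols `u^#`: smooth, and such that the Berezin
transform of `T_{u^#}` is defined for all small `h`. -/
def IsSpectralSymbol (n : ℕ) (u : ℂ → ℂ) : Prop :=
  ContDiff ℝ ∞ u ∧ ToeplitzDefined (spectral n u)

/-- The asymptotic expansion `Berezin(T_φ T_ψ) ≈ ∑_m h^m Berezin(T_{γ_m^#})` as `h ↘ 0`,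
at every point `X` of the domain (and in every matrix entry). -/
def HasExpansion {n : ℕ} (φ ψ : Mat n → Mat n) (γ : ℕ → ℂ → ℂ) : Prop :=
  ∀ X ∈ normalMatrices n, ∀ a b, ∀ M : ℕ,
    (fun h : ℝ => (berezin h (toeplitz h φ ∘ toeplitz h ψ) X -
      ∑ m ∈ Finset.range (M + 1), (h : ℂ) ^ m • berezin h (toeplitz h (spectral n (γ m))) X) a b)
      =O[𝓝[>] 0] fun h : ℝ => h ^ (M + 1)

end NormalMatrixQuantization

end

open NormalMatrixQuantization

noncomputable section

namespace NormalMatrixQuantization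

/-! ### Linear algebra of normal matrices -/

/-! Reduction to scalar Gaussian integrals. The map `(U, d) ↦ U^* diag(d) U` carries Haar measure
times the Gaussian measure to `μ_h`. A function `a` on `ℂ^N` and a vector `v` define the field `U^*
diag_j(a(d_j; …)) U v`, and by `integral_inner_sfield` the `L²` product of the fields of `(a, v)`
and `(b, w)` is `⟨v, w⟩ ∫ conj(a) b` over the Gaussian measure. Multiplication by `f^#` sends `(a,
v)` to `(f a, v)`; the function `Z^k χ` is the field of `(d_1^k, χ)`; and if `χ` is an eigenvector
of `X` with eigenvalue `x`, then `K_{X,χ}` is the field of `(exp(d_1 conj(x) / h), χ)`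
(`act_kernel_column`). Hence all Berezin transforms in question are diagonal in an eigenbasis of
`X`, with scalar integrals as entries. Translation to `x̂ = (x; 0, …, 0)` and rescaling by `t = √h`
turn the entry for `T_φ T_ψ` into `Ψ(f, g)(t) = ∬ f(x̂ + t p) g(x̂ + t q) ρ(p, q)`, where `ρ =
π^{-2N} exp(p_1 conj(q_1) - |p|² - |q|²)`; a single Toeplitz operator is the case `g = 1`.

The expansion. Differentiation in `t` and integration by parts against `ρ` give `Ψ' = 2t Ψ∘L`, where
`L(f ⊗ g) = Σ_i (Δ_i f ⊗ g + f ⊗ Δ_i g) + ∂̄_1 f ⊗ ∂_1 g` and `Δ_i = ∂_i ∂̄_i` (`hasDerivAt_Psi`).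
Formally `Ψ = exp(hL)(f ⊗ g)` at `x̂`, while a spectral symbol `u` contributes `exp(hΔ_1) u`. By the
Leibniz rule `L` differs from `Δ_1` of the product by `Σ_{i ≥ 2} (Δ_i ⊗ 1 + 1 ⊗ Δ_i) - ∂_1 ⊗ ∂̄_1`.
All these operators have constant coefficients and commute, so `exp(hΔ_1)` factors out, and `G_m(f,
g)` is the `m`-th power of this difference applied to `f ⊗ g`, multiplied out and divided by `m!`
(`coeff`). The recursion `succ_mul_coeff_add_mixed` makes the derivative of the `(M+1)`-st remainder
equal to `2t` times a sum of `M`-th remainders and a term of order `t^{2M}`; as the remainder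
vanishes at `t = 0`, induction gives order `t^{2M} = h^M` (`remainder_isBigO`). The bracket formula
can be read off from the term `-∂_1 f ∂̄_1 g` of `G_1`.

Domains. The symbols may grow like `exp(c |d|²)`, so `φ · T_ψ K` need not be square integrable
without an argument. For small `h` the Taylor coefficients of `T_ψ K` decay geometrically faster
than membership in `H_h` requires, and this beats the growth of `‖φ Z^k v‖`
(`exists_hasSum_act_projection`).

Uniqueness. The Berezin transform of `T_{u^#}` at `X = x · 1` tends to `u(x)` as `h ↘ 0` for every
admitted symbol, with no growth assumption beyond the existence of the transform
(`tendsto_berezin_spectral`). Two expansions can therefore be compared coefficient by coefficient.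
-/

instance instPolishSpaceMat (n : ℕ) : PolishSpace (Mat n) :=
  inferInstanceAs (PolishSpace (Fin (n + 1) → Fin (n + 1) → ℂ))

theorem act_apply {n : ℕ} (A : Mat n) (v : Vec n) (i : Fin (n + 1)) :
    act A v i = ∑ j, A i j * v j := rfl

theorem act_eq_toEuclideanLin {n : ℕ} (A : Mat n) (v : Vec n) :
    act A v = Matrix.toEuclideanLin A v := rfl

theorem act_act {n : ℕ} (A B : Mat n) (v : Vec n) : act A (act B v) = act (A * B) v := by
  simp [act, Matrix.mulVec_mulVec]

@[simp] theorem act_one {n : ℕ} (v : Vec n) : act (1 : Mat n) v = v := by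
  simp [act]

theorem act_smul {n : ℕ} (A : Mat n) (c : ℂ) (v : Vec n) : act A (c • v) = c • act A v := by
  simp only [act_eq_toEuclideanLin, map_smul]

theorem act_sum {n : ℕ} {ι : Type*} (A : Mat n) (s : Finset ι) (v : ι → Vec n) :
    act A (∑ i ∈ s, v i) = ∑ i ∈ s, act A (v i) := by
  simp only [act_eq_toEuclideanLin, map_sum]

theorem add_act {n : ℕ} (A B : Mat n) (v : Vec n) : act (A + B) v = act A v + act B v := by
  simp only [act_eq_toEuclideanLin, map_add, LinearMap.add_apply]

theorem smul_act {n : ℕ} (c : ℂ) (A : Mat n) (v : Vec n) : act (c • A) v = c • act A v := by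
  simp only [act_eq_toEuclideanLin, map_smul, LinearMap.smul_apply]

theorem inner_act_right {n : ℕ} (A : Mat n) (v w : Vec n) :
    ⟪v, act A w⟫_ℂ = ⟪act Aᴴ v, w⟫_ℂ := by
  rw [act_eq_toEuclideanLin, act_eq_toEuclideanLin, Matrix.toEuclideanLin_conjTranspose_eq_adjoint,
    LinearMap.adjoint_inner_left]

theorem continuous_act {n : ℕ} : Continuous fun p : Mat n × Vec n => act p.1 p.2 := by
  unfold act
  refine (PiLp.continuous_toLp 2 _).comp ?_
  exact Continuous.matrix_mulVec continuous_fst ((PiLp.continuous_ofLp 2 _).comp continuous_snd)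

theorem conjTranspose_mul_self {n : ℕ} (U : UN n) : (U : Mat n)ᴴ * (U : Mat n) = 1 :=
  Matrix.mem_unitaryGroup_iff'.1 U.2

theorem mul_conjTranspose_self {n : ℕ} (U : UN n) : (U : Mat n) * (U : Mat n)ᴴ = 1 :=
  Matrix.mem_unitaryGroup_iff.1 U.2

theorem conj_mul_conj {n : ℕ} (U : UN n) (A B : Mat n) :
    ((U : Mat n) * A * (U : Mat n)ᴴ) * ((U : Mat n) * B * (U : Mat n)ᴴ) =
      (U : Mat n) * (A * B) * (U : Mat n)ᴴ := by
  have h := conjTranspose_mul_self U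
  calc _ = (U : Mat n) * A * ((U : Mat n)ᴴ * (U : Mat n)) * (B * (U : Mat n)ᴴ) := by
        simp only [mul_assoc]
    _ = _ := by rw [h, mul_one]; simp only [mul_assoc]

theorem conj'_mul_conj' {n : ℕ} (U : UN n) (A B : Mat n) :
    ((U : Mat n)ᴴ * A * (U : Mat n)) * ((U : Mat n)ᴴ * B * (U : Mat n)) =
      (U : Mat n)ᴴ * (A * B) * (U : Mat n) := by
  have h := mul_conjTranspose_self U
  calc _ = (U : Mat n)ᴴ * A * ((U : Mat n) * (U : Mat n)ᴴ) * (B * (U : Mat n)) := by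
        simp only [mul_assoc]
    _ = _ := by rw [h, mul_one]; simp only [mul_assoc]

theorem conj_pow {n : ℕ} (U : UN n) (A : Mat n) (k : ℕ) :
    ((U : Mat n) * A * (U : Mat n)ᴴ) ^ k = (U : Mat n) * A ^ k * (U : Mat n)ᴴ := by
  induction k with
  | zero => simp [mul_conjTranspose_self]
  | succ k ih => rw [pow_succ, ih, conj_mul_conj, pow_succ]

theorem conj'_pow {n : ℕ} (U : UN n) (A : Mat n) (k : ℕ) :
    ((U : Mat n)ᴴ * A * (U : Mat n)) ^ k = (U : Mat n)ᴴ * A ^ k * (U : Mat n) := by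
  induction k with
  | zero => simp [conjTranspose_mul_self]
  | succ k ih => rw [pow_succ, ih, conj'_mul_conj', pow_succ]

theorem conj_diagonal_mem_normalMatrices {n : ℕ} (U : UN n) (d : Spec n) :
    (U : Mat n) * Matrix.diagonal d * (U : Mat n)ᴴ ∈ normalMatrices n := by
  have e : ((U : Mat n) * Matrix.diagonal d * (U : Mat n)ᴴ)ᴴ =
      (U : Mat n) * Matrix.diagonal (star d) * (U : Mat n)ᴴ := by
    simp only [Matrix.conjTranspose_mul, Matrix.conjTranspose_conjTranspose,
      Matrix.diagonal_conjTranspose, mul_assoc]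
  change _ * _ = _ * _
  rw [e, conj_mul_conj, conj_mul_conj, Matrix.diagonal_mul_diagonal, Matrix.diagonal_mul_diagonal]
  simp only [mul_comm]

theorem act_of_re_im {n : ℕ} {X : Mat n} {v : Vec n} {α β : ℂ} (h1 : act (X + Xᴴ) v = α • v)
    (h2 : act (Complex.I • (X - Xᴴ)) v = β • v) :
    act X v = ((α - Complex.I * β) / 2) • v := by
  have h3 : X = (2 : ℂ)⁻¹ • ((X + Xᴴ) + (-Complex.I) • (Complex.I • (X - Xᴴ))) := by
    rw [smul_smul, neg_mul, Complex.I_mul_I, neg_neg, one_smul, add_add_sub_cancel, ← two_smul ℂ,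
      smul_smul]
    norm_num
  rw [h3, smul_act, add_act, smul_act _ (Complex.I • (X - Xᴴ)), h1, h2, smul_smul, ← add_smul,
    smul_smul]
  congr 1
  ring

/-- Normal matrices are unitarily diagonalizable. -/
theorem exists_unitary_diagonal {n : ℕ} {X : Mat n} (hX : X ∈ normalMatrices n) :
    ∃ (V : UN n) (x : Spec n), X = (V : Mat n) * Matrix.diagonal x * (V : Mat n)ᴴ := by
  classical
  have hA : (X + Xᴴ).IsHermitian := by
    simp [Matrix.IsHermitian, add_comm]
  have hB : (Complex.I • (X - Xᴴ)).IsHermitian := by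
    simp only [Matrix.IsHermitian, Matrix.conjTranspose_smul, Matrix.conjTranspose_sub,
      Matrix.conjTranspose_conjTranspose, Complex.star_def, Complex.conj_I, smul_sub, neg_smul]
    abel
  -- Normality of `X` makes its two Hermitian parts commute, so they have a common orthonormal
  -- eigenbasis; its vectors become the columns of `V`.
  have hAB : Commute (Matrix.toEuclideanLin (X + Xᴴ))
      (Matrix.toEuclideanLin (Complex.I • (X - Xᴴ))) := by
    have h : (X + Xᴴ) * (Complex.I • (X - Xᴴ)) = (Complex.I • (X - Xᴴ)) * (X + Xᴴ) := by
      have hX' : Xᴴ * X = X * Xᴴ := hX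
      simp only [mul_smul_comm, smul_mul_assoc, add_mul, mul_add, mul_sub, sub_mul, hX']
      rw [← smul_add]
      congr 1
      abel
    refine LinearMap.ext fun v => ?_
    change act _ (act _ v) = act _ (act _ v)
    rw [act_act, act_act, h]
  have sA := Matrix.isSymmetric_toEuclideanLin_iff.2 hA
  have sB := Matrix.isSymmetric_toEuclideanLin_iff.2 hB
  have hI := LinearMap.IsSymmetric.directSum_isInternal_of_commute sA sB hAB
  have hO := LinearMap.IsSymmetric.orthogonalFamily_eigenspace_inf_eigenspace sA sB
  let w := fun i : ℂ × ℂ => stdOrthonormalBasis ℂ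
    ↥(Module.End.eigenspace (Matrix.toEuclideanLin (X + Xᴴ)) i.2 ⊓
      Module.End.eigenspace (Matrix.toEuclideanLin (Complex.I • (X - Xᴴ))) i.1)
  let b := hI.collectedBasis fun i => (w i).toBasis
  have hb : Orthonormal ℂ b := DirectSum.IsInternal.collectedBasis_orthonormal hO hI fun i => by
    rw [OrthonormalBasis.coe_toBasis]
    exact (w i).orthonormal
  have hmem : ∀ a, b a ∈ _ := fun a => DirectSum.IsInternal.collectedBasis_mem hI _ a
  let _ := FiniteDimensional.fintypeBasisIndex b
  have hc : Fintype.card (Fin (n + 1)) = Fintype.card ((i : ℂ × ℂ) × Fin (Module.finrank ℂ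
    ↥(Module.End.eigenspace (Matrix.toEuclideanLin (X + Xᴴ)) i.2 ⊓
      Module.End.eigenspace (Matrix.toEuclideanLin (Complex.I • (X - Xᴴ))) i.1))) := by
    rw [← Module.finrank_eq_card_basis b, finrank_euclideanSpace]
  let e := Fintype.equivOfCardEq hc
  let V : Mat n := Matrix.of fun i j => b (e j) i
  have hV : Vᴴ * V = 1 := by
    ext i j
    have h := orthonormal_iff_ite.1 (hb.comp e e.injective) i j
    rw [Matrix.one_apply, ← h]
    simp only [Matrix.mul_apply, Matrix.conjTranspose_apply, V, Matrix.of_apply,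
      PiLp.inner_apply, Function.comp, RCLike.inner_apply]
    exact Finset.sum_congr rfl fun k _ => mul_comm _ _
  have hVU : V ∈ Matrix.unitaryGroup (Fin (n + 1)) ℂ := Matrix.mem_unitaryGroup_iff'.2 hV
  -- With `A = X + X^*` and `B = i(X - X^*)` one has `X = (A - iB)/2`. The second component of the
  -- index is the eigenvalue of `A`, the first that of `B`.
  let x : Spec n := fun j => ((e j).1.2 - Complex.I * (e j).1.1) / 2
  have hXv : ∀ j, act X (b (e j)) = x j • b (e j) := by
    intro j
    have h1 := Module.End.mem_eigenspace_iff.1 (hmem (e j)).1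
    have h2 := Module.End.mem_eigenspace_iff.1 (hmem (e j)).2
    rw [← act_eq_toEuclideanLin] at h1 h2
    exact act_of_re_im h1 h2
  refine ⟨⟨V, hVU⟩, x, ?_⟩
  have h4 : X * V = V * Matrix.diagonal x := by
    ext i j
    have h := congrArg (fun v : Vec n => v i) (hXv j)
    simp only [act_apply, PiLp.smul_apply, smul_eq_mul] at h
    rw [Matrix.mul_diagonal, Matrix.mul_apply]
    simp only [V, Matrix.of_apply]
    rw [h, mul_comm]
  change X = V * Matrix.diagonal x * Vᴴ
  rw [← h4, mul_assoc, mul_eq_one_comm.1 hV, mul_one]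

theorem isUnit_conj_diagonal {n : ℕ} (V : UN n) {d : Spec n} (hd : ∀ j, d j ≠ 0) :
    IsUnit ((V : Mat n) * Matrix.diagonal d * (V : Mat n)ᴴ) := by
  refine IsUnit.of_mul_eq_one ((V : Mat n) * Matrix.diagonal d⁻¹ * (V : Mat n)ᴴ) ?_
  rw [conj_mul_conj, Matrix.diagonal_mul_diagonal]
  have : (fun i => d i * d⁻¹ i) = 1 := by
    funext i
    simp [hd i]
  rw [this, Pi.one_def, Matrix.diagonal_one, mul_one, mul_conjTranspose_self]

/-- The functional calculus of a unitarily diagonalized Hermitian matrix. -/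
theorem cfc_conj_diagonal {n : ℕ} (V : UN n) (r : Fin (n + 1) → ℝ) (f : ℝ → ℝ) :
    cfc f ((V : Mat n) * Matrix.diagonal (fun j => (r j : ℂ)) * (V : Mat n)ᴴ) =
      (V : Mat n) * Matrix.diagonal (fun j => (f (r j) : ℂ)) * (V : Mat n)ᴴ := by
  classical
  set A := (V : Mat n) * Matrix.diagonal (fun j => (r j : ℂ)) * (V : Mat n)ᴴ with hA
  have hsa : IsSelfAdjoint A := by
    rw [hA, isSelfAdjoint_iff, Matrix.star_eq_conjTranspose]
    simp only [Matrix.conjTranspose_mul, Matrix.conjTranspose_conjTranspose,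
      Matrix.diagonal_conjTranspose, mul_assoc]
    congr 3
    funext j
    simp
  -- The spectrum lies in `{r_j}`, so `f` may be replaced there by its interpolation polynomial, and
  -- polynomials pass through the conjugation by `V`.
  let p := Lagrange.interpolate (Finset.univ.image r) id f
  have hp : ∀ j, p.eval (r j) = f (r j) := fun j =>
    Lagrange.eval_interpolate_at_node f (Set.injOn_id _) (Finset.mem_image_of_mem r (Finset.mem_univ j))
  have hspec : Set.EqOn f (fun x => p.eval x) (spectrum ℝ A) := by
    intro l hl
    have hl' : ∃ j, l = r j := by
      by_contra hne
      push Not at hne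
      refine hl ?_
      have : algebraMap ℝ (Mat n) l - A =
          (V : Mat n) * Matrix.diagonal (fun j => (l : ℂ) - r j) * (V : Mat n)ᴴ := by
        have h1 : algebraMap ℝ (Mat n) l = (V : Mat n) * Matrix.diagonal (fun _ => (l : ℂ)) * (V : Mat n)ᴴ := by
          have : Matrix.diagonal (fun _ : Fin (n + 1) => (l : ℂ)) = (l : ℂ) • (1 : Mat n) := by
            rw [Matrix.smul_one_eq_diagonal]
          rw [this, mul_smul_comm, smul_mul_assoc, mul_one, mul_conjTranspose_self,
            Algebra.algebraMap_eq_smul_one]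
          rfl
        rw [h1, hA, ← sub_mul, ← mul_sub, Matrix.diagonal_sub]
      rw [spectrum.mem_resolventSet_iff, this]
      exact isUnit_conj_diagonal V fun j => sub_ne_zero.2 fun h => hne j (by exact_mod_cast h)
    obtain ⟨j, rfl⟩ := hl'
    exact (hp j).symm
  rw [cfc_congr hspec, cfc_polynomial p A hsa]
  have haeval : ∀ p : Polynomial ℝ, Polynomial.aeval A p =
      (V : Mat n) * Matrix.diagonal (fun j => ((p.eval (r j) : ℝ) : ℂ)) * (V : Mat n)ᴴ := by
    intro p
    induction p using Polynomial.induction_on' with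
    | add p q hp hq =>
      rw [map_add, hp, hq, ← add_mul, ← mul_add, Matrix.diagonal_add]
      simp
    | monomial k a =>
      rw [Polynomial.aeval_monomial, hA, conj_pow, Matrix.diagonal_pow, ← Algebra.smul_def,
        ← smul_mul_assoc, ← mul_smul_comm, ← Matrix.diagonal_smul]
      congr 3
      funext j
      simp
  rw [haeval p]
  simp only [hp]

/-! ### Gaussian integrals -/

/-- The squared Euclidean norm `∑ ‖d_i‖²`. -/
def nsq {n : ℕ} (d : Spec n) : ℝ := ∑ i, ‖d i‖ ^ 2

theorem nsq_nonneg {n : ℕ} (d : Spec n) : 0 ≤ nsq d :=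
  Finset.sum_nonneg fun _ _ => sq_nonneg _

theorem sq_norm_le_nsq {n : ℕ} (d : Spec n) (i : Fin (n + 1)) : ‖d i‖ ^ 2 ≤ nsq d :=
  Finset.single_le_sum (f := fun i => ‖d i‖ ^ 2) (fun _ _ => sq_nonneg _) (Finset.mem_univ i)

@[fun_prop] theorem continuous_nsq {n : ℕ} : Continuous (nsq (n := n)) := by
  unfold nsq
  fun_prop

/-- Read off from the closed formula for the integral: its value is positive, whereas the integral
of a non-integrable function is `0` by convention. -/
theorem integrable_pow_mul_exp_complex (k : ℕ) {α : ℝ} (hα : 0 < α) :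
    Integrable fun z : ℂ => ‖z‖ ^ (2 * k) * Real.exp (-α * ‖z‖ ^ 2) := by
  have h := Complex.integral_rpow_mul_exp_neg_mul_rpow (p := 2) (q := ((2 * k : ℕ) : ℝ)) (b := α)
    (by norm_num) (by have : (0 : ℝ) ≤ ((2 * k : ℕ) : ℝ) := Nat.cast_nonneg _; linarith) hα
  by_contra hc
  have h0 : ∫ z : ℂ, ‖z‖ ^ ((2 * k : ℕ) : ℝ) * Real.exp (-α * ‖z‖ ^ (2 : ℝ)) = 0 := by
    refine integral_undef fun h => hc ?_
    refine h.congr (ae_of_all _ fun z => ?_)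
    simp only [Real.rpow_natCast, Real.rpow_two]
  rw [h0] at h
  have : 0 < 2 * Real.pi / 2 * α ^ (-(((2 * k : ℕ) : ℝ) + 2) / 2) *
      Real.Gamma ((((2 * k : ℕ) : ℝ) + 2) / 2) := by
    have := Real.pi_pos
    have := Real.Gamma_pos_of_pos (s := (((2 * k : ℕ) : ℝ) + 2) / 2) (by positivity)
    positivity
  linarith

theorem integral_pow_mul_exp_complex (k : ℕ) {α : ℝ} (hα : 0 < α) :
    ∫ z : ℂ, ‖z‖ ^ (2 * k) * Real.exp (-α * ‖z‖ ^ 2) =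
      Real.pi * k.factorial * (α⁻¹) ^ (k + 1) := by
  have h := Complex.integral_rpow_mul_exp_neg_mul_rpow (p := 2) (q := ((2 * k : ℕ) : ℝ)) (b := α)
    (by norm_num) (by have : (0 : ℝ) ≤ ((2 * k : ℕ) : ℝ) := Nat.cast_nonneg _; linarith) hα
  simp only [Real.rpow_natCast, Real.rpow_two] at h
  rw [h]
  have e1 : (((2 * k : ℕ) : ℝ) + 2) / 2 = k + 1 := by push_cast; ring
  have e2 : -(((2 * k : ℕ) : ℝ) + 2) / 2 = -((k + 1 : ℕ) : ℝ) := by push_cast; ring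
  rw [e1, e2, Real.Gamma_nat_eq_factorial, Real.rpow_neg hα.le, Real.rpow_natCast, inv_pow]
  ring

theorem exp_neg_nsq {n : ℕ} (α : ℝ) (d : Spec n) :
    Real.exp (-α * nsq d) = ∏ i, Real.exp (-α * ‖d i‖ ^ 2) := by
  rw [nsq, Finset.mul_sum, Real.exp_sum]

theorem pow_mul_exp_neg_nsq {n : ℕ} (k : ℕ) (α : ℝ) (d : Spec n) :
    ‖d 0‖ ^ (2 * k) * Real.exp (-α * nsq d) =
      ∏ i, ‖d i‖ ^ (2 * (if i = 0 then k else 0)) * Real.exp (-α * ‖d i‖ ^ 2) := by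
  rw [Finset.prod_mul_distrib, ← exp_neg_nsq]
  congr 1
  rw [Fin.prod_univ_succ]
  simp

theorem integrable_pow_mul_exp {n : ℕ} (k : ℕ) {α : ℝ} (hα : 0 < α) :
    Integrable fun d : Spec n => ‖d 0‖ ^ (2 * k) * Real.exp (-α * nsq d) := by
  simp only [pow_mul_exp_neg_nsq]
  exact Integrable.fintype_prod (f := fun i z => ‖z‖ ^ (2 * (if i = 0 then k else 0)) *
    Real.exp (-α * ‖z‖ ^ 2)) fun i => integrable_pow_mul_exp_complex _ hα

theorem integral_pow_mul_exp {n : ℕ} (k : ℕ) {α : ℝ} (hα : 0 < α) :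
    ∫ d : Spec n, ‖d 0‖ ^ (2 * k) * Real.exp (-α * nsq d) =
      Real.pi ^ (n + 1) * k.factorial * (α⁻¹) ^ (k + n + 1) := by
  simp only [pow_mul_exp_neg_nsq]
  rw [integral_fintype_prod_volume_eq_prod (f := fun i z => ‖z‖ ^ (2 * (if i = 0 then k else 0)) *
    Real.exp (-α * ‖z‖ ^ 2))]
  simp only [integral_pow_mul_exp_complex _ hα]
  rw [Fin.prod_univ_succ]
  simp only [Fin.succ_ne_zero, if_true, if_false, Finset.prod_const, Finset.card_univ,
    Fintype.card_fin, Nat.factorial_zero, Nat.cast_one]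
  ring

theorem integrable_exp_nsq {n : ℕ} {α : ℝ} (hα : 0 < α) :
    Integrable fun d : Spec n => Real.exp (-α * nsq d) := by
  simpa using integrable_pow_mul_exp (n := n) 0 hα

theorem integral_exp_nsq {n : ℕ} {α : ℝ} (hα : 0 < α) :
    ∫ d : Spec n, Real.exp (-α * nsq d) = (Real.pi * α⁻¹) ^ (n + 1) := by
  simpa [mul_pow] using integral_pow_mul_exp (n := n) 0 hα

/-! ### The Gaussian measure -/

/-- The density of `gaussianSpec`. -/
def gaussDensity (n : ℕ) (h : ℝ) (d : Spec n) : ℝ :=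
  ((Real.pi * h) ^ (n + 1))⁻¹ * Real.exp (-h⁻¹ * nsq d)

@[fun_prop] theorem continuous_gaussDensity {n : ℕ} {h : ℝ} : Continuous (gaussDensity n h) := by
  unfold gaussDensity
  fun_prop

theorem gaussDensity_nonneg {n : ℕ} {h : ℝ} (hh : 0 < h) (d : Spec n) :
    0 ≤ gaussDensity n h d := by
  have := Real.pi_pos
  unfold gaussDensity
  positivity

theorem gaussianSpec_eq (n : ℕ) (h : ℝ) : gaussianSpec n h =
    (volume : Measure (Spec n)).withDensity fun d => ENNReal.ofReal (gaussDensity n h d) := by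
  unfold gaussianSpec gaussDensity nsq
  congr! 5 with d
  ring

theorem integral_gaussianSpec {n : ℕ} {h : ℝ} (hh : 0 < h) {E : Type*} [NormedAddCommGroup E]
    [NormedSpace ℝ E] (F : Spec n → E) :
    ∫ d, F d ∂gaussianSpec n h = ∫ d, gaussDensity n h d • F d := by
  rw [gaussianSpec_eq, integral_withDensity_eq_integral_toReal_smul (by fun_prop)
    (ae_of_all _ fun _ => ENNReal.ofReal_lt_top)]
  simp only [ENNReal.toReal_ofReal (gaussDensity_nonneg hh _)]

theorem integrable_gaussianSpec {n : ℕ} {h : ℝ} (hh : 0 < h) {E : Type*} [NormedAddCommGroup E]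
    [NormedSpace ℝ E] (F : Spec n → E) :
    Integrable F (gaussianSpec n h) ↔ Integrable fun d => gaussDensity n h d • F d := by
  rw [gaussianSpec_eq, integrable_withDensity_iff_integrable_smul' (by fun_prop)
    (ae_of_all _ fun _ => ENNReal.ofReal_lt_top)]
  simp only [ENNReal.toReal_ofReal (gaussDensity_nonneg hh _)]

theorem integral_gaussDensity {n : ℕ} {h : ℝ} (hh : 0 < h) : ∫ d, gaussDensity n h d = 1 := by
  unfold gaussDensity
  rw [integral_const_mul, integral_exp_nsq (inv_pos.2 hh), inv_inv]
  have := Real.pi_pos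
  exact inv_mul_cancel₀ (by positivity)

theorem gaussianSpec_absolutelyContinuous {n : ℕ} {h : ℝ} : gaussianSpec n h ≪ volume :=
  withDensity_absolutelyContinuous _ _

/-- `F = O(exp(c ‖d‖²))` on the whole space. -/
def Growth {n : ℕ} (c : ℝ) (F : Spec n → ℂ) : Prop :=
  ∃ C, ∀ d, ‖F d‖ ≤ C * Real.exp (c * nsq d)

theorem Growth.exists_nonneg {n : ℕ} {c : ℝ} {F : Spec n → ℂ} (hF : Growth c F) :
    ∃ C, 0 ≤ C ∧ ∀ d, ‖F d‖ ≤ C * Real.exp (c * nsq d) := by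
  obtain ⟨C, hC⟩ := hF
  refine ⟨|C|, abs_nonneg _, fun d => (hC d).trans ?_⟩
  gcongr
  exact le_abs_self C

theorem Growth.mono {n : ℕ} {c c' : ℝ} {F : Spec n → ℂ} (hF : Growth c F) (h : c ≤ c') :
    Growth c' F := by
  obtain ⟨C, hC0, hC⟩ := hF.exists_nonneg
  refine ⟨C, fun d => (hC d).trans ?_⟩
  have := nsq_nonneg d
  gcongr

theorem Growth.mul {n : ℕ} {c c' : ℝ} {F G : Spec n → ℂ} (hF : Growth c F) (hG : Growth c' G) :
    Growth (c + c') fun d => F d * G d := by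
  obtain ⟨C, hC0, hC⟩ := hF.exists_nonneg
  obtain ⟨C', hC0', hC'⟩ := hG.exists_nonneg
  refine ⟨C * C', fun d => ?_⟩
  rw [norm_mul, add_mul, Real.exp_add]
  calc ‖F d‖ * ‖G d‖ ≤ (C * Real.exp (c * nsq d)) * (C' * Real.exp (c' * nsq d)) := by
        gcongr
        exacts [hC d, hC' d]
    _ = _ := by ring

theorem Growth.conj {n : ℕ} {c : ℝ} {F : Spec n → ℂ} (hF : Growth c F) :
    Growth c fun d => (starRingEnd ℂ) (F d) := by
  obtain ⟨C, hC⟩ := hF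
  exact ⟨C, fun d => by simpa using hC d⟩

/-- Young's inequality `|d_1||y| ≤ |y|²/(4ε) + ε|d_1|²`. As `ε` is arbitrary, exponentials cost
nothing in the comparison with the Gaussian weight. -/
theorem growth_exp {n : ℕ} (y : ℂ) {ε : ℝ} (hε : 0 < ε) :
    Growth ε fun d : Spec n => Complex.exp (d 0 * y) := by
  refine ⟨Real.exp (‖y‖ ^ 2 / (4 * ε)), fun d => ?_⟩
  rw [Complex.norm_exp, ← Real.exp_add]
  refine Real.exp_le_exp.2 ?_
  have h1 : (d 0 * y).re ≤ ‖d 0‖ * ‖y‖ := by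
    rw [← norm_mul]
    exact Complex.re_le_norm _
  have h2 : ‖d 0‖ * ‖y‖ ≤ ‖y‖ ^ 2 / (4 * ε) + ε * ‖d 0‖ ^ 2 := by
    have h3 : ‖y‖ ^ 2 / (4 * ε) + ε * ‖d 0‖ ^ 2 - ‖d 0‖ * ‖y‖ =
        (‖y‖ - 2 * ε * ‖d 0‖) ^ 2 / (4 * ε) := by
      field_simp
      ring
    have : 0 ≤ (‖y‖ - 2 * ε * ‖d 0‖) ^ 2 / (4 * ε) := by positivity
    linarith
  have h4 : ε * ‖d 0‖ ^ 2 ≤ ε * nsq d := by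
    gcongr
    exact sq_norm_le_nsq d 0
  linarith

theorem growth_pow {n : ℕ} (k : ℕ) {ε : ℝ} (hε : 0 < ε) :
    Growth ε fun d : Spec n => d 0 ^ k := by
  obtain ⟨C, hC⟩ : ∃ C, ∀ t : ℝ, 0 ≤ t → t ^ k ≤ C * Real.exp (ε * t ^ 2) := by
    refine ⟨1 + k.factorial * (ε⁻¹) ^ k, fun t ht => ?_⟩
    have h1 : t ^ k ≤ 1 + (t ^ 2) ^ k := by
      rcases le_total t 1 with h | h
      · have := pow_le_one₀ (n := k) ht h
        have : 0 ≤ (t ^ 2) ^ k := by positivity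
        linarith
      · have : t ^ k ≤ (t ^ 2) ^ k := pow_le_pow_left₀ ht (by nlinarith) k
        linarith
    have h2 : (ε * t ^ 2) ^ k / k.factorial ≤ Real.exp (ε * t ^ 2) :=
      Real.pow_div_factorial_le_exp _ (by positivity) k
    have h3 : (1 : ℝ) ≤ Real.exp (ε * t ^ 2) := Real.one_le_exp (by positivity)
    have h4 : (t ^ 2) ^ k = k.factorial * (ε⁻¹) ^ k * ((ε * t ^ 2) ^ k / k.factorial) := by
      rw [mul_pow, inv_pow]
      field_simp
    have h5 : (t ^ 2) ^ k ≤ k.factorial * (ε⁻¹) ^ k * Real.exp (ε * t ^ 2) := by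
      rw [h4]
      gcongr
    linarith
  have hC0 : 0 ≤ C := by
    have := hC 0 le_rfl
    have h0 : (0 : ℝ) ≤ 0 ^ k := by positivity
    simpa using h0.trans this
  refine ⟨C, fun d => ?_⟩
  rw [norm_pow]
  refine (hC _ (norm_nonneg _)).trans ?_
  gcongr
  exact sq_norm_le_nsq d 0

theorem Growth.integrable {n : ℕ} {h c : ℝ} (hh : 0 < h) (hc : c < h⁻¹) {F : Spec n → ℂ}
    (hFm : AEStronglyMeasurable F) (hF : Growth c F) : Integrable F (gaussianSpec n h) := by
  obtain ⟨C, hC0, hC⟩ := hF.exists_nonneg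
  rw [integrable_gaussianSpec hh]
  refine (((integrable_exp_nsq (n := n) (sub_pos.2 hc)).const_mul
    (((Real.pi * h) ^ (n + 1))⁻¹ * C))).mono' ?_ (ae_of_all _ fun d => ?_)
  · exact continuous_gaussDensity.aestronglyMeasurable.smul hFm
  · rw [norm_smul, Real.norm_of_nonneg (gaussDensity_nonneg hh d)]
    calc gaussDensity n h d * ‖F d‖ ≤ gaussDensity n h d * (C * Real.exp (c * nsq d)) := by
          have := gaussDensity_nonneg hh d
          gcongr
          exact hC d
      _ = ((Real.pi * h) ^ (n + 1))⁻¹ * C * (Real.exp (-h⁻¹ * nsq d) * Real.exp (c * nsq d)) := by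
          unfold gaussDensity
          ring
      _ = _ := by
          rw [← Real.exp_add]
          congr 2
          ring

theorem Growth.memLp {n : ℕ} {h c : ℝ} (hh : 0 < h) (hc : c + c < h⁻¹) {F : Spec n → ℂ}
    (hFm : AEStronglyMeasurable F) (hF : Growth c F) : MemLp F 2 (gaussianSpec n h) := by
  rw [memLp_two_iff_integrable_sq_norm (hFm.mono_ac gaussianSpec_absolutelyContinuous)]
  have := ((hF.mul hF).integrable hh hc (hFm.mul hFm)).norm
  refine this.congr (ae_of_all _ fun d => ?_)
  simp only [Pi.mul_apply, norm_mul, sq]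

/-! ### Moments -/

/-- Rotation of `d_1` preserves the Gaussian and multiplies the integral by a nontrivial character
of the circle. -/
theorem integral_conj_pow_mul_pow_of_ne {n : ℕ} {h : ℝ} (hh : 0 < h) {k l : ℕ} (hkl : k ≠ l) :
    ∫ d : Spec n, (starRingEnd ℂ) (d 0 ^ k) * d 0 ^ l ∂gaussianSpec n h = 0 := by
  have hz : ∀ α : ℝ, ∫ z : ℂ, (starRingEnd ℂ) (z ^ k) * z ^ l * Complex.exp (-α * ‖z‖ ^ 2) = 0 := by
    intro α
    set I := ∫ z : ℂ, (starRingEnd ℂ) (z ^ k) * z ^ l * Complex.exp (-α * ‖z‖ ^ 2) with hI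
    have hrot : ∀ a : Circle, I = (starRingEnd ℂ) ((a : ℂ) ^ k) * (a : ℂ) ^ l * I := by
      intro a
      have := ((rotation a).measurePreserving).integral_comp
        (rotation a).toHomeomorph.measurableEmbedding
        (fun z : ℂ => (starRingEnd ℂ) (z ^ k) * z ^ l * Complex.exp (-α * ‖z‖ ^ 2))
      rw [← hI] at this
      nth_rewrite 1 [← this]
      rw [hI, ← integral_const_mul]
      refine integral_congr_ae (ae_of_all _ fun z => ?_)
      simp only [rotation_apply, mul_pow, map_mul, norm_mul, Circle.norm_coe, one_mul]
      ring
    by_contra hne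
    have h1 : ∀ a : Circle, (a : ℂ) ^ k = (a : ℂ) ^ l := by
      intro a
      have h2 : (starRingEnd ℂ) ((a : ℂ) ^ k) * (a : ℂ) ^ l = 1 :=
        (mul_eq_right₀ hne).1 (hrot a).symm
      have h3 : (a : ℂ) ^ k * (starRingEnd ℂ) ((a : ℂ) ^ k) = 1 := by
        rw [Complex.mul_conj, map_pow]
        simp
      calc (a : ℂ) ^ k = (a : ℂ) ^ k * ((starRingEnd ℂ) ((a : ℂ) ^ k) * (a : ℂ) ^ l) := by
            rw [h2, mul_one]
        _ = _ := by rw [← mul_assoc, h3, one_mul]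
    -- Rotation by one radian suffices: `exp(ik) = exp(il)` with `k ≠ l` would make `π` rational.
    have h4 := h1 (Circle.exp 1)
    rw [← Circle.coe_pow, ← Circle.coe_pow, ← Circle.exp_nsmul, ← Circle.exp_nsmul] at h4
    have h5 : Circle.exp (k • 1) = Circle.exp (l • 1) := Circle.coe_injective h4
    rw [Circle.exp_eq_exp] at h5
    obtain ⟨m, hm⟩ := h5
    simp only [nsmul_eq_mul, mul_one] at hm
    rcases eq_or_ne m 0 with rfl | hm0
    · simp only [Int.cast_zero, zero_mul, add_zero, Nat.cast_inj] at hm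
      exact hkl hm
    · have hpi : Real.pi = ((k : ℚ) - l) / (2 * m) := by
        have : (m : ℝ) ≠ 0 := by exact_mod_cast hm0
        push_cast
        field_simp
        linarith
      exact irrational_pi ⟨((k : ℚ) - l) / (2 * m), by rw [hpi]; push_cast; ring⟩
  rw [integral_gaussianSpec hh]
  have e : ∀ d : Spec n, gaussDensity n h d • ((starRingEnd ℂ) (d 0 ^ k) * d 0 ^ l) =
      ((((Real.pi * h) ^ (n + 1))⁻¹ : ℝ) : ℂ) * ∏ i, (if i = 0 then (starRingEnd ℂ) (d i ^ k) * d i ^ l else 1) *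
        Complex.exp (-(h⁻¹ : ℝ) * ‖d i‖ ^ 2) := by
    intro d
    rw [Finset.prod_mul_distrib, Complex.real_smul, gaussDensity, exp_neg_nsq]
    rw [Fin.prod_univ_succ (fun i => if i = 0 then (starRingEnd ℂ) (d i ^ k) * d i ^ l else 1)]
    simp only [Fin.succ_ne_zero, if_true, if_false, Finset.prod_const_one, mul_one]
    push_cast
    ring
  simp only [e]
  rw [integral_const_mul, integral_fintype_prod_volume_eq_prod (f := fun i z =>
    (if i = 0 then (starRingEnd ℂ) (z ^ k) * z ^ l else 1) * Complex.exp (-(h⁻¹ : ℝ) * ‖z‖ ^ 2)),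
    Fin.prod_univ_succ]
  simp only [if_true]
  rw [hz, zero_mul, mul_zero]

theorem integral_norm_pow_gaussianSpec {n : ℕ} {h : ℝ} (hh : 0 < h) (k : ℕ) :
    ∫ d : Spec n, ‖d 0‖ ^ (2 * k) ∂gaussianSpec n h = k.factorial * h ^ k := by
  rw [integral_gaussianSpec hh]
  have e : ∀ d : Spec n, gaussDensity n h d • ‖d 0‖ ^ (2 * k) =
      ((Real.pi * h) ^ (n + 1))⁻¹ * (‖d 0‖ ^ (2 * k) * Real.exp (-h⁻¹ * nsq d)) := by
    intro d
    rw [gaussDensity, smul_eq_mul]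
    ring
  simp only [e]
  rw [integral_const_mul, integral_pow_mul_exp k (inv_pos.2 hh), inv_inv]
  have := Real.pi_pos
  field_simp
  ring

theorem integral_conj_pow_mul_pow {n : ℕ} {h : ℝ} (hh : 0 < h) (k l : ℕ) :
    ∫ d : Spec n, (starRingEnd ℂ) (d 0 ^ k) * d 0 ^ l ∂gaussianSpec n h =
      if k = l then (k.factorial : ℂ) * (h : ℂ) ^ k else 0 := by
  split_ifs with hkl
  · subst hkl
    have := congrArg (fun r : ℝ => (r : ℂ)) (integral_norm_pow_gaussianSpec (n := n) hh k)
    push_cast at this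
    rw [← this, ← integral_complex_ofReal]
    refine integral_congr_ae (ae_of_all _ fun d => ?_)
    simp only [map_pow, ← mul_pow, Complex.ofReal_pow, pow_mul, Complex.conj_mul']
  · exact integral_conj_pow_mul_pow_of_ne hh hkl

/-- A moment bound that decays faster than `√(k! h^k)`. -/
theorem Growth.exists_moment_bound {n : ℕ} {h c : ℝ} (hh : 0 < h) (hc : c ≤ h⁻¹ / 8)
    {b : Spec n → ℂ} (hb : Growth c b) :
    ∃ C, 0 ≤ C ∧ ∀ k : ℕ, ∫ d, ‖d 0 ^ k * b d‖ ∂gaussianSpec n h ≤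
      C * √(k.factorial * (2 * h / 3) ^ k) := by
  obtain ⟨C, hC0, hC⟩ := (hb.mono hc).exists_nonneg
  have hpi := Real.pi_pos
  set D := ((Real.pi * h) ^ (n + 1))⁻¹ * C with hD
  refine ⟨D * ((Real.pi * (2 * h / 3)) ^ (n + 1) + (Real.pi * (4 * h)) ^ (n + 1)), by positivity,
    fun k => ?_⟩
  have hhi := inv_pos.2 hh
  -- This is the weight in `u v ≤ s⁻¹ u² + s v²`. The integral of `u²` is a constant times `s²`, so
  -- both terms integrate to constant multiples of `s`.
  set s := √(k.factorial * (2 * h / 3) ^ k) with hs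
  have hs0 : 0 < s := Real.sqrt_pos.2 (by positivity)
  have hs2 : k.factorial * (2 * h / 3) ^ k = s ^ 2 := (Real.sq_sqrt (by positivity)).symm
  have i1 := integrable_pow_mul_exp (n := n) k (α := 3 / 2 * h⁻¹) (by positivity)
  have i2 := integrable_exp_nsq (n := n) (α := 1 / 4 * h⁻¹) (by positivity)
  rw [integral_gaussianSpec hh]
  calc ∫ d : Spec n, gaussDensity n h d • ‖d 0 ^ k * b d‖ ≤
      ∫ d : Spec n, D * (s⁻¹ * (‖d 0‖ ^ (2 * k) * Real.exp (-(3 / 2 * h⁻¹) * nsq d)) +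
        s * Real.exp (-(1 / 4 * h⁻¹) * nsq d)) := by
        refine integral_mono_of_nonneg (ae_of_all _ fun d => ?_)
          (((i1.const_mul s⁻¹).add (i2.const_mul s)).const_mul D) (ae_of_all _ fun d => ?_)
        · exact smul_nonneg (gaussDensity_nonneg hh d) (norm_nonneg _)
        · dsimp only
          have h1 : gaussDensity n h d • ‖d 0 ^ k * b d‖ ≤
              gaussDensity n h d * (‖d 0‖ ^ k * (C * Real.exp (h⁻¹ / 8 * nsq d))) := by
            rw [norm_mul, norm_pow, smul_eq_mul]
            have := gaussDensity_nonneg hh d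
            gcongr
            exact hC d
          refine h1.trans ?_
          -- The exponent left over is `1 - 1/8 = 3/4 + 1/8`. Squaring `u` gives the rate `3/2 · h⁻¹
          -- > h⁻¹`, which is the source of the gain `2/3`; the remaining `1/8` keeps `v²`
          -- integrable.
          set u := ‖d 0‖ ^ k * Real.exp (-(3 / 4 * h⁻¹) * nsq d) with hu
          set v := Real.exp (-(1 / 8 * h⁻¹) * nsq d) with hv
          have h2 : gaussDensity n h d * (‖d 0‖ ^ k * (C * Real.exp (h⁻¹ / 8 * nsq d))) =
              D * (u * v) := by
            rw [gaussDensity, hD, hu, hv, mul_assoc (‖d 0‖ ^ k), ← Real.exp_add]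
            calc _ = ((Real.pi * h) ^ (n + 1))⁻¹ * C * (‖d 0‖ ^ k *
                (Real.exp (-h⁻¹ * nsq d) * Real.exp (h⁻¹ / 8 * nsq d))) := by ring
              _ = _ := by
                rw [← Real.exp_add]
                congr 3
                ring
          have h3 : ‖d 0‖ ^ (2 * k) * Real.exp (-(3 / 2 * h⁻¹) * nsq d) = u ^ 2 := by
            rw [hu, mul_pow, ← pow_mul, mul_comm k 2, ← Real.exp_nat_mul]
            congr 2
            push_cast
            ring
          have h4 : Real.exp (-(1 / 4 * h⁻¹) * nsq d) = v ^ 2 := by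
            rw [hv, ← Real.exp_nat_mul]
            congr 1
            push_cast
            ring
          rw [h2, h3, h4]
          refine mul_le_mul_of_nonneg_left ?_ (by positivity)
          have h5 : s⁻¹ * u ^ 2 + s * v ^ 2 - u * v = s⁻¹ * ((u - s * v / 2) ^ 2 + 3 / 4 * (s * v) ^ 2) := by
            field_simp
            ring
          have : 0 ≤ s⁻¹ * ((u - s * v / 2) ^ 2 + 3 / 4 * (s * v) ^ 2) := by positivity
          linarith
    _ = _ := by
        rw [integral_const_mul, integral_add (i1.const_mul _) (i2.const_mul _), integral_const_mul,
          integral_const_mul, integral_pow_mul_exp k (by positivity), integral_exp_nsq (by positivity)]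
        have e1 : (3 / 2 * h⁻¹)⁻¹ = 2 * h / 3 := by field_simp
        have e2 : (1 / 4 * h⁻¹)⁻¹ = 4 * h := by field_simp
        rw [e1, e2, add_assoc, pow_add (2 * h / 3)]
        have e3 : s⁻¹ * (Real.pi ^ (n + 1) * k.factorial * ((2 * h / 3) ^ k * (2 * h / 3) ^ (n + 1))) =
            s⁻¹ * (k.factorial * (2 * h / 3) ^ k) * (Real.pi * (2 * h / 3)) ^ (n + 1) := by
          rw [mul_pow]
          ring
        rw [e3, hs2]
        field_simp

/-- Squaring `f` costs `h⁻¹/8` of the Gaussian rate, so `7/8 · h⁻¹` remains. The resulting loss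
`8/7` is compensated by the gain `2/3` of `Growth.exists_moment_bound`. -/
theorem Growth.exists_sq_moment_bound {n : ℕ} {h c : ℝ} (hh : 0 < h) (hc : c ≤ h⁻¹ / 16)
    {f : Spec n → ℂ} (hf : Growth c f) :
    ∃ C, 0 ≤ C ∧ ∀ k : ℕ, ∫ d, ‖f d * d 0 ^ k‖ ^ 2 ∂gaussianSpec n h ≤
      C * (k.factorial * (8 * h / 7) ^ k) := by
  obtain ⟨C, hC0, hC⟩ := (hf.mono hc).exists_nonneg
  have hpi := Real.pi_pos
  have hhi := inv_pos.2 hh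
  refine ⟨((Real.pi * h) ^ (n + 1))⁻¹ * C ^ 2 * (Real.pi * (8 * h / 7)) ^ (n + 1), by positivity,
    fun k => ?_⟩
  have i1 := integrable_pow_mul_exp (n := n) k (α := 7 / 8 * h⁻¹) (by positivity)
  rw [integral_gaussianSpec hh]
  calc ∫ d : Spec n, gaussDensity n h d • ‖f d * d 0 ^ k‖ ^ 2 ≤
      ∫ d : Spec n, ((Real.pi * h) ^ (n + 1))⁻¹ * C ^ 2 *
        (‖d 0‖ ^ (2 * k) * Real.exp (-(7 / 8 * h⁻¹) * nsq d)) := by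
        refine integral_mono_of_nonneg (ae_of_all _ fun d => ?_) (i1.const_mul _)
          (ae_of_all _ fun d => ?_)
        · exact smul_nonneg (gaussDensity_nonneg hh d) (by positivity)
        · dsimp only
          rw [smul_eq_mul, norm_mul, norm_pow]
          calc gaussDensity n h d * (‖f d‖ * ‖d 0‖ ^ k) ^ 2 ≤
              gaussDensity n h d * ((C * Real.exp (h⁻¹ / 16 * nsq d)) * ‖d 0‖ ^ k) ^ 2 := by
                have := gaussDensity_nonneg hh d
                gcongr
                exact hC d
            _ = ((Real.pi * h) ^ (n + 1))⁻¹ * C ^ 2 * (‖d 0‖ ^ (2 * k) *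
                (Real.exp (-h⁻¹ * nsq d) * Real.exp (h⁻¹ / 16 * nsq d) ^ 2)) := by
                rw [gaussDensity]
                ring
            _ = _ := by
                rw [← Real.exp_nat_mul, ← Real.exp_add]
                congr 4
                push_cast
                ring
    _ = _ := by
        rw [integral_const_mul, integral_pow_mul_exp k (by positivity)]
        have e1 : (7 / 8 * h⁻¹)⁻¹ = 8 * h / 7 := by field_simp
        rw [e1, add_assoc, pow_add (8 * h / 7), mul_pow Real.pi (8 * h / 7)]
        ring

/-! ### Polar coordinates on the normal matrices -/

/-- The map `(U, d) ↦ U^* diag(d) U`. -/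
def diagMap {n : ℕ} (p : UN n × Spec n) : Mat n :=
  ((p.1 : Mat n))ᴴ * Matrix.diagonal p.2 * (p.1 : Mat n)

/-- The product measure whose image under `diagMap` is `mu`. -/
def nu (n : ℕ) (h : ℝ) : Measure (UN n × Spec n) := (haarUN n).prod (gaussianSpec n h)

theorem mu_eq (n : ℕ) (h : ℝ) : mu n h = (nu n h).map diagMap := rfl

@[fun_prop] theorem continuous_diagMap {n : ℕ} : Continuous (diagMap (n := n)) := by
  unfold diagMap
  refine Continuous.mul (Continuous.mul ?_ ?_) ?_
  · exact (continuous_subtype_val.comp continuous_fst).matrix_conjTranspose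
  · exact continuous_snd.matrix_diagonal
  · exact continuous_subtype_val.comp continuous_fst

theorem measurable_diagMap {n : ℕ} : Measurable (diagMap (n := n)) :=
  continuous_diagMap.measurable

theorem coe_inv_UN {n : ℕ} (U : UN n) : ((U⁻¹ : UN n) : Mat n) = (U : Mat n)ᴴ := rfl

theorem range_diagMap {n : ℕ} : Set.range (diagMap (n := n)) = normalMatrices n := by
  ext X
  constructor
  · rintro ⟨⟨U, d⟩, rfl⟩
    have := conj_diagonal_mem_normalMatrices U⁻¹ d
    rwa [coe_inv_UN, Matrix.conjTranspose_conjTranspose] at this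
  · intro hX
    obtain ⟨V, x, rfl⟩ := exists_unitary_diagonal hX
    refine ⟨(V⁻¹, x), ?_⟩
    rw [diagMap, coe_inv_UN, Matrix.conjTranspose_conjTranspose]

theorem isClosed_normalMatrices {n : ℕ} : IsClosed (normalMatrices n) :=
  isClosed_eq (by fun_prop) (by fun_prop)

instance instPolishSpaceUN (n : ℕ) : PolishSpace (UN n) := by
  refine IsClosed.polishSpace (α := Mat n) ?_
  have e : (Matrix.unitaryGroup (Fin (n + 1)) ℂ : Set (Mat n)) = {A : Mat n | A * star A = 1} := by
    ext A
    exact Matrix.mem_unitaryGroup_iff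
  change IsClosed (Matrix.unitaryGroup (Fin (n + 1)) ℂ : Set (Mat n))
  rw [e]
  exact isClosed_eq (by fun_prop) continuous_const

instance instIsProbabilityMeasureHaarUN (n : ℕ) : IsProbabilityMeasure (haarUN n) :=
  ⟨Measure.haarMeasure_self (K₀ := (⊤ : TopologicalSpace.PositiveCompacts (UN n)))⟩

instance instIsHaarMeasureHaarUN (n : ℕ) : (haarUN n).IsHaarMeasure :=
  Measure.isHaarMeasure_haarMeasure _

instance instSFiniteGaussianSpec (n : ℕ) (h : ℝ) : SFinite (gaussianSpec n h) := by
  unfold gaussianSpec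
  infer_instance

theorem ae_mem_normalMatrices {n : ℕ} {h : ℝ} : ∀ᵐ Z ∂mu n h, Z ∈ normalMatrices n := by
  rw [mu_eq, ae_map_iff (p := fun Z => Z ∈ normalMatrices n) measurable_diagMap.aemeasurable
    isClosed_normalMatrices.measurableSet]
  refine ae_of_all _ fun p => ?_
  rw [← range_diagMap]
  exact Set.mem_range_self p

/-- A function on the matrices is `mu`-measurable if it is measurable in polar coordinates. -/
theorem aemeasurable_of_comp_diagMap {n : ℕ} {h : ℝ} {β : Type*} [MeasurableSpace β]
    {F : Mat n → β} (hF : Measurable (F ∘ diagMap)) : AEMeasurable F (mu n h) := by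
  let r : UN n × Spec n → Set.range (diagMap (n := n)) := Set.rangeFactorization diagMap
  have hr : Measurable r := measurable_diagMap.subtype_mk
  have h1 : Measurable ((F ∘ Subtype.val) ∘ r) := hF
  -- Measurability descends along a surjective Borel map out of a standard Borel space. This
  -- replaces a measurable choice of diagonalizations: `sharp` picks one arbitrarily, yet is
  -- continuous in polar coordinates for continuous symbols that are symmetric in the tail.
  have h2 : Measurable (F ∘ (Subtype.val : Set.range (diagMap (n := n)) → Mat n)) :=
    (hr.measurable_comp_iff_of_surjective Set.rangeFactorization_surjective).1 h1
  have h3 : MeasurableSet (Set.range (diagMap (n := n))) := by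
    rw [range_diagMap]
    exact isClosed_normalMatrices.measurableSet
  have h4 : AEMeasurable F ((mu n h).restrict (Set.range (diagMap (n := n)))) :=
    aemeasurable_restrict_of_measurable_subtype h3 h2
  rwa [Measure.restrict_eq_self_of_ae_mem] at h4
  rw [range_diagMap]
  exact ae_mem_normalMatrices

/-! ### Averaging over the unitary group -/

theorem continuous_act_UN {n : ℕ} (v : Vec n) (k : Fin (n + 1)) :
    Continuous fun U : UN n => act (U : Mat n) v k := by
  simp only [act_apply]
  refine continuous_finsetSum _ fun j _ => Continuous.mul ?_ continuous_const
  exact continuous_subtype_val.matrix_elem k j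

theorem integrable_haarUN {n : ℕ} {E : Type*} [NormedAddCommGroup E] {F : UN n → E}
    (hF : Continuous F) : Integrable F (haarUN n) :=
  hF.integrable_of_hasCompactSupport (HasCompactSupport.of_compactSpace F)

theorem norm_act_UN {n : ℕ} (U : UN n) (v w : Vec n) :
    ⟪act (U : Mat n) v, act (U : Mat n) w⟫_ℂ = ⟪v, w⟫_ℂ := by
  rw [inner_act_right, act_act, conjTranspose_mul_self, act_one]

theorem inner_eq_sum {n : ℕ} (v w : Vec n) : ⟪v, w⟫_ℂ = ∑ k, (starRingEnd ℂ) (v k) * w k := by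
  rw [PiLp.inner_apply]
  exact Finset.sum_congr rfl fun k _ => mul_comm _ _

/-- Haar measure is invariant under left translation by the permutation matrix of the transposition
of `k` and `l`. -/
theorem integral_haarUN_swap {n : ℕ} (v w : Vec n) (k l : Fin (n + 1)) :
    ∫ U : UN n, (starRingEnd ℂ) (act (U : Mat n) v k) * act (U : Mat n) w k ∂haarUN n =
      ∫ U : UN n, (starRingEnd ℂ) (act (U : Mat n) v l) * act (U : Mat n) w l ∂haarUN n := by
  let P : Mat n := (Equiv.swap k l).permMatrix ℂ
  have hP : P ∈ Matrix.unitaryGroup (Fin (n + 1)) ℂ := by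
    rw [Matrix.mem_unitaryGroup_iff, Matrix.star_eq_conjTranspose, Matrix.conjTranspose_permMatrix,
      ← Matrix.permMatrix_mul]
    simp
  have hact : ∀ (A : Mat n) (u : Vec n), act (P * A) u k = act A u l := by
    intro A u
    rw [← act_act, act, act]
    change (P *ᵥ _) k = _
    rw [Matrix.permMatrix_mulVec]
    simp
  rw [← integral_mul_left_eq_self _ (⟨P, hP⟩ : UN n)]
  refine integral_congr_ae (ae_of_all _ fun U => ?_)
  dsimp only
  rw [Submonoid.coe_mul, hact, hact]

/-- Summed over `k` the integrand is `⟨U v, U w⟩ = ⟨v, w⟩`, and the `N` integrals are equal. -/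
theorem integral_haarUN {n : ℕ} (v w : Vec n) (k : Fin (n + 1)) :
    ∫ U : UN n, (starRingEnd ℂ) (act (U : Mat n) v k) * act (U : Mat n) w k ∂haarUN n =
      ⟪v, w⟫_ℂ / (n + 1) := by
  have h1 : ∑ l : Fin (n + 1), ∫ U : UN n,
      (starRingEnd ℂ) (act (U : Mat n) v l) * act (U : Mat n) w l ∂haarUN n = ⟪v, w⟫_ℂ := by
    rw [← integral_finsetSum]
    · simp only [← inner_eq_sum, norm_act_UN, integral_const, probReal_univ, one_smul]
    · intro l _
      refine integrable_haarUN ?_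
      exact (Complex.continuous_conj.comp (continuous_act_UN v l)).mul (continuous_act_UN w l)
  have h2 : (n + 1 : ℂ) * ∫ U : UN n,
      (starRingEnd ℂ) (act (U : Mat n) v k) * act (U : Mat n) w k ∂haarUN n = ⟪v, w⟫_ℂ := by
    rw [← h1, Finset.sum_congr rfl fun l _ => integral_haarUN_swap v w l k]
    simp
  have : (n + 1 : ℂ) ≠ 0 := by exact_mod_cast Nat.succ_ne_zero n
  field_simp
  rw [mul_comm]
  exact h2

/-! ### Spectral vector fields -/

/-- Written as a permutation of the coordinates, moving `d_j` to the front visibly preserves the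
Gaussian measure. -/
theorem cons_succAbove_eq {n : ℕ} (d : Spec n) (j : Fin (n + 1)) :
    (Fin.cons (d j) fun i => d (j.succAbove i) : Spec n) = d ∘ j.cycleRange.symm := by
  funext i
  refine Fin.cases ?_ (fun i => ?_) i
  · simp [Fin.cycleRange_symm_zero]
  · simp [Fin.cycleRange_symm_succ]

theorem sharpDiag_eq {n : ℕ} (f : Spec n → ℂ) (d : Spec n) :
    sharpDiag f d = Matrix.diagonal fun j => f (d ∘ j.cycleRange.symm) := by
  simp only [sharpDiag, cons_succAbove_eq]

theorem nsq_comp {n : ℕ} (σ : Equiv.Perm (Fin (n + 1))) (d : Spec n) : nsq (d ∘ σ) = nsq d :=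
  Equiv.sum_comp σ fun i => ‖d i‖ ^ 2

theorem measurePreserving_comp_perm {n : ℕ} {h : ℝ} (σ : Equiv.Perm (Fin (n + 1))) :
    MeasurePreserving (fun d : Spec n => d ∘ σ) (gaussianSpec n h) (gaussianSpec n h) := by
  have hv : MeasurePreserving (fun d : Spec n => d ∘ σ) volume volume := by
    have := volume_measurePreserving_piCongrLeft (fun _ : Fin (n + 1) => ℂ) σ.symm
    convert this using 1
    funext d
    funext i
    have := MeasurableEquiv.piCongrLeft_apply_apply (β := fun _ : Fin (n + 1) => ℂ) σ.symm d (σ i)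
    simpa using this.symm
  refine ⟨hv.measurable, ?_⟩
  rw [gaussianSpec_eq]
  ext s hs
  rw [Measure.map_apply hv.measurable hs, withDensity_apply _ (hv.measurable hs),
    withDensity_apply _ hs, ← hv.setLIntegral_comp_preimage hs (by fun_prop)]
  simp only [gaussDensity, nsq_comp]

/-- The vector field `U^* diag(d) U ↦ U^* diag_j(a(d_j; …)) U v`. -/
def sfield {n : ℕ} (a : Spec n → ℂ) (v : Vec n) (p : UN n × Spec n) : Vec n :=
  act (((p.1 : Mat n))ᴴ * sharpDiag a p.2 * (p.1 : Mat n)) v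

theorem inner_sfield {n : ℕ} (a b : Spec n → ℂ) (v w : Vec n) (p : UN n × Spec n) :
    ⟪sfield a v p, sfield b w p⟫_ℂ =
      ∑ j, ((starRingEnd ℂ) (act (p.1 : Mat n) v j) * act (p.1 : Mat n) w j) *
        ((starRingEnd ℂ) (a (p.2 ∘ j.cycleRange.symm)) * b (p.2 ∘ j.cycleRange.symm)) := by
  have e : ∀ (c : Spec n → ℂ) (u : Vec n), sfield c u p =
      act ((p.1⁻¹ : UN n) : Mat n) (act (sharpDiag c p.2) (act (p.1 : Mat n) u)) := by
    intro c u
    rw [act_act, act_act, coe_inv_UN, sfield, mul_assoc]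
  rw [e, e, norm_act_UN, inner_eq_sum]
  refine Finset.sum_congr rfl fun j _ => ?_
  have e2 : ∀ (c : Spec n → ℂ) (u : Vec n), act (sharpDiag c p.2) u j =
      c (p.2 ∘ j.cycleRange.symm) * u j := by
    intro c u
    rw [sharpDiag_eq, act]
    change (Matrix.diagonal _ *ᵥ _) j = _
    exact Matrix.mulVec_diagonal _ _ _
  rw [e2, e2, map_mul]
  ring

theorem continuous_conj_sharpDiag {n : ℕ} {a : Spec n → ℂ} (ha : Continuous a) :
    Continuous fun p : UN n × Spec n =>
      ((p.1 : Mat n))ᴴ * sharpDiag a p.2 * (p.1 : Mat n) := by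
  simp only [sharpDiag_eq]
  refine Continuous.mul (Continuous.mul ?_ ?_) ?_
  · exact (continuous_subtype_val.comp continuous_fst).matrix_conjTranspose
  · refine Continuous.matrix_diagonal (continuous_pi fun j => ha.comp ?_)
    fun_prop
  · exact continuous_subtype_val.comp continuous_fst

theorem continuous_sfield {n : ℕ} {a : Spec n → ℂ} (ha : Continuous a) (v : Vec n) :
    Continuous (sfield a v) :=
  continuous_act.comp ((continuous_conj_sharpDiag ha).prodMk continuous_const)

theorem integrable_sfield_term {n : ℕ} {h : ℝ} {c : Spec n → ℂ}
    (hc : Integrable c (gaussianSpec n h)) (v w : Vec n) (j : Fin (n + 1)) :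
    Integrable (fun p : UN n × Spec n =>
      ((starRingEnd ℂ) (act (p.1 : Mat n) v j) * act (p.1 : Mat n) w j) *
        c (p.2 ∘ j.cycleRange.symm)) (nu n h) := by
  have h1 : Integrable (fun U : UN n =>
      (starRingEnd ℂ) (act (U : Mat n) v j) * act (U : Mat n) w j) (haarUN n) :=
    integrable_haarUN ((Complex.continuous_conj.comp (continuous_act_UN v j)).mul
      (continuous_act_UN w j))
  have h2 : Integrable (fun d : Spec n => c (d ∘ j.cycleRange.symm)) (gaussianSpec n h) :=
    (measurePreserving_comp_perm j.cycleRange.symm).integrable_comp_of_integrable hc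
  exact h1.mul_prod h2

/-- The reduction to scalar integrals. In each of the `N` summands of `inner_sfield` the variables
`U` and `d` separate: the Haar factor is `⟨v, w⟩/N`, and the Gaussian factor does not depend on `j`
by permutation invariance. -/
theorem integral_inner_sfield {n : ℕ} {h : ℝ} {a b : Spec n → ℂ} (v w : Vec n)
    (hab : Integrable (fun d => (starRingEnd ℂ) (a d) * b d) (gaussianSpec n h)) :
    ∫ p, ⟪sfield a v p, sfield b w p⟫_ℂ ∂nu n h =
      ⟪v, w⟫_ℂ * ∫ d, (starRingEnd ℂ) (a d) * b d ∂gaussianSpec n h := by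
  simp only [inner_sfield]
  rw [integral_finsetSum _ fun j _ => integrable_sfield_term hab v w j]
  have e : ∀ j : Fin (n + 1), ∫ p : UN n × Spec n,
      ((starRingEnd ℂ) (act (p.1 : Mat n) v j) * act (p.1 : Mat n) w j) *
        ((starRingEnd ℂ) (a (p.2 ∘ j.cycleRange.symm)) * b (p.2 ∘ j.cycleRange.symm)) ∂nu n h =
      ⟪v, w⟫_ℂ / (n + 1) * ∫ d, (starRingEnd ℂ) (a d) * b d ∂gaussianSpec n h := by
    intro j
    have h1 := integral_prod_mul (μ := haarUN n) (ν := gaussianSpec n h)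
      (fun U : UN n => (starRingEnd ℂ) (act (U : Mat n) v j) * act (U : Mat n) w j)
      (fun d : Spec n => (starRingEnd ℂ) (a (d ∘ j.cycleRange.symm)) * b (d ∘ j.cycleRange.symm))
    rw [nu, h1, integral_haarUN]
    congr 1
    have h2 := (measurePreserving_comp_perm (n := n) (h := h) j.cycleRange.symm)
    conv_rhs => rw [← h2.map_eq]
    rw [integral_map h2.measurable.aemeasurable]
    rw [h2.map_eq]
    exact hab.aestronglyMeasurable
  simp only [e, Finset.sum_const, Finset.card_univ, Fintype.card_fin, nsmul_eq_mul]
  have : (n + 1 : ℂ) ≠ 0 := by exact_mod_cast Nat.succ_ne_zero n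
  push_cast
  field_simp

theorem integrable_inner_sfield {n : ℕ} {h : ℝ} {a b : Spec n → ℂ} (v w : Vec n)
    (hab : Integrable (fun d => (starRingEnd ℂ) (a d) * b d) (gaussianSpec n h)) :
    Integrable (fun p => ⟪sfield a v p, sfield b w p⟫_ℂ) (nu n h) := by
  simp only [inner_sfield]
  exact integrable_finsetSum _ fun j _ => integrable_sfield_term hab v w j

theorem integrable_conj_mul {n : ℕ} {h : ℝ} {a b : Spec n → ℂ} (ha : MemLp a 2 (gaussianSpec n h))
    (hb : MemLp b 2 (gaussianSpec n h)) :
    Integrable (fun d => (starRingEnd ℂ) (a d) * b d) (gaussianSpec n h) :=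
  (MemLp.star ha).integrable_mul hb

theorem memLp_sfield {n : ℕ} {h : ℝ} {a : Spec n → ℂ} (ha : Continuous a)
    (ha2 : MemLp a 2 (gaussianSpec n h)) (v : Vec n) : MemLp (sfield a v) 2 (nu n h) := by
  rw [memLp_two_iff_integrable_sq_norm (continuous_sfield ha v).aestronglyMeasurable]
  refine (integrable_inner_sfield v v (integrable_conj_mul ha2 ha2)).re.congr
    (ae_of_all _ fun p => ?_)
  exact (inner_self_eq_norm_sq (𝕜 := ℂ) _)

/-- A converse to `memLp_sfield`, needed for uniqueness, where integrability of the symbol has to be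
extracted from the mere existence of the Berezin transform. -/
theorem memLp_of_memLp_sfield {n : ℕ} {h : ℝ} {a : Spec n → ℂ} (ha : Continuous a)
    (hs : ∀ v, MemLp (sfield a v) 2 (nu n h)) : MemLp a 2 (gaussianSpec n h) := by
  rw [memLp_two_iff_integrable_sq_norm ha.aestronglyMeasurable]
  have h1 : Integrable (fun p : UN n × Spec n =>
      ∑ i, ‖sfield a (EuclideanSpace.single i 1) p‖ ^ 2) (nu n h) :=
    integrable_finsetSum _ fun i _ =>
      (memLp_two_iff_integrable_sq_norm (continuous_sfield ha _).aestronglyMeasurable).1 (hs _)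
  have h2 : Integrable (fun p : UN n × Spec n => ‖a p.2‖ ^ 2) (nu n h) := by
    refine h1.mono' (by fun_prop) (ae_of_all _ fun p => ?_)
    have e : ∀ v : Vec n, ‖sfield a v p‖ ^ 2 =
        ∑ j, ‖act (p.1 : Mat n) v j‖ ^ 2 * ‖a (p.2 ∘ j.cycleRange.symm)‖ ^ 2 := by
      intro v
      have := inner_sfield a a v v p
      simp only [inner_self_eq_norm_sq_to_K, Complex.conj_mul'] at this
      have h2 : ∀ (r : ℝ), (RCLike.ofReal r : ℂ) = Complex.ofReal r := fun _ => rfl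
      simp only [h2] at this
      exact_mod_cast this
    -- Row `0` of a unitary matrix is a unit vector; so after summation over the basis vectors `v =
    -- e_i` the term `j = 0` alone is `|a(d)|²`, and the other terms are nonnegative.
    have e2 : ∑ i, ‖act (p.1 : Mat n) (EuclideanSpace.single i 1) 0‖ ^ 2 = 1 := by
      have := congrFun (congrFun (mul_conjTranspose_self p.1) 0) 0
      rw [Matrix.mul_apply, Matrix.one_apply_eq] at this
      simp only [Matrix.conjTranspose_apply, Complex.star_def, Complex.mul_conj'] at this
      have h3 : ∀ i, act (p.1 : Mat n) (EuclideanSpace.single i 1) 0 = (p.1 : Mat n) 0 i := by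
        intro i
        simp [act_apply]
      simp only [h3]
      exact_mod_cast this
    rw [Real.norm_of_nonneg (by positivity)]
    simp only [e]
    rw [Finset.sum_comm]
    simp only [← Finset.sum_mul]
    calc ‖a p.2‖ ^ 2 = (∑ i, ‖act (p.1 : Mat n) (EuclideanSpace.single i 1) 0‖ ^ 2) *
          ‖a (p.2 ∘ (0 : Fin (n + 1)).cycleRange.symm)‖ ^ 2 := by
          rw [e2, Fin.cycleRange_zero, one_mul]
          rfl
      _ ≤ _ := Finset.single_le_sum (f := fun j : Fin (n + 1) =>
          (∑ i, ‖act (p.1 : Mat n) (EuclideanSpace.single i 1) j‖ ^ 2) *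
          ‖a (p.2 ∘ j.cycleRange.symm)‖ ^ 2) (fun j _ => by positivity) (Finset.mem_univ 0)
  have h3 : MeasurePreserving (Prod.snd : UN n × Spec n → Spec n) (nu n h) (gaussianSpec n h) :=
    measurePreserving_snd
  exact (h3.integrable_comp (by fun_prop)).1 h2

/-! ### Functions on the normal matrices that are spectral vector fields -/

/-- In polar coordinates `F` is almost everywhere the vector field `sfield a v`. -/
def IsField {n : ℕ} (h : ℝ) (F : Mat n → Vec n) (a : Spec n → ℂ) (v : Vec n) : Prop :=
  (fun p => F (diagMap p)) =ᵐ[nu n h] sfield a v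

/-- In polar coordinates the matrix function `φ` is `U^* diag_j(f(d_j; …)) U`. -/
def IsSharp {n : ℕ} (φ : Mat n → Mat n) (f : Spec n → ℂ) : Prop :=
  ∀ p : UN n × Spec n, φ (diagMap p) = ((p.1 : Mat n))ᴴ * sharpDiag f p.2 * (p.1 : Mat n)

theorem sharpDiag_mul {n : ℕ} (a b : Spec n → ℂ) (d : Spec n) :
    sharpDiag (fun d => a d * b d) d = sharpDiag a d * sharpDiag b d := by
  simp only [sharpDiag, Matrix.diagonal_mul_diagonal]

theorem act_sfield {n : ℕ} {φ : Mat n → Mat n} {f : Spec n → ℂ} (hφ : IsSharp φ f)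
    (a : Spec n → ℂ) (v : Vec n) (p : UN n × Spec n) :
    act (φ (diagMap p)) (sfield a v p) = sfield (fun d => f d * a d) v p := by
  rw [hφ p, sfield, act_act, conj'_mul_conj', sfield, sharpDiag_mul]

theorem sfield_add {n : ℕ} (a b : Spec n → ℂ) (v : Vec n) (p : UN n × Spec n) :
    sfield (fun d => a d + b d) v p = sfield a v p + sfield b v p := by
  rw [sfield, sfield, sfield, ← add_act, ← add_mul, ← mul_add]
  simp only [sharpDiag, Matrix.diagonal_add]

theorem sfield_smul {n : ℕ} (c : ℂ) (a : Spec n → ℂ) (v : Vec n) (p : UN n × Spec n) :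
    sfield (fun d => c * a d) v p = c • sfield a v p := by
  rw [sfield, sfield, ← smul_act, ← smul_mul_assoc, ← mul_smul_comm]
  simp only [sharpDiag, ← Matrix.diagonal_smul]
  rfl

theorem coeFn_sum_L2 {n : ℕ} {h : ℝ} {ι : Type*} (s : Finset ι) (F : ι → L2 n h) :
    ((∑ i ∈ s, F i : L2 n h) : Mat n → Vec n) =ᵐ[mu n h] fun Z => ∑ i ∈ s, F i Z := by
  classical
  induction s using Finset.induction_on with
  | empty =>
    simp only [Finset.sum_empty]
    exact Lp.coeFn_zero (Vec n) 2 (mu n h)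
  | insert i s hi ih =>
    simp only [Finset.sum_insert hi]
    filter_upwards [Lp.coeFn_add (F i) (∑ i ∈ s, F i), ih] with Z h1 h2
    rw [h1, Pi.add_apply, h2]

theorem IsField.add {n : ℕ} {h : ℝ} {F G : L2 n h} {a b : Spec n → ℂ} {v : Vec n}
    (hF : IsField h F a v) (hG : IsField h G b v) :
    IsField h (F + G : L2 n h) (fun d => a d + b d) v := by
  have h1 := ae_of_ae_map measurable_diagMap.aemeasurable (Lp.coeFn_add F G)
  filter_upwards [hF, hG, h1] with p hF hG h1
  rw [sfield_add, ← hF, ← hG, h1]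
  rfl

theorem IsField.smul {n : ℕ} {h : ℝ} {F : L2 n h} {a : Spec n → ℂ} {v : Vec n}
    (hF : IsField h F a v) (c : ℂ) : IsField h (c • F : L2 n h) (fun d => c * a d) v := by
  have h1 := ae_of_ae_map measurable_diagMap.aemeasurable (Lp.coeFn_smul c F)
  filter_upwards [hF, h1] with p hF h1
  rw [sfield_smul, ← hF, h1]
  rfl

theorem IsField.zero {n : ℕ} {h : ℝ} (v : Vec n) : IsField h (0 : L2 n h) (fun _ => 0) v := by
  have h1 := ae_of_ae_map measurable_diagMap.aemeasurable (Lp.coeFn_zero (Vec n) 2 (mu n h))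
  filter_upwards [h1] with p h1
  rw [h1]
  have := sfield_smul 0 (fun _ => 0) v p
  simp only [zero_mul, zero_smul] at this
  rw [this]
  rfl

theorem IsField.sum {n : ℕ} {h : ℝ} {ι : Type*} (s : Finset ι) {F : ι → L2 n h}
    {a : ι → Spec n → ℂ} {v : Vec n} (hF : ∀ i ∈ s, IsField h (F i) (a i) v) :
    IsField h (∑ i ∈ s, F i : L2 n h) (fun d => ∑ i ∈ s, a i d) v := by
  classical
  induction s using Finset.induction_on with
  | empty =>
    simp only [Finset.sum_empty]
    exact IsField.zero v
  | insert i s hi ih =>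
    simp only [Finset.sum_insert hi]
    exact (hF i (Finset.mem_insert_self i s)).add
      (ih fun j hj => hF j (Finset.mem_insert_of_mem hj))

theorem IsField.sub {n : ℕ} {h : ℝ} {F G : L2 n h} {a b : Spec n → ℂ} {v : Vec n}
    (hF : IsField h F a v) (hG : IsField h G b v) :
    IsField h (F - G : L2 n h) (fun d => a d - b d) v := by
  have := hF.add (hG.smul (-1))
  simpa only [neg_smul, one_smul, ← sub_eq_add_neg, neg_mul, one_mul] using this

theorem IsField.congr {n : ℕ} {h : ℝ} {F G : Mat n → Vec n} {a : Spec n → ℂ} {v : Vec n}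
    (hF : IsField h F a v) (hG : G =ᵐ[mu n h] F) : IsField h G a v := by
  filter_upwards [hF, ae_of_ae_map measurable_diagMap.aemeasurable hG] with p h1 h2
  rw [h2, h1]

theorem IsField.act {n : ℕ} {h : ℝ} {F : Mat n → Vec n} {a : Spec n → ℂ} {v : Vec n}
    (hF : IsField h F a v) {φ : Mat n → Mat n} {f : Spec n → ℂ} (hφ : IsSharp φ f) :
    IsField h (fun Z => act (φ Z) (F Z)) (fun d => f d * a d) v := by
  filter_upwards [hF] with p hp
  rw [← act_sfield hφ, ← hp]

theorem IsSharp.aestronglyMeasurable {n : ℕ} {h : ℝ} {φ : Mat n → Mat n} {f : Spec n → ℂ}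
    (hφ : IsSharp φ f) (hf : Continuous f) : AEStronglyMeasurable φ (mu n h) := by
  refine (aemeasurable_of_comp_diagMap ?_).aestronglyMeasurable
  have : φ ∘ diagMap = fun p : UN n × Spec n =>
      ((p.1 : Mat n))ᴴ * sharpDiag f p.2 * (p.1 : Mat n) := funext hφ
  rw [this]
  exact (continuous_conj_sharpDiag hf).measurable

theorem IsSharp.aestronglyMeasurable_act {n : ℕ} {h : ℝ} {φ : Mat n → Mat n} {f : Spec n → ℂ}
    (hφ : IsSharp φ f) (hf : Continuous f) {F : Mat n → Vec n}
    (hF : AEStronglyMeasurable F (mu n h)) :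
    AEStronglyMeasurable (fun Z => NormalMatrixQuantization.act (φ Z) (F Z)) (mu n h) :=
  continuous_act.comp_aestronglyMeasurable ((hφ.aestronglyMeasurable hf).prodMk hF)

theorem isSharp_one {n : ℕ} : IsSharp (fun _ : Mat n => (1 : Mat n)) fun _ => 1 := by
  intro p
  rw [sharpDiag, Matrix.diagonal_one, mul_one, conjTranspose_mul_self]

theorem isSharp_sharp {n : ℕ} {f : Spec n → ℂ} (hf : IsSymmetricTail f) : IsSharp (sharp f) f := by
  intro p
  have := sharp_conj hf p.1⁻¹ p.2
  rwa [coe_inv_UN, Matrix.conjTranspose_conjTranspose] at this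

theorem IsSharp.apply_diagonal {n : ℕ} {φ : Mat n → Mat n} {f : Spec n → ℂ} (hφ : IsSharp φ f)
    (d : Spec n) : φ (Matrix.diagonal d) 0 0 = f d := by
  have := hφ (1, d)
  simp only [diagMap, OneMemClass.coe_one, Matrix.conjTranspose_one, one_mul, mul_one] at this
  rw [this, sharpDiag_eq, Matrix.diagonal_apply_eq, Fin.cycleRange_zero]
  rfl

theorem IsField.memLp {n : ℕ} {h : ℝ} {F : Mat n → Vec n} {a : Spec n → ℂ} {v : Vec n}
    (hF : IsField h F a v) (hFm : AEStronglyMeasurable F (mu n h)) (ha : Continuous a)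
    (ha2 : MemLp a 2 (gaussianSpec n h)) : MemLp F 2 (mu n h) := by
  rw [mu_eq] at hFm ⊢
  rw [memLp_map_measure_iff hFm measurable_diagMap.aemeasurable]
  exact (memLp_congr_ae hF).2 (memLp_sfield ha ha2 v)

theorem IsField.inner {n : ℕ} {h : ℝ} {F G : L2 n h} {a b : Spec n → ℂ} {v w : Vec n}
    (hF : IsField h F a v) (hG : IsField h G b w)
    (ha : MemLp a 2 (gaussianSpec n h)) (hb : MemLp b 2 (gaussianSpec n h)) :
    ⟪F, G⟫_ℂ = ⟪v, w⟫_ℂ * ∫ d, (starRingEnd ℂ) (a d) * b d ∂gaussianSpec n h := by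
  rw [L2.inner_def, ← integral_inner_sfield v w (integrable_conj_mul ha hb)]
  have hm : AEStronglyMeasurable (fun Z => ⟪(F : Mat n → Vec n) Z, (G : Mat n → Vec n) Z⟫_ℂ)
      (mu n h) := (Lp.aestronglyMeasurable F).inner (Lp.aestronglyMeasurable G)
  have h1 : ∫ Z, ⟪(F : Mat n → Vec n) Z, (G : Mat n → Vec n) Z⟫_ℂ ∂mu n h =
      ∫ p, ⟪(F : Mat n → Vec n) (diagMap p), (G : Mat n → Vec n) (diagMap p)⟫_ℂ ∂nu n h :=
    integral_map (μ := nu n h) measurable_diagMap.aemeasurable hm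
  rw [h1]
  refine integral_congr_ae ?_
  filter_upwards [hF, hG] with p hF hG
  rw [hF, hG]

theorem IsField.sq_norm {n : ℕ} {h : ℝ} {F : L2 n h} {a : Spec n → ℂ} {v : Vec n}
    (hF : IsField h F a v) (ha : MemLp a 2 (gaussianSpec n h)) :
    ‖F‖ ^ 2 = ‖v‖ ^ 2 * ∫ d, ‖a d‖ ^ 2 ∂gaussianSpec n h := by
  have h1 := hF.inner hF ha ha
  simp only [inner_self_eq_norm_sq_to_K, Complex.conj_mul'] at h1
  have h2 : ∀ (r : ℝ), (RCLike.ofReal r : ℂ) = Complex.ofReal r := fun _ => rfl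
  simp only [h2, ← Complex.ofReal_pow] at h1
  rw [integral_complex_ofReal] at h1
  exact_mod_cast h1

/-! ### The monomials -/

theorem act_diagMap_pow {n : ℕ} (k : ℕ) (χ : Vec n) (p : UN n × Spec n) :
    act (diagMap p ^ k) χ = sfield (fun d => d 0 ^ k) χ p := by
  rw [diagMap, conj'_pow, sfield, Matrix.diagonal_pow]
  rfl

theorem continuous_pow_zero {n : ℕ} (k : ℕ) : Continuous fun d : Spec n => d 0 ^ k := by
  fun_prop

theorem memLp_pow {n : ℕ} {h : ℝ} (hh : 0 < h) (k : ℕ) :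
    MemLp (fun d : Spec n => d 0 ^ k) 2 (gaussianSpec n h) := by
  have hi := inv_pos.2 hh
  exact (growth_pow k (ε := h⁻¹ / 4) (by positivity)).memLp hh (by linarith)
    (continuous_pow_zero k).aestronglyMeasurable

theorem memLp_monomial {n : ℕ} {h : ℝ} (hh : 0 < h) (k : ℕ) (χ : Vec n) :
    MemLp (fun Z : Mat n => act (Z ^ k) χ) 2 (mu n h) := by
  have hf : IsField h (fun Z : Mat n => act (Z ^ k) χ) (fun d => d 0 ^ k) χ :=
    ae_of_all _ fun p => act_diagMap_pow k χ p
  refine hf.memLp ?_ (continuous_pow_zero k) (memLp_pow hh k)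
  refine Continuous.aestronglyMeasurable ?_
  exact continuous_act.comp ((continuous_id.pow k).prodMk continuous_const)

/-- The function `Z ↦ Z^k χ` as an element of `L²`. -/
def monomial {n : ℕ} {h : ℝ} (hh : 0 < h) (k : ℕ) (χ : Vec n) : L2 n h :=
  (memLp_monomial hh k χ).toLp _

theorem monomial_coeFn {n : ℕ} {h : ℝ} (hh : 0 < h) (k : ℕ) (χ : Vec n) :
    (monomial hh k χ : Mat n → Vec n) =ᵐ[mu n h] fun Z => act (Z ^ k) χ :=
  MemLp.coeFn_toLp _

theorem isField_monomial {n : ℕ} {h : ℝ} (hh : 0 < h) (k : ℕ) (χ : Vec n) :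
    IsField h (monomial hh k χ) (fun d => d 0 ^ k) χ := by
  filter_upwards [ae_of_ae_map measurable_diagMap.aemeasurable (monomial_coeFn hh k χ)] with p hp
  rw [hp, act_diagMap_pow]

theorem monomial_mem {n : ℕ} {h : ℝ} (hh : 0 < h) (k : ℕ) (χ : Vec n) :
    monomial hh k χ ∈ bargmann n h :=
  Submodule.le_topologicalClosure _ (Submodule.subset_span ⟨k, χ, monomial_coeFn hh k χ⟩)

theorem inner_monomial {n : ℕ} {h : ℝ} (hh : 0 < h) (k l : ℕ) (χ χ' : Vec n) :
    ⟪monomial hh k χ, monomial hh l χ'⟫_ℂ =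
      ⟪χ, χ'⟫_ℂ * if k = l then (k.factorial : ℂ) * (h : ℂ) ^ k else 0 := by
  rw [(isField_monomial hh k χ).inner (isField_monomial hh l χ') (memLp_pow hh k) (memLp_pow hh l),
    integral_conj_pow_mul_pow hh]

/-- The monomials `Z^k χ` are linear in `χ`, so those with `χ = e_i` already span the dense subspace
that defines `H_h`. -/
theorem eq_zero_of_inner_monomial {n : ℕ} {h : ℝ} (hh : 0 < h) {F : L2 n h} (hF : F ∈ bargmann n h)
    (h0 : ∀ k i, ⟪monomial hh k (EuclideanSpace.single i 1), F⟫_ℂ = 0) : F = 0 := by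
  have hlin : ∀ k (χ : Vec n), monomial hh k χ = ∑ i, χ i • monomial hh k (EuclideanSpace.single i 1) := by
    intro k χ
    refine Lp.ext ((monomial_coeFn hh k χ).trans ?_)
    have h1 : ∀ i, ((χ i • monomial hh k (EuclideanSpace.single i 1) : L2 n h) : Mat n → Vec n)
        =ᵐ[mu n h] fun Z => χ i • act (Z ^ k) (EuclideanSpace.single i 1) := by
      intro i
      filter_upwards [Lp.coeFn_smul (χ i) (monomial hh k (EuclideanSpace.single i 1)),
        monomial_coeFn hh k (EuclideanSpace.single i 1)] with Z h1 h2
      rw [h1, Pi.smul_apply, h2]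
    have h2 := coeFn_sum_L2 (Finset.univ : Finset (Fin (n + 1)))
      fun i => χ i • monomial hh k (EuclideanSpace.single i 1)
    filter_upwards [h2, ae_all_iff.2 h1] with Z h2 h1
    rw [h2]
    simp only [h1]
    conv_lhs => rw [show χ = ∑ i, χ i • EuclideanSpace.single i (1 : ℂ) by
      ext j; simp [Pi.single_apply]]
    rw [act_sum]
    simp only [act_smul]
  have h1 : F ∈ (Submodule.span ℂ {F : L2 n h | ∃ (k : ℕ) (χ : Vec n),
      F =ᵐ[mu n h] fun Z => act (Z ^ k) χ})ᗮ := by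
    rw [Submodule.mem_orthogonal]
    intro G hG
    induction hG using Submodule.span_induction with
    | mem G hG =>
      obtain ⟨k, χ, hG⟩ := hG
      have : G = monomial hh k χ := Lp.ext (hG.trans (monomial_coeFn hh k χ).symm)
      rw [this, hlin, sum_inner]
      refine Finset.sum_eq_zero fun i _ => ?_
      rw [inner_smul_left, h0, mul_zero]
    | zero => exact inner_zero_left _
    | add x y _ _ hx hy => rw [inner_add_left, hx, hy, add_zero]
    | smul c x _ hx => rw [inner_smul_left, hx, mul_zero]
  rw [← Submodule.orthogonal_closure] at h1
  exact inner_self_eq_zero.1 (Submodule.inner_right_of_mem_orthogonal hF h1)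

/-! ### The reproducing kernel and the coherent vectors -/

/-- The function `d ↦ exp(d_1 y)`. -/
def kexp {n : ℕ} (y : ℂ) (d : Spec n) : ℂ := Complex.exp (d 0 * y)

@[fun_prop] theorem continuous_kexp {n : ℕ} (y : ℂ) : Continuous (kexp (n := n) y) := by
  unfold kexp
  fun_prop

theorem growth_kexp {n : ℕ} (y : ℂ) {ε : ℝ} (hε : 0 < ε) : Growth ε (kexp (n := n) y) :=
  growth_exp y hε

theorem memLp_kexp {n : ℕ} {h : ℝ} (hh : 0 < h) (y : ℂ) :
    MemLp (kexp y) 2 (gaussianSpec n h) := by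
  have hi := inv_pos.2 hh
  exact (growth_kexp y (ε := h⁻¹ / 4) (by positivity)).memLp hh (by linarith)
    (continuous_kexp y).aestronglyMeasurable

/-- The `j`-th column of a unitary matrix. -/
def column {n : ℕ} (V : UN n) (j : Fin (n + 1)) : Vec n :=
  act (V : Mat n) (EuclideanSpace.single j 1)

theorem inner_column {n : ℕ} (V : UN n) (i j : Fin (n + 1)) :
    ⟪column V i, column V j⟫_ℂ = if i = j then 1 else 0 := by
  rw [column, column, norm_act_UN, orthonormal_iff_ite.1 EuclideanSpace.orthonormal_single i j]

theorem sum_column {n : ℕ} (V : UN n) (χ : Vec n) :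
    χ = ∑ j, (act (V : Mat n)ᴴ χ j) • column V j := by
  have h1 : act (V : Mat n)ᴴ χ = ∑ j, (act (V : Mat n)ᴴ χ j) • EuclideanSpace.single j (1 : ℂ) := by
    ext i
    simp [Pi.single_apply]
  calc χ = act (V : Mat n) (act (V : Mat n)ᴴ χ) := by
        rw [act_act, mul_conjTranspose_self, act_one]
    _ = act (V : Mat n) (∑ j, (act (V : Mat n)ᴴ χ j) • EuclideanSpace.single j (1 : ℂ)) := by
        rw [← h1]
    _ = _ := by
        rw [act_sum]
        simp only [act_smul, column]

/-- The two arguments need not commute. The middle factor is nevertheless explicit: between the two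
unitaries, `X^k Y^{*k}` multiplies the entry `(UV)_{ij}` by `(d_i conj(x_j))^k`, and the series sums
entrywise to an exponential. -/
theorem kernel_eq {n : ℕ} (h : ℝ) (p : UN n × Spec n) (V : UN n) (x : Spec n) :
    kernel h (diagMap p) ((V : Mat n) * Matrix.diagonal x * (V : Mat n)ᴴ) =
      (p.1 : Mat n)ᴴ * (Matrix.of fun i j => ((p.1 : Mat n) * (V : Mat n)) i j *
        Complex.exp (p.2 i * ((starRingEnd ℂ) (x j) / h))) * (V : Mat n)ᴴ := by
  refine HasSum.tsum_eq ?_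
  have e : ∀ k : ℕ, ((Nat.factorial k : ℂ) * (h : ℂ) ^ k)⁻¹ • (diagMap p ^ k *
      ((V : Mat n) * Matrix.diagonal x * (V : Mat n)ᴴ)ᴴ ^ k) =
      (p.1 : Mat n)ᴴ * (Matrix.of fun i j => ((p.1 : Mat n) * (V : Mat n)) i j *
        ((p.2 i * ((starRingEnd ℂ) (x j) / h)) ^ k / k.factorial)) * (V : Mat n)ᴴ := by
    intro k
    have e1 : ((V : Mat n) * Matrix.diagonal x * (V : Mat n)ᴴ)ᴴ =
        (V : Mat n) * Matrix.diagonal (star x) * (V : Mat n)ᴴ := by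
      simp only [Matrix.conjTranspose_mul, Matrix.conjTranspose_conjTranspose,
        Matrix.diagonal_conjTranspose, mul_assoc]
    rw [e1, conj_pow, diagMap, conj'_pow, Matrix.diagonal_pow, Matrix.diagonal_pow]
    have e2 : (Matrix.of fun i j => ((p.1 : Mat n) * (V : Mat n)) i j *
        ((p.2 i * ((starRingEnd ℂ) (x j) / h)) ^ k / k.factorial)) =
        ((Nat.factorial k : ℂ) * (h : ℂ) ^ k)⁻¹ • (Matrix.diagonal (p.2 ^ k) *
          ((p.1 : Mat n) * (V : Mat n)) * Matrix.diagonal (star x ^ k)) := by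
      ext i j
      simp only [Matrix.of_apply, Matrix.smul_apply, Matrix.mul_diagonal, Matrix.diagonal_mul,
        Pi.pow_apply, Pi.star_apply, smul_eq_mul, mul_pow, div_pow, RCLike.star_def]
      rw [mul_inv]
      ring
    rw [e2, mul_smul_comm, smul_mul_assoc]
    simp only [mul_assoc]
  simp only [e]
  refine (HasSum.mul_left _ ?_).mul_right _
  refine Pi.hasSum.2 fun i => Pi.hasSum.2 fun j => ?_
  refine HasSum.mul_left _ ?_
  rw [Complex.exp_eq_exp_ℂ]
  exact NormedSpace.expSeries_div_hasSum_exp _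

/-- On an eigenvector of `X` only the eigenvalue `x_j` enters, and the kernel function becomes a
spectral field. This is why all Berezin transforms here diagonalize together with `X`. -/
theorem act_kernel_column {n : ℕ} (h : ℝ) (p : UN n × Spec n) (V : UN n) (x : Spec n)
    (j : Fin (n + 1)) :
    act (kernel h (diagMap p) ((V : Mat n) * Matrix.diagonal x * (V : Mat n)ᴴ)) (column V j) =
      sfield (kexp ((starRingEnd ℂ) (x j) / h)) (column V j) p := by
  rw [kernel_eq, sfield, column, act_act, act_act]
  simp only [mul_assoc]
  rw [conjTranspose_mul_self, mul_one, ← act_act, ← act_act (p.1 : Mat n)ᴴ]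
  congr 1
  ext i
  simp [act_apply, sharpDiag, kexp, Matrix.diagonal_mul]
  ring

theorem kernel_self {n : ℕ} (h : ℝ) (V : UN n) (x : Spec n) :
    kernel h ((V : Mat n) * Matrix.diagonal x * (V : Mat n)ᴴ)
      ((V : Mat n) * Matrix.diagonal x * (V : Mat n)ᴴ) =
      (V : Mat n) * Matrix.diagonal (fun j => ((Real.exp (‖x j‖ ^ 2 / h) : ℝ) : ℂ)) *
        (V : Mat n)ᴴ := by
  have h1 := kernel_eq h (V⁻¹, x) V x
  simp only [diagMap, coe_inv_UN, Matrix.conjTranspose_conjTranspose] at h1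
  rw [h1]
  congr 2
  ext i j
  rw [Matrix.of_apply, conjTranspose_mul_self]
  by_cases hij : i = j
  · subst hij
    rw [Matrix.one_apply_eq, Matrix.diagonal_apply_eq, one_mul, ← mul_div_assoc, Complex.mul_conj']
    push_cast
    rfl
  · rw [Matrix.one_apply_ne hij, Matrix.diagonal_apply_ne _ hij, zero_mul]

theorem kernelInvSqrt_eq {n : ℕ} (h : ℝ) (V : UN n) (x : Spec n) :
    kernelInvSqrt h ((V : Mat n) * Matrix.diagonal x * (V : Mat n)ᴴ) =
      (V : Mat n) * Matrix.diagonal (fun j => (((√(Real.exp (‖x j‖ ^ 2 / h)))⁻¹ : ℝ) : ℂ)) *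
        (V : Mat n)ᴴ := by
  rw [kernelInvSqrt, kernel_self]
  exact cfc_conj_diagonal V (fun j => Real.exp (‖x j‖ ^ 2 / h)) fun x => (√x)⁻¹

/-- The Taylor sums of the exponential are polynomials in `Z` applied to the column, and they
converge in `L²` by dominated convergence with majorant `exp(|d_1||y|)`. -/
theorem exists_coherent_column {n : ℕ} {h : ℝ} (hh : 0 < h) (V : UN n) (x : Spec n)
    (j : Fin (n + 1)) : ∃ F : bargmann n h, (F : L2 n h) =ᵐ[mu n h] fun Z =>
      act (kernel h Z ((V : Mat n) * Matrix.diagonal x * (V : Mat n)ᴴ)) (column V j) := by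
  set X := (V : Mat n) * Matrix.diagonal x * (V : Mat n)ᴴ with hX
  set v := column V j
  set y := (starRingEnd ℂ) (x j) / h
  have hfield : IsField h (fun Z => act (kernel h Z X) v) (kexp y) v :=
    ae_of_all _ fun p => act_kernel_column h p V x j
  have hmeas : AEStronglyMeasurable (fun Z => act (kernel h Z X) v) (mu n h) := by
    refine (aemeasurable_of_comp_diagMap ?_).aestronglyMeasurable
    have : (fun Z => act (kernel h Z X) v) ∘ diagMap = sfield (kexp y) v :=
      funext fun p => act_kernel_column h p V x j
    rw [this]
    exact (continuous_sfield (continuous_kexp y) v).measurable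
  have hm2 := hfield.memLp hmeas (continuous_kexp y) (memLp_kexp hh y)
  refine ⟨⟨hm2.toLp _, ?_⟩, hm2.coeFn_toLp⟩
  have hF : IsField h (hm2.toLp _ : L2 n h) (kexp y) v := hfield.congr hm2.coeFn_toLp
  let S : ℕ → L2 n h := fun K => ∑ k ∈ Finset.range K, (y ^ k / (k.factorial : ℂ)) • monomial hh k v
  let s : ℕ → Spec n → ℂ := fun K d => ∑ k ∈ Finset.range K, (y ^ k / (k.factorial : ℂ)) * d 0 ^ k
  have hS : ∀ K, IsField h (S K) (s K) v := fun K =>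
    IsField.sum _ fun k _ => (isField_monomial hh k v).smul _
  have hs : ∀ K d, s K d = ∑ k ∈ Finset.range K, (d 0 * y) ^ k / (k.factorial : ℂ) := by
    intro K d
    refine Finset.sum_congr rfl fun k _ => ?_
    rw [mul_pow]
    ring
  have hcont : ∀ K, Continuous (s K) := fun K => by fun_prop
  have hbound : ∀ K d, ‖kexp y d - s K d‖ ≤ ‖kexp (n := n) (‖y‖ : ℂ) (fun i => (‖d i‖ : ℂ))‖ := by
    intro K d
    rw [hs]
    refine (Complex.norm_exp_sub_sum_le_exp_norm_sub_sum _ _).trans ?_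
    rw [kexp, Complex.norm_exp, norm_mul, ← Complex.ofReal_mul, Complex.ofReal_re]
    refine sub_le_self _ (Finset.sum_nonneg fun k _ => by positivity)
  have hg : Growth (h⁻¹ / 4) fun d : Spec n => kexp (‖y‖ : ℂ) (fun i => (‖d i‖ : ℂ) : Spec n) := by
    obtain ⟨C, hC⟩ := growth_kexp (n := n) (‖y‖ : ℂ) (ε := h⁻¹ / 4)
      (by have := inv_pos.2 hh; positivity)
    refine ⟨C, fun d => (hC _).trans_eq ?_⟩
    simp [nsq]
  have hi := inv_pos.2 hh
  have hg2 : MemLp (fun d : Spec n => kexp (‖y‖ : ℂ) (fun i => (‖d i‖ : ℂ) : Spec n)) 2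
      (gaussianSpec n h) :=
    hg.memLp hh (by linarith) (Continuous.aestronglyMeasurable (by fun_prop))
  have hd2 : ∀ K, MemLp (fun d => kexp y d - s K d) 2 (gaussianSpec n h) := fun K =>
    hg2.mono (Continuous.aestronglyMeasurable ((continuous_kexp y).sub (hcont K)))
      (ae_of_all _ fun d => hbound K d)
  have hnorm : ∀ K, ‖(hm2.toLp _ : L2 n h) - S K‖ ^ 2 =
      ‖v‖ ^ 2 * ∫ d, ‖kexp y d - s K d‖ ^ 2 ∂gaussianSpec n h := fun K =>
    (hF.sub (hS K)).sq_norm (hd2 K)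
  have hlim : Tendsto (fun K => ∫ d, ‖kexp y d - s K d‖ ^ 2 ∂gaussianSpec n h) atTop (𝓝 0) := by
    have : (0 : ℝ) = ∫ d : Spec n, (0 : ℝ) ∂gaussianSpec n h := by simp
    rw [this]
    refine tendsto_integral_of_dominated_convergence
      (fun d => ‖kexp (n := n) (‖y‖ : ℂ) (fun i => (‖d i‖ : ℂ))‖ ^ 2) ?_ ?_ ?_ ?_
    · exact fun K => ((hd2 K).aestronglyMeasurable.norm.pow 2)
    · exact (memLp_two_iff_integrable_sq_norm hg2.aestronglyMeasurable).1 hg2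
    · intro K
      refine ae_of_all _ fun d => ?_
      rw [Real.norm_of_nonneg (by positivity)]
      have := hbound K d
      gcongr
    · refine ae_of_all _ fun d => ?_
      have h1 : Tendsto (fun K => s K d) atTop (𝓝 (kexp y d)) := by
        simp only [hs, kexp]
        rw [Complex.exp_eq_exp_ℂ]
        exact (NormedSpace.expSeries_div_hasSum_exp (d 0 * y)).tendsto_sum_nat
      have h2 := ((tendsto_const_nhds (x := kexp y d)).sub h1).norm.pow 2
      simpa using h2
  have hlim2 : Tendsto S atTop (𝓝 (hm2.toLp _ : L2 n h)) := by
    rw [tendsto_iff_norm_sub_tendsto_zero]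
    have h1 := (hlim.const_mul (‖v‖ ^ 2)).sqrt
    simp only [← hnorm, mul_zero, Real.sqrt_zero, Real.sqrt_sq (norm_nonneg _)] at h1
    simpa only [norm_sub_rev] using h1
  refine (Submodule.isClosed_topologicalClosure _).mem_of_tendsto hlim2 (Eventually.of_forall fun K => ?_)
  exact Submodule.sum_mem _ fun k _ => Submodule.smul_mem _ _ (monomial_mem hh k v)

theorem exists_coherent {n : ℕ} {h : ℝ} (hh : 0 < h) {X : Mat n} (hX : X ∈ normalMatrices n)
    (χ : Vec n) : ∃ F : bargmann n h, (F : L2 n h) =ᵐ[mu n h] fun Z => act (kernel h Z X) χ := by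
  obtain ⟨V, x, rfl⟩ := exists_unitary_diagonal hX
  choose F hF using fun j => exists_coherent_column hh V x j
  refine ⟨∑ j, (act (V : Mat n)ᴴ χ j) • F j, ?_⟩
  have h1 : ((∑ j, (act (V : Mat n)ᴴ χ j) • F j : bargmann n h) : L2 n h) =
      ∑ j, (act (V : Mat n)ᴴ χ j) • (F j : L2 n h) := by
    simp only [Submodule.coe_sum, Submodule.coe_smul]
  rw [h1]
  have h2 : ∀ j, (((act (V : Mat n)ᴴ χ j) • (F j : L2 n h) : L2 n h) : Mat n → Vec n) =ᵐ[mu n h]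
      fun Z => (act (V : Mat n)ᴴ χ j) • act (kernel h Z ((V : Mat n) * Matrix.diagonal x * (V : Mat n)ᴴ))
        (column V j) := by
    intro j
    filter_upwards [hF j, Lp.coeFn_smul (act (V : Mat n)ᴴ χ j) (F j : L2 n h)] with Z h1 h2
    rw [h2, Pi.smul_apply, h1]
  filter_upwards [coeFn_sum_L2 Finset.univ fun j => (act (V : Mat n)ᴴ χ j) • (F j : L2 n h),
    ae_all_iff.2 h2] with Z h3 h4
  rw [h3]
  simp only [h4]
  conv_rhs => rw [sum_column V χ]
  rw [act_sum]
  simp only [act_smul]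

theorem coherent_coeFn {n : ℕ} {h : ℝ} (hh : 0 < h) {X : Mat n} (hX : X ∈ normalMatrices n)
    (χ : Vec n) : (coherent h X χ : L2 n h) =ᵐ[mu n h] fun Z => act (kernel h Z X) χ := by
  rw [coherent, dif_pos (exists_coherent hh hX χ)]
  exact (exists_coherent hh hX χ).choose_spec

theorem coherent_sum {n : ℕ} {h : ℝ} (hh : 0 < h) {X : Mat n} (hX : X ∈ normalMatrices n)
    {ι : Type*} [Fintype ι] (c : ι → ℂ) (χ : ι → Vec n) :
    coherent h X (∑ i, c i • χ i) = ∑ i, c i • coherent h X (χ i) := by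
  refine Subtype.ext (Lp.ext ?_)
  simp only [Submodule.coe_sum, Submodule.coe_smul]
  have h2 : ∀ i, ((c i • (coherent h X (χ i) : L2 n h) : L2 n h) : Mat n → Vec n) =ᵐ[mu n h]
      fun Z => c i • act (kernel h Z X) (χ i) := by
    intro i
    filter_upwards [coherent_coeFn hh hX (χ i),
      Lp.coeFn_smul (c i) (coherent h X (χ i) : L2 n h)] with Z h1 h2
    rw [h2, Pi.smul_apply, h1]
  filter_upwards [coherent_coeFn hh hX (∑ i, c i • χ i), ae_all_iff.2 h2,
    coeFn_sum_L2 Finset.univ fun i => c i • (coherent h X (χ i) : L2 n h)] with Z h3 h4 h5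
  rw [h3, h5, act_sum]
  simp only [h4]
  simp only [act_smul]

theorem isField_coherent {n : ℕ} {h : ℝ} (hh : 0 < h) (V : UN n) (x : Spec n) (j : Fin (n + 1)) :
    IsField h (coherent h ((V : Mat n) * Matrix.diagonal x * (V : Mat n)ᴴ) (column V j) : L2 n h)
      (kexp ((starRingEnd ℂ) (x j) / h)) (column V j) := by
  refine IsField.congr ?_ (coherent_coeFn hh (conj_diagonal_mem_normalMatrices V x) (column V j))
  exact ae_of_all _ fun p => act_kernel_column h p V x j

/-! ### Toeplitz operators -/

theorem IsField.inDomain {n : ℕ} {h : ℝ} {F : bargmann n h} {a : Spec n → ℂ} {v : Vec n}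
    (hF : IsField h (F : L2 n h) a v) (ha : Continuous a) {φ : Mat n → Mat n} {f : Spec n → ℂ}
    (hφ : IsSharp φ f) (hf : Continuous f)
    (h2 : MemLp (fun d => f d * a d) 2 (gaussianSpec n h)) : InDomain h φ F :=
  (hF.act hφ).memLp (hφ.aestronglyMeasurable_act hf (Lp.aestronglyMeasurable _)) (hf.mul ha) h2

theorem inner_toeplitz {n : ℕ} {h : ℝ} {φ : Mat n → Mat n} {F : bargmann n h}
    (hF : InDomain h φ F) (G : bargmann n h) :
    ⟪G, toeplitz h φ F⟫_ℂ = ⟪(G : L2 n h), MemLp.toLp _ hF⟫_ℂ := by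
  rw [toeplitz, dif_pos hF]
  exact Submodule.inner_orthogonalProjectionOnto_eq_of_mem_left G _

/-- Since `toeplitz` takes the value `0` off its natural domain, linearity is available only for
combinations of elements of the domain. -/
theorem inDomain_sum_and_toeplitz_sum {n : ℕ} {h : ℝ} {φ : Mat n → Mat n} {ι : Type*} [Fintype ι]
    (c : ι → ℂ) (F : ι → bargmann n h) (hF : ∀ i, InDomain h φ (F i)) :
    InDomain h φ (∑ i, c i • F i) ∧
      toeplitz h φ (∑ i, c i • F i) = ∑ i, c i • toeplitz h φ (F i) := by
  have h1 : ∀ i, ((c i • (F i : L2 n h) : L2 n h) : Mat n → Vec n) =ᵐ[mu n h]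
      fun Z => c i • (F i : L2 n h) Z := fun i => Lp.coeFn_smul (c i) (F i : L2 n h)
  have h2 : ((∑ i, c i • F i : bargmann n h) : L2 n h) = ∑ i, c i • (F i : L2 n h) := by
    simp only [Submodule.coe_sum, Submodule.coe_smul]
  have h3 : (fun Z => act (φ Z) (((∑ i, c i • F i : bargmann n h) : L2 n h) Z)) =ᵐ[mu n h]
      ((∑ i, c i • MemLp.toLp _ (hF i) : L2 n h) : Mat n → Vec n) := by
    have h5 : ∀ i, ((c i • MemLp.toLp _ (hF i) : L2 n h) : Mat n → Vec n) =ᵐ[mu n h]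
        fun Z => c i • act (φ Z) ((F i : L2 n h) Z) := by
      intro i
      filter_upwards [Lp.coeFn_smul (c i) (MemLp.toLp _ (hF i)), (hF i).coeFn_toLp] with Z h6 h7
      rw [h6, Pi.smul_apply, h7]
    rw [h2]
    filter_upwards [coeFn_sum_L2 Finset.univ fun i => c i • (F i : L2 n h), ae_all_iff.2 h1,
      coeFn_sum_L2 Finset.univ fun i => c i • MemLp.toLp _ (hF i), ae_all_iff.2 h5]
      with Z h6 h7 h8 h9
    rw [h6, h8, act_sum]
    simp only [h7, h9, act_smul]
  have h4 : InDomain h φ (∑ i, c i • F i) := (memLp_congr_ae h3).2 (Lp.memLp _)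
  refine ⟨h4, ?_⟩
  have h5 : MemLp.toLp _ h4 = ∑ i, c i • MemLp.toLp _ (hF i) := Lp.ext (h4.coeFn_toLp.trans h3)
  rw [toeplitz, dif_pos h4, h5, map_sum]
  refine Finset.sum_congr rfl fun i _ => ?_
  rw [map_smul, toeplitz, dif_pos (hF i)]

/-- It allows a single operator to be treated as the product `T_φ T_1`, so that both sides of the
expansion are values of the same `Psi`. -/
theorem toeplitz_one {n : ℕ} (h : ℝ) (F : bargmann n h) : toeplitz h (fun _ => 1) F = F := by
  have h1 : InDomain h (fun _ => 1) F := by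
    simp only [InDomain, act_one]
    exact Lp.memLp _
  have h2 : MemLp.toLp _ h1 = (F : L2 n h) := by
    refine Lp.ext (h1.coeFn_toLp.trans ?_)
    simp only [act_one]
    rfl
  rw [toeplitz, dif_pos h1, h2, Submodule.orthogonalProjectionOnto_mem_subspace_eq_self]

theorem inner_smul_smul_bargmann {n : ℕ} {h : ℝ} (c d : ℂ) (F G : bargmann n h) :
    ⟪c • F, d • G⟫_ℂ = (starRingEnd ℂ) c * (d * ⟪F, G⟫_ℂ) := by
  change ⟪c • (F : L2 n h), d • (G : L2 n h)⟫_ℂ = _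
  rw [inner_smul_left, inner_smul_right]
  rfl

/-- The Berezin transform of an operator that respects the splitting of the coherent vectors along
the eigenvectors of `X`. -/
theorem berezin_eq {n : ℕ} {h : ℝ} (hh : 0 < h) (T : bargmann n h → bargmann n h) (V : UN n)
    (x s : Spec n)
    (hT : ∀ c : Fin (n + 1) → ℂ,
      T (∑ j, c j • coherent h ((V : Mat n) * Matrix.diagonal x * (V : Mat n)ᴴ) (column V j)) =
        ∑ j, c j • T (coherent h ((V : Mat n) * Matrix.diagonal x * (V : Mat n)ᴴ) (column V j)))
    (hs : ∀ i j, ⟪coherent h ((V : Mat n) * Matrix.diagonal x * (V : Mat n)ᴴ) (column V i),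
      T (coherent h ((V : Mat n) * Matrix.diagonal x * (V : Mat n)ᴴ) (column V j))⟫_ℂ =
        if i = j then s j else 0) :
    berezin h T ((V : Mat n) * Matrix.diagonal x * (V : Mat n)ᴴ) =
      (V : Mat n) * Matrix.diagonal
        (fun j => ((Real.exp (-(‖x j‖ ^ 2 / h)) : ℝ) : ℂ) * s j) * (V : Mat n)ᴴ := by
  set X := (V : Mat n) * Matrix.diagonal x * (V : Mat n)ᴴ with hX
  have hXn : X ∈ normalMatrices n := conj_diagonal_mem_normalMatrices V x
  have hpre : preBerezin h T X = (V : Mat n) * Matrix.diagonal s * (V : Mat n)ᴴ := by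
    -- The coordinates of `e_b` in the basis of columns of `V` are the conjugates of row `b`.
    have hc : ∀ b, coherent h X (EuclideanSpace.single b 1) =
        ∑ j, (starRingEnd ℂ) ((V : Mat n) b j) • coherent h X (column V j) := by
      intro b
      conv_lhs => rw [sum_column V (EuclideanSpace.single b 1)]
      rw [coherent_sum hh hXn]
      refine Finset.sum_congr rfl fun j _ => ?_
      congr 1
      simp [act_apply]
    ext a b
    rw [preBerezin, Matrix.of_apply, hc a, hc b, hT, sum_inner, Matrix.mul_apply]
    refine Finset.sum_congr rfl fun i _ => ?_
    rw [inner_sum, Finset.sum_eq_single i]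
    · rw [inner_smul_smul_bargmann, hs, if_pos rfl, Complex.conj_conj,
        Matrix.mul_diagonal, Matrix.conjTranspose_apply, Complex.star_def]
      ring
    · intro j _ hj
      rw [inner_smul_smul_bargmann, hs, if_neg hj.symm, mul_zero, mul_zero]
    · exact fun hi => absurd (Finset.mem_univ i) hi
  rw [berezin, hpre, hX, kernelInvSqrt_eq, conj_mul_conj, conj_mul_conj,
    Matrix.diagonal_mul_diagonal, Matrix.diagonal_mul_diagonal]
  congr 3
  funext j
  have h1 : (√(Real.exp (‖x j‖ ^ 2 / h)))⁻¹ * (√(Real.exp (‖x j‖ ^ 2 / h)))⁻¹ =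
      Real.exp (-(‖x j‖ ^ 2 / h)) := by
    rw [← mul_inv, Real.mul_self_sqrt (Real.exp_nonneg _), Real.exp_neg]
  rw [← h1]
  push_cast
  ring

/-- The Berezin transform of a Toeplitz operator. -/
theorem berezin_toeplitz {n : ℕ} {h : ℝ} (hh : 0 < h) {φ : Mat n → Mat n} {f : Spec n → ℂ}
    (hφ : IsSharp φ f) (hf : Continuous f) (V : UN n) (x : Spec n)
    (hd : ∀ j, MemLp (fun d => f d * kexp ((starRingEnd ℂ) (x j) / h) d) 2 (gaussianSpec n h)) :
    berezin h (toeplitz h φ) ((V : Mat n) * Matrix.diagonal x * (V : Mat n)ᴴ) =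
      (V : Mat n) * Matrix.diagonal
        (fun j => ((Real.exp (-(‖x j‖ ^ 2 / h)) : ℝ) : ℂ) *
          ∫ d, (starRingEnd ℂ) (kexp ((starRingEnd ℂ) (x j) / h) d) *
            (f d * kexp ((starRingEnd ℂ) (x j) / h) d) ∂gaussianSpec n h) * (V : Mat n)ᴴ := by
  have hdom := fun j => (isField_coherent hh V x j).inDomain (continuous_kexp _) hφ hf (hd j)
  refine berezin_eq hh _ V x _ (fun c => (inDomain_sum_and_toeplitz_sum c _ hdom).2) fun i j => ?_
  rw [inner_toeplitz (hdom j), (isField_coherent hh V x i).inner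
    (((isField_coherent hh V x j).act hφ).congr (hdom j).coeFn_toLp) (memLp_kexp hh _) (hd j),
    inner_column]
  split_ifs with hij
  · rw [hij, one_mul]
  · rw [zero_mul]

/-! ### The projection onto the Bargmann space -/

theorem norm_monomial {n : ℕ} {h : ℝ} (hh : 0 < h) (k : ℕ) (v : Vec n) :
    ‖monomial hh k v‖ = ‖v‖ * √(k.factorial * h ^ k) := by
  have h1 := (isField_monomial hh k v).sq_norm (memLp_pow hh k)
  simp only [norm_pow, ← pow_mul, mul_comm k 2] at h1
  rw [integral_norm_pow_gaussianSpec hh] at h1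
  rw [← Real.sqrt_sq (norm_nonneg (monomial hh k v)), h1, Real.sqrt_mul (sq_nonneg _),
    Real.sqrt_sq (norm_nonneg _)]

theorem sqrt_pow_eq {x : ℝ} (hx : 0 ≤ x) (k : ℕ) : √(x ^ k) = √x ^ k := by
  rw [← Real.sqrt_sq (pow_nonneg (Real.sqrt_nonneg x) k), ← pow_mul, mul_comm, pow_mul,
    Real.sq_sqrt hx]

theorem tsum_enorm_ne_top {ι E : Type*} [NormedAddCommGroup E] {f : ι → E}
    (hf : Summable fun i => ‖f i‖) : ∑' i, ‖f i‖ₑ ≠ ⊤ := by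
  simp only [← ofReal_norm]
  exact hf.tsum_ofReal_ne_top

/-- The moments `∫ conj(d_1^k) b(d) / (k! h^k)` of a function. -/
def moment {n : ℕ} (h : ℝ) (b : Spec n → ℂ) (k : ℕ) : ℂ :=
  (∫ d, (starRingEnd ℂ) (d 0 ^ k) * b d ∂gaussianSpec n h) / (k.factorial * (h : ℂ) ^ k)

/-- The left side is the norm of the `k`-th Taylor term of the projection, up to `‖v‖`. Parseval
would give square summability only; the geometric decay is what survives multiplication by an
unbounded symbol. -/
theorem exists_norm_moment_le {n : ℕ} {h c : ℝ} (hh : 0 < h) (hc : c ≤ h⁻¹ / 8)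
    {b : Spec n → ℂ} (hb : Growth c b) :
    ∃ C, 0 ≤ C ∧ ∀ k : ℕ, ‖moment h b k‖ * √(k.factorial * h ^ k) ≤ C * √(2 / 3) ^ k := by
  obtain ⟨C, hC0, hC⟩ := hb.exists_moment_bound hh hc
  refine ⟨C, hC0, fun k => ?_⟩
  have h1 : ‖∫ d, (starRingEnd ℂ) (d 0 ^ k) * b d ∂gaussianSpec n h‖ ≤
      C * √(k.factorial * (2 * h / 3) ^ k) := by
    refine (norm_integral_le_integral_norm _).trans (le_of_eq_of_le ?_ (hC k))
    simp
  have h2 : √(k.factorial * (2 * h / 3) ^ k) = √(k.factorial * h ^ k) * √(2 / 3) ^ k := by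
    rw [← sqrt_pow_eq (by norm_num), ← Real.sqrt_mul (by positivity)]
    congr 1
    rw [mul_div_right_comm, mul_pow]
    ring
  have h3 : ‖(k.factorial * (h : ℂ) ^ k : ℂ)‖ = √(k.factorial * h ^ k) * √(k.factorial * h ^ k) := by
    rw [Real.mul_self_sqrt (by positivity)]
    simp [abs_of_pos hh]
  have h4 : 0 < √(k.factorial * h ^ k) := Real.sqrt_pos.2 (by positivity)
  rw [moment, norm_div, h3]
  rw [h2] at h1
  calc _ = ‖∫ d, (starRingEnd ℂ) (d 0 ^ k) * b d ∂gaussianSpec n h‖ / √(k.factorial * h ^ k) := by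
        field_simp
    _ ≤ C * (√(k.factorial * h ^ k) * √(2 / 3) ^ k) / √(k.factorial * h ^ k) := by gcongr
    _ = _ := by field_simp

theorem summable_norm_moment_smul {n : ℕ} {h c : ℝ} (hh : 0 < h) (hc : c ≤ h⁻¹ / 8)
    {b : Spec n → ℂ} (hb : Growth c b) (v : Vec n) :
    Summable fun k => ‖moment h b k • monomial hh k v‖ := by
  obtain ⟨C, hC0, hC⟩ := exists_norm_moment_le hh hc hb
  have h1 : √(2 / 3 : ℝ) < 1 := by
    rw [Real.sqrt_lt' one_pos]
    norm_num
  refine Summable.of_nonneg_of_le (fun _ => norm_nonneg _) (fun k => ?_)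
    ((summable_geometric_of_lt_one (Real.sqrt_nonneg _) h1).mul_left (‖v‖ * C))
  rw [norm_smul, norm_monomial]
  calc ‖moment h b k‖ * (‖v‖ * √(k.factorial * h ^ k)) =
      ‖v‖ * (‖moment h b k‖ * √(k.factorial * h ^ k)) := by ring
    _ ≤ ‖v‖ * (C * √(2 / 3) ^ k) := by
        exact mul_le_mul_of_nonneg_left (hC k) (norm_nonneg v)
    _ = _ := by ring

/-- The monomials are orthogonal with squared norm `k! h^k ‖v‖²`, so the moments are the Fourier
coefficients of the projection. Both sides lie in `H_h` and have the same inner products with all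
monomials. -/
theorem hasSum_projection {n : ℕ} {h c : ℝ} (hh : 0 < h) (hc : c ≤ h⁻¹ / 8) {b : Spec n → ℂ}
    (hbc : Continuous b) (hb : Growth c b) {v : Vec n} {y : L2 n h} (hy : IsField h y b v) :
    HasSum (fun k => moment h b k • monomial hh k v)
      ((bargmann n h).orthogonalProjectionOnto y : L2 n h) := by
  have hi := inv_pos.2 hh
  have hb2 : MemLp b 2 (gaussianSpec n h) :=
    hb.memLp hh (by linarith) hbc.aestronglyMeasurable
  have hS := (summable_norm_moment_smul hh hc hb v).of_norm
  have hmem : (∑' k, moment h b k • monomial hh k v) ∈ bargmann n h :=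
    (Submodule.isClosed_topologicalClosure _).mem_of_tendsto hS.hasSum
      (Eventually.of_forall fun s => Submodule.sum_mem _ fun k _ =>
        Submodule.smul_mem _ _ (monomial_mem hh k v))
  have h0 : (∑' k, moment h b k • monomial hh k v) -
      ((bargmann n h).orthogonalProjectionOnto y : L2 n h) = 0 := by
    refine eq_zero_of_inner_monomial hh (Submodule.sub_mem _ hmem (Submodule.coe_mem _))
      fun l i => ?_
    rw [inner_sub_right]
    have h1 : ⟪monomial hh l (EuclideanSpace.single i 1),
        ((bargmann n h).orthogonalProjectionOnto y : L2 n h)⟫_ℂ =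
        ⟪monomial hh l (EuclideanSpace.single i 1), y⟫_ℂ :=
      Submodule.inner_orthogonalProjectionOnto_eq_of_mem_left
        (⟨_, monomial_mem hh l _⟩ : bargmann n h) y
    have h2 := hS.hasSum.mapL (innerSL ℂ (monomial hh l (EuclideanSpace.single i 1)))
    simp only [innerSL_apply_apply, inner_smul_right, inner_monomial] at h2
    have h3 := h2.unique (hasSum_ite_eq l
      (moment h b l * (⟪EuclideanSpace.single i (1 : ℂ), v⟫_ℂ * (l.factorial * (h : ℂ) ^ l))) |>.congr_fun
        fun k => by
          by_cases hkl : k = l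
          · subst hkl
            simp
          · simp [hkl, Ne.symm hkl])
    rw [h3, h1, (isField_monomial hh l _).inner hy (memLp_pow hh l) hb2, moment]
    have : (l.factorial * (h : ℂ) ^ l) ≠ 0 :=
      mul_ne_zero (by exact_mod_cast l.factorial_ne_zero) (pow_ne_zero _ (by exact_mod_cast hh.ne'))
    generalize (l.factorial * (h : ℂ) ^ l) = D at this ⊢
    field_simp
    ring
  rw [← sub_eq_zero.1 h0]
  exact hS.hasSum

/-- A Toeplitz operator applied to a projection: the product lies in `L²`, and is the sum of a
series. -/
theorem exists_hasSum_act_projection {n : ℕ} {h c c' : ℝ} (hh : 0 < h) (hc : c ≤ h⁻¹ / 8)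
    {b : Spec n → ℂ} (hbc : Continuous b) (hb : Growth c b) {v : Vec n} {y : L2 n h}
    (hy : IsField h y b v) (hc' : c' ≤ h⁻¹ / 16) {φ : Mat n → Mat n} {f : Spec n → ℂ}
    (hφ : IsSharp φ f) (hfc : Continuous f) (hf : Growth c' f) :
    ∃ W : ℕ → L2 n h, (∀ k, IsField h (W k) (fun d => f d * d 0 ^ k) v) ∧
      ∃ H : InDomain h φ ((bargmann n h).orthogonalProjectionOnto y),
        HasSum (fun k => moment h b k • W k) (MemLp.toLp _ H) := by
  have hi := inv_pos.2 hh
  have hfm : ∀ k, MemLp (fun d : Spec n => f d * d 0 ^ k) 2 (gaussianSpec n h) := fun k =>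
    (hf.mul (growth_pow k (ε := h⁻¹ / 16) (by positivity))).memLp hh (by linarith)
      (hfc.mul (continuous_pow_zero k)).aestronglyMeasurable
  have hm : ∀ k, MemLp (fun Z => act (φ Z) (monomial hh k v Z)) 2 (mu n h) := fun k =>
    ((isField_monomial hh k v).act hφ).memLp
      (hφ.aestronglyMeasurable_act hfc (Lp.aestronglyMeasurable _))
      (hfc.mul (continuous_pow_zero k)) (hfm k)
  have hW : ∀ k, IsField h ((hm k).toLp _ : L2 n h) (fun d => f d * d 0 ^ k) v := fun k =>
    ((isField_monomial hh k v).act hφ).congr (hm k).coeFn_toLp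
  refine ⟨fun k => (hm k).toLp _, hW, ?_⟩
  have hsum : Summable fun k => ‖moment h b k • ((hm k).toLp _ : L2 n h)‖ := by
    obtain ⟨C, hC0, hC⟩ := exists_norm_moment_le hh hc hb
    obtain ⟨D, hD0, hD⟩ := hf.exists_sq_moment_bound hh hc'
    -- The decay of the moments beats the growth of `‖φ Z^k v‖`, since `2/3 · 8/7 = 16/21`.
    have h1 : √(2 / 3) * √(8 / 7 : ℝ) < 1 := by
      rw [← Real.sqrt_mul (by norm_num), Real.sqrt_lt' one_pos]
      norm_num
    refine Summable.of_nonneg_of_le (fun _ => norm_nonneg _) (fun k => ?_)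
      ((summable_geometric_of_lt_one (by positivity) h1).mul_left (‖v‖ * √D * C))
    have h2 : ‖((hm k).toLp _ : L2 n h)‖ ≤
        ‖v‖ * (√D * (√(k.factorial * h ^ k) * √(8 / 7) ^ k)) := by
      rw [← Real.sqrt_sq (norm_nonneg ((hm k).toLp _ : L2 n h)), (hW k).sq_norm (hfm k),
        Real.sqrt_mul (sq_nonneg _), Real.sqrt_sq (norm_nonneg _), ← sqrt_pow_eq (by norm_num),
        ← Real.sqrt_mul (by positivity), ← Real.sqrt_mul hD0]
      refine mul_le_mul_of_nonneg_left (Real.sqrt_le_sqrt ((hD k).trans_eq ?_)) (norm_nonneg _)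
      rw [mul_assoc, ← mul_pow]
      congr 3
      ring
    rw [norm_smul]
    calc _ ≤ ‖moment h b k‖ * (‖v‖ * (√D * (√(k.factorial * h ^ k) * √(8 / 7) ^ k))) := by gcongr
      _ = ‖v‖ * √D * √(8 / 7) ^ k * (‖moment h b k‖ * √(k.factorial * h ^ k)) := by ring
      _ ≤ ‖v‖ * √D * √(8 / 7) ^ k * (C * √(2 / 3) ^ k) := by
          exact mul_le_mul_of_nonneg_left (hC k) (by positivity)
      _ = _ := by
          rw [mul_pow]
          ring
  have hP := hasSum_projection hh hc hbc hb hy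
  have h1 := Lp.hasSum_coeFn_tsum (tsum_enorm_ne_top (summable_norm_moment_smul hh hc hb v))
  rw [hP.tsum_eq] at h1
  have h2 := Lp.hasSum_coeFn_tsum (tsum_enorm_ne_top hsum)
  -- Absolute convergence in `L²` gives pointwise convergence almost everywhere, before and after
  -- multiplication by `φ`. At each such `Z` the matrix `φ(Z)` acts continuously, so the second sum
  -- is `φ(Z)` applied to the first.
  have hae : (fun Z => act (φ Z) (((bargmann n h).orthogonalProjectionOnto y : L2 n h) Z)) =ᵐ[mu n h]
      ((∑' k, moment h b k • ((hm k).toLp _ : L2 n h) : L2 n h) : Mat n → Vec n) := by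
    have h3 : ∀ k, ((moment h b k • monomial hh k v : L2 n h) : Mat n → Vec n) =ᵐ[mu n h]
        fun Z => moment h b k • monomial hh k v Z := fun k => Lp.coeFn_smul _ _
    have h4 : ∀ k, ((moment h b k • ((hm k).toLp _ : L2 n h) : L2 n h) : Mat n → Vec n) =ᵐ[mu n h]
        fun Z => moment h b k • act (φ Z) (monomial hh k v Z) := by
      intro k
      filter_upwards [Lp.coeFn_smul (moment h b k) ((hm k).toLp _ : L2 n h),
        (hm k).coeFn_toLp] with Z h5 h6
      rw [h5, Pi.smul_apply, h6]
    filter_upwards [h1, h2, ae_all_iff.2 h3, ae_all_iff.2 h4] with Z h1 h2 h3 h4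
    simp only [h3] at h1
    simp only [h4] at h2
    have hcont : Continuous fun u : Vec n => act (φ Z) u :=
      continuous_act.comp (continuous_const.prodMk continuous_id)
    have h5 := h1.map (Matrix.toEuclideanLin (φ Z)) hcont
    refine HasSum.unique ?_ h2
    refine h5.congr_fun fun k => ?_
    simp only [Function.comp, map_smul, act_eq_toEuclideanLin]
  have H : InDomain h φ ((bargmann n h).orthogonalProjectionOnto y) :=
    (memLp_congr_ae hae).2 (Lp.memLp _)
  refine ⟨H, ?_⟩
  have h3 : MemLp.toLp _ H = ∑' k, moment h b k • ((hm k).toLp _ : L2 n h) :=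
    Lp.ext (H.coeFn_toLp.trans hae)
  rw [h3]
  exact hsum.of_norm.hasSum

/-! ### Products of Toeplitz operators -/

/-- The projection is resummed into an integral against the scalar kernel `exp(z conj(w) / h)`. The
interchange is justified because the two moment bounds together give terms of size `(2/3)^k`. -/
theorem hasSum_moment_integral {n : ℕ} {h c : ℝ} (hh : 0 < h) (hc : c ≤ h⁻¹ / 8)
    {α b : Spec n → ℂ} (hαc : Continuous α) (hα : Growth c α) (hbc : Continuous b)
    (hb : Growth c b) :
    HasSum (fun k => moment h b k * ∫ d, α d * d 0 ^ k ∂gaussianSpec n h)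
      (∫ z, α z.1 * b z.2 * Complex.exp (z.1 0 * (starRingEnd ℂ) (z.2 0) / h)
        ∂(gaussianSpec n h).prod (gaussianSpec n h)) := by
  have hi := inv_pos.2 hh
  let F : ℕ → Spec n × Spec n → ℂ := fun k z => (α z.1 * z.1 0 ^ k) *
    (((starRingEnd ℂ) (z.2 0 ^ k) * b z.2) / (k.factorial * (h : ℂ) ^ k))
  have i1 : ∀ k, Integrable (fun d : Spec n => α d * d 0 ^ k) (gaussianSpec n h) := fun k =>
    (hα.mul (growth_pow k (ε := h⁻¹ / 8) (by positivity))).integrable hh (by linarith)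
      (hαc.mul (continuous_pow_zero k)).aestronglyMeasurable
  have i2 : ∀ k, Integrable (fun d : Spec n => (starRingEnd ℂ) (d 0 ^ k) * b d)
      (gaussianSpec n h) := fun k =>
    ((growth_pow k (ε := h⁻¹ / 8) (by positivity)).conj.mul hb).integrable hh (by linarith)
      (Continuous.aestronglyMeasurable (by fun_prop))
  have hFi : ∀ k, Integrable (F k) ((gaussianSpec n h).prod (gaussianSpec n h)) := fun k =>
    (i1 k).mul_prod ((i2 k).div_const _)
  have hFint : ∀ k, ∫ z, F k z ∂(gaussianSpec n h).prod (gaussianSpec n h) =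
      moment h b k * ∫ d, α d * d 0 ^ k ∂gaussianSpec n h := by
    intro k
    rw [integral_prod_mul (fun d : Spec n => α d * d 0 ^ k)
      (fun d : Spec n => ((starRingEnd ℂ) (d 0 ^ k) * b d) / (k.factorial * (h : ℂ) ^ k)),
      integral_div, mul_comm]
    rfl
  have hsum : Summable fun k => ∫ z, ‖F k z‖ ∂(gaussianSpec n h).prod (gaussianSpec n h) := by
    obtain ⟨C, hC0, hC⟩ := hα.exists_moment_bound hh hc
    obtain ⟨D, hD0, hD⟩ := hb.exists_moment_bound hh hc
    refine Summable.of_nonneg_of_le (fun k => integral_nonneg fun _ => norm_nonneg _) (fun k => ?_)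
      ((summable_geometric_of_lt_one (r := 2 / 3) (by norm_num) (by norm_num)).mul_left (C * D))
    simp only [F, norm_mul (α _ * _)]
    rw [integral_prod_mul (fun d : Spec n => ‖α d * d 0 ^ k‖)
      (fun d : Spec n => ‖((starRingEnd ℂ) (d 0 ^ k) * b d) / (k.factorial * (h : ℂ) ^ k)‖)]
    have e1 : ∫ d : Spec n, ‖α d * d 0 ^ k‖ ∂gaussianSpec n h ≤
        C * √(k.factorial * (2 * h / 3) ^ k) := by
      simpa only [mul_comm (α _)] using hC k
    have e2 : ∫ d : Spec n, ‖((starRingEnd ℂ) (d 0 ^ k) * b d) / (k.factorial * (h : ℂ) ^ k)‖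
        ∂gaussianSpec n h ≤ D * √(k.factorial * (2 * h / 3) ^ k) / (k.factorial * h ^ k) := by
      simp only [norm_div]
      rw [integral_div]
      have e3 : ‖(k.factorial * (h : ℂ) ^ k : ℂ)‖ = k.factorial * h ^ k := by
        simp [abs_of_pos hh]
      rw [e3]
      gcongr
      refine le_of_eq_of_le ?_ (hD k)
      simp
    calc _ ≤ (C * √(k.factorial * (2 * h / 3) ^ k)) *
          (D * √(k.factorial * (2 * h / 3) ^ k) / (k.factorial * h ^ k)) :=
          mul_le_mul e1 e2 (integral_nonneg fun _ => norm_nonneg _) (by positivity)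
      _ = C * D * (√(k.factorial * (2 * h / 3) ^ k) * √(k.factorial * (2 * h / 3) ^ k)) /
          (k.factorial * h ^ k) := by ring
      _ = C * D * (2 / 3) ^ k := by
          have e4 : (2 * h / 3) ^ k = (2 / 3) ^ k * h ^ k := by
            rw [← mul_pow]
            ring
          have : (0 : ℝ) < k.factorial := by positivity
          rw [Real.mul_self_sqrt (by positivity), e4]
          field_simp
  have h1 := hasSum_integral_of_summable_integral_norm hFi hsum
  simp only [hFint] at h1
  suffices e : ∀ z, ∑' k, F k z =
      α z.1 * b z.2 * Complex.exp (z.1 0 * (starRingEnd ℂ) (z.2 0) / h) by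
    simpa only [e] using h1
  intro z
  have h2 : HasSum (fun k => F k z)
      (α z.1 * b z.2 * Complex.exp (z.1 0 * (starRingEnd ℂ) (z.2 0) / h)) := by
    have h3 := (NormedSpace.expSeries_div_hasSum_exp
      (z.1 0 * (starRingEnd ℂ) (z.2 0) / h)).mul_left (α z.1 * b z.2)
    rw [← Complex.exp_eq_exp_ℂ] at h3
    refine h3.congr_fun fun k => ?_
    simp only [F, map_pow, div_pow, mul_pow]
    ring
  exact h2.tsum_eq

theorem growth_mul_kexp {n : ℕ} {h c : ℝ} (hh : 0 < h) (hc : c ≤ h⁻¹ / 16) {g : Spec n → ℂ}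
    (hg : Growth c g) (y : ℂ) : Growth (h⁻¹ / 8) fun d => g d * kexp y d := by
  have hi := inv_pos.2 hh
  exact (hg.mul (growth_kexp y (ε := h⁻¹ / 16) (by positivity))).mono (by linarith)

theorem memLp_mul_kexp {n : ℕ} {h c : ℝ} (hh : 0 < h) (hc : c ≤ h⁻¹ / 16) {g : Spec n → ℂ}
    (hgc : Continuous g) (hg : Growth c g) (y : ℂ) :
    MemLp (fun d => g d * kexp y d) 2 (gaussianSpec n h) := by
  have hi := inv_pos.2 hh
  exact (growth_mul_kexp hh hc hg y).memLp hh (by linarith)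
    (hgc.mul (continuous_kexp y)).aestronglyMeasurable

theorem inDomain_coherent_column {n : ℕ} {h : ℝ} (hh : 0 < h) {φ : Mat n → Mat n} {f : Spec n → ℂ}
    (hφ : IsSharp φ f) (hf : Continuous f) (V : UN n) (x : Spec n) (j : Fin (n + 1))
    (hd : MemLp (fun d => f d * kexp ((starRingEnd ℂ) (x j) / h) d) 2 (gaussianSpec n h)) :
    InDomain h φ
      (coherent h ((V : Mat n) * Matrix.diagonal x * (V : Mat n)ᴴ) (column V j)) :=
  (isField_coherent hh V x j).inDomain (continuous_kexp _) hφ hf hd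

theorem inDomain_coherent {n : ℕ} {h c : ℝ} (hh : 0 < h) (hc : c ≤ h⁻¹ / 16) {φ : Mat n → Mat n}
    {f : Spec n → ℂ} (hφ : IsSharp φ f) (hfc : Continuous f) (hf : Growth c f) {X : Mat n}
    (hX : X ∈ normalMatrices n) (χ : Vec n) : InDomain h φ (coherent h X χ) := by
  obtain ⟨V, x, rfl⟩ := exists_unitary_diagonal hX
  rw [sum_column V χ, coherent_sum hh hX]
  exact (inDomain_sum_and_toeplitz_sum _ _ fun j =>
    inDomain_coherent_column hh hφ hfc V x j (memLp_mul_kexp hh hc hfc hf _)).1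

theorem exists_hasSum_toeplitz_toeplitz {n : ℕ} {h c : ℝ} (hh : 0 < h) (hc : c ≤ h⁻¹ / 16)
    {φ ψ : Mat n → Mat n} {f g : Spec n → ℂ} (hφ : IsSharp φ f) (hψ : IsSharp ψ g)
    (hfc : Continuous f) (hgc : Continuous g) (hf : Growth c f) (hg : Growth c g)
    (V : UN n) (x : Spec n) (j : Fin (n + 1)) :
    ∃ W : ℕ → L2 n h, (∀ k, IsField h (W k) (fun d => f d * d 0 ^ k) (column V j)) ∧
      ∃ H : InDomain h φ (toeplitz h ψ
          (coherent h ((V : Mat n) * Matrix.diagonal x * (V : Mat n)ᴴ) (column V j))),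
        HasSum (fun k => moment h (fun d => g d * kexp ((starRingEnd ℂ) (x j) / h) d) k • W k)
          (MemLp.toLp _ H) := by
  have hdom := inDomain_coherent_column hh hψ hgc V x j (memLp_mul_kexp hh hc hgc hg _)
  have hfield := ((isField_coherent hh V x j).act hψ).congr hdom.coeFn_toLp
  have hT : toeplitz h ψ (coherent h ((V : Mat n) * Matrix.diagonal x * (V : Mat n)ᴴ) (column V j)) =
      (bargmann n h).orthogonalProjectionOnto (MemLp.toLp _ hdom) := by
    rw [toeplitz, dif_pos hdom]
  rw [hT]
  exact exists_hasSum_act_projection hh le_rfl (hgc.mul (continuous_kexp _))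
    (growth_mul_kexp hh hc hg _) hfield hc hφ hfc hf

theorem inDomain_toeplitz_coherent {n : ℕ} {h c : ℝ} (hh : 0 < h) (hc : c ≤ h⁻¹ / 16)
    {φ ψ : Mat n → Mat n} {f g : Spec n → ℂ} (hφ : IsSharp φ f) (hψ : IsSharp ψ g)
    (hfc : Continuous f) (hgc : Continuous g) (hf : Growth c f) (hg : Growth c g) {X : Mat n}
    (hX : X ∈ normalMatrices n) (χ : Vec n) :
    InDomain h φ (toeplitz h ψ (coherent h X χ)) := by
  obtain ⟨V, x, rfl⟩ := exists_unitary_diagonal hX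
  rw [sum_column V χ, coherent_sum hh hX, (inDomain_sum_and_toeplitz_sum _ _ fun j =>
    inDomain_coherent_column hh hψ hgc V x j (memLp_mul_kexp hh hc hgc hg _)).2]
  refine (inDomain_sum_and_toeplitz_sum _ _ fun j => ?_).1
  obtain ⟨_, _, H, _⟩ := exists_hasSum_toeplitz_toeplitz hh hc hφ hψ hfc hgc hf hg V x j
  exact H

/-- The Berezin transform of a product of Toeplitz operators. -/
theorem berezin_toeplitz_toeplitz {n : ℕ} {h c : ℝ} (hh : 0 < h) (hc : c ≤ h⁻¹ / 16)
    {φ ψ : Mat n → Mat n} {f g : Spec n → ℂ} (hφ : IsSharp φ f) (hψ : IsSharp ψ g)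
    (hfc : Continuous f) (hgc : Continuous g) (hf : Growth c f) (hg : Growth c g)
    (V : UN n) (x : Spec n) :
    berezin h (toeplitz h φ ∘ toeplitz h ψ) ((V : Mat n) * Matrix.diagonal x * (V : Mat n)ᴴ) =
      (V : Mat n) * Matrix.diagonal
        (fun j => ((Real.exp (-(‖x j‖ ^ 2 / h)) : ℝ) : ℂ) *
          ∫ z, ((starRingEnd ℂ) (kexp ((starRingEnd ℂ) (x j) / h) z.1) * f z.1) *
            (g z.2 * kexp ((starRingEnd ℂ) (x j) / h) z.2) *
            Complex.exp (z.1 0 * (starRingEnd ℂ) (z.2 0) / h)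
            ∂(gaussianSpec n h).prod (gaussianSpec n h)) * (V : Mat n)ᴴ := by
  have hi := inv_pos.2 hh
  have hdom := fun j => inDomain_coherent_column hh hψ hgc V x j (memLp_mul_kexp hh hc hgc hg _)
  refine berezin_eq hh _ V x _ (fun c' => ?_) fun i j => ?_
  · simp only [Function.comp]
    rw [(inDomain_sum_and_toeplitz_sum c' _ hdom).2]
    refine (inDomain_sum_and_toeplitz_sum c' _ fun j => ?_).2
    obtain ⟨_, _, H, _⟩ := exists_hasSum_toeplitz_toeplitz hh hc hφ hψ hfc hgc hf hg V x j
    exact H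
  · obtain ⟨W, hW, H, hs⟩ := exists_hasSum_toeplitz_toeplitz hh hc hφ hψ hfc hgc hf hg V x j
    rw [Function.comp, inner_toeplitz H]
    have h1 := hs.mapL (innerSL ℂ
      (coherent h ((V : Mat n) * Matrix.diagonal x * (V : Mat n)ᴴ) (column V i) : L2 n h))
    have hfm : ∀ k, MemLp (fun d : Spec n => f d * d 0 ^ k) 2 (gaussianSpec n h) := fun k =>
      (hf.mul (growth_pow k (ε := h⁻¹ / 16) (by positivity))).memLp hh (by linarith)
        (hfc.mul (continuous_pow_zero k)).aestronglyMeasurable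
    have h2 : ∀ k, ⟪(coherent h ((V : Mat n) * Matrix.diagonal x * (V : Mat n)ᴴ) (column V i) : L2 n h),
        W k⟫_ℂ = (if i = j then 1 else 0) *
          ∫ d, (starRingEnd ℂ) (kexp ((starRingEnd ℂ) (x i) / h) d) * (f d * d 0 ^ k)
            ∂gaussianSpec n h := by
      intro k
      rw [(isField_coherent hh V x i).inner (hW k) (memLp_kexp hh _) (hfm k), inner_column]
    simp only [innerSL_apply_apply, inner_smul_right, h2] at h1
    split_ifs with hij
    · subst hij
      simp only [if_true, one_mul, ← mul_assoc] at h1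
      refine h1.unique ?_
      have hα : Growth (h⁻¹ / 8) fun d =>
          (starRingEnd ℂ) (kexp ((starRingEnd ℂ) (x i) / h) d) * f d :=
        (((growth_kexp _ (ε := h⁻¹ / 16) (by positivity)).conj).mul hf).mono (by linarith)
      exact hasSum_moment_integral hh le_rfl (by fun_prop) hα
        (hgc.mul (continuous_kexp _)) (growth_mul_kexp hh hc hg _)
    · simp only [if_neg hij, zero_mul, mul_zero] at h1
      exact h1.unique hasSum_zero

/-! ### Rescaled Gaussian integrals -/

/-- The point `(x; 0, …, 0)`. -/
def base (n : ℕ) (x : ℂ) : Spec n := Fin.cons x 0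

theorem nsq_sub_base {n : ℕ} (x : ℂ) (w : Spec n) :
    nsq (w - base n x) = nsq w - ‖w 0‖ ^ 2 + ‖w 0 - x‖ ^ 2 := by
  simp only [nsq, Fin.sum_univ_succ, Pi.sub_apply, base, Fin.cons_zero, Fin.cons_succ,
    Pi.zero_apply, sub_zero]
  ring

theorem sq_norm_sub (w x : ℂ) : ((‖w - x‖ ^ 2 : ℝ) : ℂ) =
    ((‖w‖ ^ 2 : ℝ) : ℂ) - (starRingEnd ℂ) w * x - w * (starRingEnd ℂ) x + ((‖x‖ ^ 2 : ℝ) : ℂ) := by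
  push_cast
  rw [← Complex.mul_conj', ← Complex.mul_conj', ← Complex.mul_conj', map_sub]
  ring

/-- Completing the square: `|exp(w_1 conj(x)/h)|²` and the normalization `exp(-|x|²/h)` only
recentre the Gaussian at `x̂`. -/
theorem gaussDensity_sub_base_smul {n : ℕ} {h : ℝ} (hh : 0 < h) (x : ℂ) (f : Spec n → ℂ)
    (w : Spec n) : gaussDensity n h (w - base n x) • f w =
    ((Real.exp (-(‖x‖ ^ 2 / h)) : ℝ) : ℂ) * gaussDensity n h w •
      ((starRingEnd ℂ) (kexp ((starRingEnd ℂ) x / h) w) *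
        (f w * kexp ((starRingEnd ℂ) x / h) w)) := by
  have h0 : (h : ℂ) ≠ 0 := by exact_mod_cast hh.ne'
  have key : ((Real.exp (-(‖x‖ ^ 2 / h)) : ℝ) : ℂ) *
      ((Real.exp (-h⁻¹ * nsq w) : ℝ) : ℂ) * ((starRingEnd ℂ) (kexp ((starRingEnd ℂ) x / h) w) *
      kexp ((starRingEnd ℂ) x / h) w) = ((Real.exp (-h⁻¹ * nsq (w - base n x)) : ℝ) : ℂ) := by
    rw [kexp, ← Complex.exp_conj, Complex.ofReal_exp, Complex.ofReal_exp, Complex.ofReal_exp,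
      ← Complex.exp_add, ← Complex.exp_add, ← Complex.exp_add, nsq_sub_base]
    congr 1
    have := sq_norm_sub (w 0) x
    simp only [Complex.ofReal_add, Complex.ofReal_sub, Complex.ofReal_mul, this, map_mul, map_div₀,
      Complex.conj_conj, Complex.conj_ofReal, Complex.ofReal_neg, Complex.ofReal_inv,
      Complex.ofReal_div]
    field_simp
    ring
  rw [gaussDensity, gaussDensity, Complex.real_smul, Complex.real_smul, Complex.ofReal_mul,
    Complex.ofReal_mul, ← key]
  ring

theorem exp_mul_integral_gaussianSpec {n : ℕ} {h : ℝ} (hh : 0 < h) (x : ℂ) (f : Spec n → ℂ) :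
    ((Real.exp (-(‖x‖ ^ 2 / h)) : ℝ) : ℂ) *
      ∫ d, (starRingEnd ℂ) (kexp ((starRingEnd ℂ) x / h) d) *
        (f d * kexp ((starRingEnd ℂ) x / h) d) ∂gaussianSpec n h =
      ∫ v, gaussDensity n h v • f (base n x + v) := by
  rw [integral_gaussianSpec hh, ← integral_const_mul,
    ← integral_add_left_eq_self (μ := (volume : Measure (Spec n))) _ (base n x)]
  refine integral_congr_ae (ae_of_all _ fun v => ?_)
  dsimp only
  rw [← gaussDensity_sub_base_smul hh, add_sub_cancel_left]

/-- The density of the complex Gaussian measure on `ℂ^N × ℂ^N` that governs products of Toeplitz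
operators. -/
def rho {n : ℕ} (z : Spec n × Spec n) : ℂ :=
  (((Real.pi ^ (n + 1)) ^ 2)⁻¹ : ℝ) *
    Complex.exp (z.1 0 * (starRingEnd ℂ) (z.2 0) - (nsq z.1 : ℝ) - (nsq z.2 : ℝ))

/-- `∬ f(x̂ + t p) g(x̂ + t q) ρ(p, q) dp dq` with `x̂ = (x; 0, …, 0)`. -/
def Psi {n : ℕ} (x : ℂ) (f g : Spec n → ℂ) (t : ℝ) : ℂ :=
  ∫ z : Spec n × Spec n, f (base n x + t • z.1) * g (base n x + t • z.2) * rho z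

theorem nsq_smul {n : ℕ} (t : ℝ) (d : Spec n) : nsq (t • d) = t ^ 2 * nsq d := by
  simp only [nsq, Pi.smul_apply, norm_smul, Real.norm_eq_abs, mul_pow, sq_abs, Finset.mul_sum]

theorem finrank_spec (n : ℕ) : Module.finrank ℝ (Spec n) = 2 * (n + 1) := by
  rw [Module.finrank_pi_fintype]
  simp [mul_comm]

/-- The normalization, the two exponentials and the kernel combine with the Gaussian weights into
the exponent of `ρ` at `((w - x̂)/√h, (w' - x̂)/√h)`. -/
theorem exp_mul_integral_gaussianSpec_prod {n : ℕ} {h : ℝ} (hh : 0 < h) (x : ℂ)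
    (f g : Spec n → ℂ) :
    ((Real.exp (-(‖x‖ ^ 2 / h)) : ℝ) : ℂ) *
      ∫ z, ((starRingEnd ℂ) (kexp ((starRingEnd ℂ) x / h) z.1) * f z.1) *
        (g z.2 * kexp ((starRingEnd ℂ) x / h) z.2) *
        Complex.exp (z.1 0 * (starRingEnd ℂ) (z.2 0) / h)
        ∂(gaussianSpec n h).prod (gaussianSpec n h) = Psi x f g (√h) := by
  have hpi := Real.pi_pos
  have hm : Measurable fun d : Spec n => ENNReal.ofReal (gaussDensity n h d) := by fun_prop
  have hprod : (gaussianSpec n h).prod (gaussianSpec n h) =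
      (volume : Measure (Spec n × Spec n)).withDensity fun z =>
        ENNReal.ofReal (gaussDensity n h z.1 * gaussDensity n h z.2) := by
    rw [gaussianSpec_eq, prod_withDensity hm hm]
    simp only [← ENNReal.ofReal_mul (gaussDensity_nonneg hh _)]
    rfl
  rw [hprod, integral_withDensity_eq_integral_toReal_smul (by fun_prop)
    (ae_of_all _ fun _ => ENNReal.ofReal_lt_top)]
  simp only [ENNReal.toReal_ofReal (mul_nonneg (gaussDensity_nonneg hh _) (gaussDensity_nonneg hh _))]
  have hs : 0 < √h := Real.sqrt_pos.2 hh
  let B : Spec n × Spec n := (base n x, base n x)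
  let F : Spec n × Spec n → ℂ := fun v =>
    f (base n x + v.1) * g (base n x + v.2) * rho ((√h)⁻¹ • v)
  have hPsi : Psi x f g (√h) = ∫ v, F (√h • v) := by
    rw [Psi]
    refine integral_congr_ae (ae_of_all _ fun z => ?_)
    simp only [F, Prod.smul_fst, Prod.smul_snd, smul_smul, inv_mul_cancel₀ hs.ne', one_smul]
  have hdim : Module.finrank ℝ (Spec n × Spec n) = 2 * (2 * (n + 1)) := by
    rw [Module.finrank_prod, finrank_spec]
    ring
  have hvol : (volume : Measure (Spec n × Spec n)).IsAddHaarMeasure :=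
    Measure.prod.instIsAddHaarMeasure _ _
  rw [hPsi, Measure.integral_comp_smul, ← integral_const_mul, ← integral_smul,
    ← integral_add_left_eq_self (μ := (volume : Measure (Spec n × Spec n))) _ B]
  refine integral_congr_ae (ae_of_all _ fun v => ?_)
  simp only [F, Prod.fst_add, Prod.snd_add, B]
  set w := base n x + v.1 with hw
  set w' := base n x + v.2 with hw'
  have hv : v.1 = w - base n x := by simp [hw]
  have hv' : v.2 = w' - base n x := by simp [hw']
  have hv0 : v.1 0 = w 0 - x := by simp [hv, base]
  have hv0' : v.2 0 = w' 0 - x := by simp [hv', base]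
  have h0 : (h : ℂ) ≠ 0 := by exact_mod_cast hh.ne'
  have hsq : (√h)⁻¹ ^ 2 = h⁻¹ := by rw [inv_pow, Real.sq_sqrt hh.le]
  have key : ((Real.exp (-(‖x‖ ^ 2 / h)) : ℝ) : ℂ) * (((Real.exp (-h⁻¹ * nsq w) : ℝ) : ℂ) *
      ((Real.exp (-h⁻¹ * nsq w') : ℝ) : ℂ)) * ((starRingEnd ℂ) (kexp ((starRingEnd ℂ) x / h) w) *
      kexp ((starRingEnd ℂ) x / h) w' * Complex.exp (w 0 * (starRingEnd ℂ) (w' 0) / h)) =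
      Complex.exp (((√h)⁻¹ • v).1 0 * (starRingEnd ℂ) (((√h)⁻¹ • v).2 0) -
        (nsq ((√h)⁻¹ • v).1 : ℝ) - (nsq ((√h)⁻¹ • v).2 : ℝ)) := by
    rw [kexp, kexp, ← Complex.exp_conj, Complex.ofReal_exp, Complex.ofReal_exp, Complex.ofReal_exp]
    simp only [← Complex.exp_add]
    congr 1
    simp only [Prod.smul_fst, Prod.smul_snd, nsq_smul, hsq, Pi.smul_apply, Complex.real_smul,
      map_mul, Complex.conj_ofReal]
    have e1 : ((√h)⁻¹ : ℝ) * v.1 0 * (((√h)⁻¹ : ℝ) * (starRingEnd ℂ) (v.2 0)) =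
        ((h⁻¹ : ℝ) : ℂ) * ((w 0 - x) * (starRingEnd ℂ) (w' 0 - x)) := by
      rw [← hsq, hv0, hv0']
      push_cast
      ring
    rw [e1, hv, hv', nsq_sub_base, nsq_sub_base]
    have h1 := sq_norm_sub (w 0) x
    have h2 := sq_norm_sub (w' 0) x
    have h3 := Complex.mul_conj' x
    simp only [Complex.ofReal_add, Complex.ofReal_sub, Complex.ofReal_mul, h1, h2, map_div₀,
      Complex.conj_conj, Complex.conj_ofReal, Complex.ofReal_neg, Complex.ofReal_inv,
      Complex.ofReal_div, Complex.ofReal_pow, ← h3, map_sub]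
    field_simp
    ring
  rw [rho, ← key, hdim, gaussDensity, gaussDensity]
  -- The Jacobian of the scaling by `√h` in real dimension `4N` accounts for the powers of `h` in
  -- the two Gaussian normalizations.
  have hc : |((√h) ^ (2 * (2 * (n + 1))))⁻¹| = ((h ^ (n + 1)) ^ 2)⁻¹ := by
    rw [abs_of_pos (by positivity), pow_mul, Real.sq_sqrt hh.le, mul_comm 2, pow_mul]
  rw [hc]
  simp only [Complex.real_smul]
  push_cast
  rw [mul_pow]
  ring

/-! ### Smooth functions of Gaussian growth and their Wirtinger derivatives -/

/-- Smooth functions all of whose derivatives are `O(exp(c ‖d‖²))`, with `c` depending on the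
order of the derivative. -/
def GaussSmooth {n : ℕ} (f : Spec n → ℂ) : Prop :=
  ContDiff ℝ ∞ f ∧ ∀ k : ℕ, ∃ C c : ℝ, ∀ d, ‖iteratedFDeriv ℝ k f d‖ ≤ C * Real.exp (c * nsq d)

theorem GaussSmooth.exists_nonneg {n : ℕ} {f : Spec n → ℂ} (hf : GaussSmooth f) (k : ℕ) :
    ∃ C c : ℝ, 0 ≤ C ∧ 0 ≤ c ∧ ∀ d, ‖iteratedFDeriv ℝ k f d‖ ≤ C * Real.exp (c * nsq d) := by
  obtain ⟨C, c, h⟩ := hf.2 k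
  refine ⟨|C|, |c|, abs_nonneg _, abs_nonneg _, fun d => (h d).trans ?_⟩
  have := nsq_nonneg d
  gcongr
  exacts [le_abs_self _, le_abs_self _]

theorem GaussSmooth.growth {n : ℕ} {f : Spec n → ℂ} (hf : GaussSmooth f) :
    ∃ c, 0 ≤ c ∧ Growth c f := by
  obtain ⟨C, c, -, hc, h⟩ := hf.exists_nonneg 0
  exact ⟨c, hc, C, fun d => by simpa using h d⟩

theorem GaussSmooth.differentiable {n : ℕ} {f : Spec n → ℂ} (hf : GaussSmooth f) :
    Differentiable ℝ f := hf.1.differentiable (by simp)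

theorem GaussSmooth.continuous {n : ℕ} {f : Spec n → ℂ} (hf : GaussSmooth f) : Continuous f :=
  hf.1.continuous

theorem GaussSmooth.add {n : ℕ} {f g : Spec n → ℂ} (hf : GaussSmooth f) (hg : GaussSmooth g) :
    GaussSmooth fun d => f d + g d := by
  refine ⟨hf.1.add hg.1, fun k => ?_⟩
  obtain ⟨C, c, hC, hc, h⟩ := hf.exists_nonneg k
  obtain ⟨C', c', hC', hc', h'⟩ := hg.exists_nonneg k
  refine ⟨C + C', c + c', fun d => ?_⟩
  have e := iteratedFDeriv_add_apply (i := k) (hf.1.contDiffAt.of_le (by exact_mod_cast le_top))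
    (hg.1.contDiffAt.of_le (by exact_mod_cast le_top)) (x := d)
  have hd := nsq_nonneg d
  calc ‖iteratedFDeriv ℝ k (f + g) d‖ ≤ C * Real.exp (c * nsq d) + C' * Real.exp (c' * nsq d) := by
        rw [e]
        exact (norm_add_le _ _).trans (add_le_add (h d) (h' d))
    _ ≤ C * Real.exp ((c + c') * nsq d) + C' * Real.exp ((c + c') * nsq d) := by
        gcongr <;> linarith
    _ = _ := by ring

theorem GaussSmooth.const_mul {n : ℕ} {f : Spec n → ℂ} (hf : GaussSmooth f) (a : ℂ) :
    GaussSmooth fun d => a * f d := by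
  refine ⟨contDiff_const.mul hf.1, fun k => ?_⟩
  obtain ⟨C, c, h⟩ := hf.2 k
  refine ⟨‖a‖ * C, c, fun d => ?_⟩
  have e := iteratedFDeriv_const_smul_apply (i := k) (a := a)
    (hf.1.contDiffAt.of_le (by exact_mod_cast le_top)) (x := d)
  change ‖iteratedFDeriv ℝ k (a • f) d‖ ≤ _
  rw [e, norm_smul, mul_assoc]
  gcongr
  exact h d

theorem gaussSmooth_const {n : ℕ} (a : ℂ) : GaussSmooth fun _ : Spec n => a := by
  refine ⟨contDiff_const, fun k => ⟨‖a‖, 0, fun d => ?_⟩⟩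
  rcases eq_or_ne k 0 with rfl | hk
  · simp
  · simp [iteratedFDeriv_const_of_ne hk]

theorem GaussSmooth.sum {n : ℕ} {ι : Type*} {s : Finset ι} {f : ι → Spec n → ℂ}
    (hf : ∀ i ∈ s, GaussSmooth (f i)) : GaussSmooth fun d => ∑ i ∈ s, f i d := by
  classical
  induction s using Finset.induction_on with
  | empty => simpa using gaussSmooth_const 0
  | insert i s hi ih =>
    simp only [Finset.sum_insert hi]
    exact (hf i (Finset.mem_insert_self _ _)).add
      (ih fun j hj => hf j (Finset.mem_insert_of_mem hj))

theorem GaussSmooth.mul {n : ℕ} {f g : Spec n → ℂ} (hf : GaussSmooth f) (hg : GaussSmooth g) :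
    GaussSmooth fun d => f d * g d := by
  refine ⟨hf.1.mul hg.1, fun k => ?_⟩
  choose C c hC hc h using hf.exists_nonneg
  choose C' c' hC' hc' h' using hg.exists_nonneg
  have hsum : ∀ {e : ℕ → ℝ}, (∀ i, 0 ≤ e i) → ∀ i ∈ Finset.range (k + 1),
      e i ≤ ∑ j ∈ Finset.range (k + 1), e j := fun he i hi =>
    Finset.single_le_sum (fun j _ => he j) hi
  refine ⟨∑ i ∈ Finset.range (k + 1), k.choose i * (C i * C' (k - i)),
    (∑ i ∈ Finset.range (k + 1), c i) + ∑ i ∈ Finset.range (k + 1), c' i, fun d => ?_⟩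
  refine (norm_iteratedFDeriv_mul_le hf.1 hg.1 d (by exact_mod_cast le_top)).trans ?_
  rw [Finset.sum_mul]
  refine Finset.sum_le_sum fun i hi => ?_
  have hd := nsq_nonneg d
  have hi' : k - i ∈ Finset.range (k + 1) := by
    rw [Finset.mem_range]
    omega
  have h1 : ‖iteratedFDeriv ℝ i f d‖ ≤
      C i * Real.exp ((∑ i ∈ Finset.range (k + 1), c i) * nsq d) := by
    refine (h i d).trans ?_
    have := hC i
    gcongr
    exact hsum hc i hi
  have h2 : ‖iteratedFDeriv ℝ (k - i) g d‖ ≤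
      C' (k - i) * Real.exp ((∑ i ∈ Finset.range (k + 1), c' i) * nsq d) := by
    refine (h' (k - i) d).trans ?_
    have := hC' (k - i)
    gcongr
    exact hsum hc' _ hi'
  calc (k.choose i : ℝ) * ‖iteratedFDeriv ℝ i f d‖ * ‖iteratedFDeriv ℝ (k - i) g d‖
      ≤ k.choose i * (C i * Real.exp ((∑ i ∈ Finset.range (k + 1), c i) * nsq d)) *
        (C' (k - i) * Real.exp ((∑ i ∈ Finset.range (k + 1), c' i) * nsq d)) := by
        have := hC i
        gcongr
    _ = _ := by
        rw [add_mul, Real.exp_add]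
        ring

theorem GaussSmooth.fderiv_apply {n : ℕ} {f : Spec n → ℂ} (hf : GaussSmooth f) (v : Spec n) :
    GaussSmooth fun d => fderiv ℝ f d v := by
  have h1 : ContDiff ℝ ∞ (fderiv ℝ f) := hf.1.fderiv_right (by simp)
  refine ⟨h1.clm_apply contDiff_const, fun k => ?_⟩
  obtain ⟨C, c, h⟩ := hf.2 (k + 1)
  refine ⟨‖v‖ * C, c, fun d => ?_⟩
  refine (norm_iteratedFDeriv_clm_apply_const h1.contDiffAt
    (by exact_mod_cast le_top)).trans ?_
  rw [norm_iteratedFDeriv_fderiv, mul_assoc]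
  gcongr
  exact h d

/-- The value of `u` at `(d_1; 0, …, 0)`, as a function of `d`. -/
def restrictHead {n : ℕ} (u : Spec n → ℂ) (d : Spec n) : ℂ := flat u (d 0)

/-- The linear map `d ↦ (d_1; 0, …, 0)`. -/
def headL (n : ℕ) : Spec n →L[ℝ] Spec n :=
  (ContinuousLinearMap.single ℝ (fun _ : Fin (n + 1) => ℂ) 0).comp
    (ContinuousLinearMap.proj (R := ℝ) (φ := fun _ : Fin (n + 1) => ℂ) 0)

theorem headL_apply {n : ℕ} (d : Spec n) : headL n d = base n (d 0) := by
  funext i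
  refine Fin.cases ?_ (fun i => ?_) i <;> simp [headL, base]

theorem restrictHead_eq {n : ℕ} (u : Spec n → ℂ) : restrictHead u = u ∘ headL n := by
  funext d
  rw [Function.comp, headL_apply]
  rfl

theorem GaussSmooth.restrictHead {n : ℕ} {f : Spec n → ℂ} (hf : GaussSmooth f) :
    GaussSmooth (restrictHead f) := by
  rw [restrictHead_eq]
  refine ⟨hf.1.comp (headL n).contDiff, fun k => ?_⟩
  obtain ⟨C, c, hC, hc, h⟩ := hf.exists_nonneg k
  refine ⟨C * ‖headL n‖ ^ k, c, fun d => ?_⟩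
  rw [(headL n).iteratedFDeriv_comp_right hf.1 d (by exact_mod_cast le_top)]
  refine (ContinuousMultilinearMap.norm_compContinuousLinearMap_le _ _).trans ?_
  rw [Finset.prod_const, Finset.card_univ, Fintype.card_fin, mul_right_comm]
  gcongr
  refine (h _).trans ?_
  gcongr
  rw [headL_apply]
  simpa [nsq, base, Fin.sum_univ_succ] using sq_norm_le_nsq d 0

theorem contDiff_wirtinger {n : ℕ} {f : Spec n → ℂ} (hf : ContDiff ℝ ∞ f) (p : Fin (n + 1) × Bool) :
    ContDiff ℝ ∞ (wirtinger p f) := by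
  have h1 : ContDiff ℝ ∞ (fderiv ℝ f) := hf.fderiv_right (by simp)
  exact ((h1.clm_apply contDiff_const).add
    (contDiff_const.mul (h1.clm_apply contDiff_const))).div_const _

theorem GaussSmooth.wirtinger {n : ℕ} {f : Spec n → ℂ} (hf : GaussSmooth f)
    (p : Fin (n + 1) × Bool) : GaussSmooth (wirtinger p f) := by
  have h := ((hf.fderiv_apply (Pi.single p.1 1)).add ((hf.fderiv_apply
    (Pi.single p.1 Complex.I)).const_mul (if p.2 then Complex.I else -Complex.I))).const_mul 2⁻¹
  refine (funext fun d => ?_ : NormalMatrixQuantization.wirtinger p f = _) ▸ h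
  rw [NormalMatrixQuantization.wirtinger, div_eq_inv_mul]

theorem wirtinger_add {n : ℕ} {f g : Spec n → ℂ} (hf : Differentiable ℝ f)
    (hg : Differentiable ℝ g) (p : Fin (n + 1) × Bool) :
    wirtinger p (fun d => f d + g d) = fun d => wirtinger p f d + wirtinger p g d := by
  funext d
  simp only [wirtinger]
  rw [fderiv_fun_add (hf d) (hg d)]
  simp only [add_apply]
  ring

theorem wirtinger_const_mul {n : ℕ} {f : Spec n → ℂ} (hf : Differentiable ℝ f) (a : ℂ)
    (p : Fin (n + 1) × Bool) :
    wirtinger p (fun d => a * f d) = fun d => a * wirtinger p f d := by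
  funext d
  simp only [wirtinger]
  rw [fderiv_const_mul (hf d)]
  simp only [smul_apply, smul_eq_mul]
  ring

theorem wirtinger_mul {n : ℕ} {f g : Spec n → ℂ} (hf : Differentiable ℝ f)
    (hg : Differentiable ℝ g) (p : Fin (n + 1) × Bool) :
    wirtinger p (fun d => f d * g d) = fun d => wirtinger p f d * g d + f d * wirtinger p g d := by
  funext d
  simp only [wirtinger]
  rw [fderiv_fun_mul (hf d) (hg d)]
  simp only [add_apply, smul_apply, smul_eq_mul]
  ring

theorem wirtinger_const {n : ℕ} (a : ℂ) (p : Fin (n + 1) × Bool) :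
    wirtinger p (fun _ : Spec n => a) = fun _ => 0 := by
  funext d
  simp [wirtinger]

theorem wirtinger_sum {n : ℕ} {ι : Type*} {s : Finset ι} {f : ι → Spec n → ℂ}
    (hf : ∀ i ∈ s, Differentiable ℝ (f i)) (p : Fin (n + 1) × Bool) :
    wirtinger p (fun d => ∑ i ∈ s, f i d) = fun d => ∑ i ∈ s, wirtinger p (f i) d := by
  funext d
  simp only [wirtinger]
  rw [fderiv_fun_sum fun i hi => hf i hi d]
  simp only [sum_apply, Finset.mul_sum, ← Finset.sum_add_distrib,
    Finset.sum_div]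

theorem fderiv_fderiv_apply_comm {n : ℕ} {f : Spec n → ℂ} (hf : ContDiff ℝ ∞ f) (v w d : Spec n) :
    fderiv ℝ (fun e => fderiv ℝ f e v) d w = fderiv ℝ (fun e => fderiv ℝ f e w) d v := by
  have h1 : Differentiable ℝ (fderiv ℝ f) :=
    (hf.fderiv_right (m := ∞) (by simp)).differentiable (by simp)
  have h2 := (hf.contDiffAt (x := d)).isSymmSndFDerivAt (by
    rw [minSmoothness_of_isRCLikeNormedField]
    exact ENat.LEInfty.out)
  rw [fderiv_clm_apply (h1 d) (differentiableAt_const _),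
    fderiv_clm_apply (h1 d) (differentiableAt_const _)]
  simpa using h2 w v

theorem wirtinger_comm {n : ℕ} {f : Spec n → ℂ} (hf : ContDiff ℝ ∞ f) (p q : Fin (n + 1) × Bool) :
    wirtinger p (wirtinger q f) = wirtinger q (wirtinger p f) := by
  have h1 : ContDiff ℝ ∞ (fderiv ℝ f) := hf.fderiv_right (by simp)
  have h2 : ∀ v, Differentiable ℝ fun d => fderiv ℝ f d v := fun v =>
    (h1.clm_apply contDiff_const).differentiable (by simp)
  have h3 : ∀ (r : Fin (n + 1) × Bool) (d v : Spec n), fderiv ℝ (wirtinger r f) d v =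
      (fderiv ℝ (fun e => fderiv ℝ f e (Pi.single r.1 1)) d v +
        (if r.2 then Complex.I else -Complex.I) *
          fderiv ℝ (fun e => fderiv ℝ f e (Pi.single r.1 Complex.I)) d v) / 2 := by
    intro r d v
    have e : wirtinger r f = fun d => 2⁻¹ * (fderiv ℝ f d (Pi.single r.1 1) +
        (if r.2 then Complex.I else -Complex.I) * fderiv ℝ f d (Pi.single r.1 Complex.I)) := by
      funext d
      rw [wirtinger, div_eq_inv_mul]
    have h4 := (h2 (Pi.single r.1 1)).fun_add
      ((h2 (Pi.single r.1 Complex.I)).const_mul (if r.2 then Complex.I else -Complex.I))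
    rw [e, fderiv_const_mul (h4 d),
      fderiv_fun_add (h2 _ d) ((h2 _).const_mul _ d), fderiv_const_mul (h2 _ d)]
    simp only [add_apply, smul_apply, smul_eq_mul]
    ring
  funext d
  rw [wirtinger, wirtinger, h3, h3, h3, h3,
    fderiv_fderiv_apply_comm hf (Pi.single q.1 1) (Pi.single p.1 1),
    fderiv_fderiv_apply_comm hf (Pi.single q.1 1) (Pi.single p.1 Complex.I),
    fderiv_fderiv_apply_comm hf (Pi.single q.1 Complex.I) (Pi.single p.1 1),
    fderiv_fderiv_apply_comm hf (Pi.single q.1 Complex.I) (Pi.single p.1 Complex.I)]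
  ring

theorem wirtinger_restrictHead_succ {n : ℕ} {f : Spec n → ℂ} (hf : Differentiable ℝ f) (i : Fin n)
    (b : Bool) : wirtinger (i.succ, b) (restrictHead f) = fun _ => 0 := by
  funext d
  have h : ∀ c : ℂ, headL n (Pi.single i.succ c) = 0 := by
    intro c
    rw [headL_apply]
    funext j
    refine Fin.cases ?_ (fun j => ?_) j <;> simp [base]
  rw [wirtinger, restrictHead_eq, fderiv_comp _ (hf _) (headL n).differentiableAt]
  simp [h]

theorem wirtinger_restrictHead_zero {n : ℕ} {f : Spec n → ℂ} (hf : Differentiable ℝ f)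
    (b : Bool) : wirtinger (0, b) (restrictHead f) = restrictHead (wirtinger (0, b) f) := by
  funext d
  have h : ∀ c : ℂ, headL n (Pi.single 0 c) = Pi.single 0 c := by
    intro c
    rw [headL_apply]
    funext j
    refine Fin.cases ?_ (fun j => ?_) j <;> simp [base]
  rw [restrictHead_eq (wirtinger _ f), wirtinger, restrictHead_eq,
    fderiv_comp _ (hf _) (headL n).differentiableAt]
  simp [h, wirtinger]

/-- The mixed derivative `∂²/∂d_i ∂d̄_i`. -/
def mixed {n : ℕ} (i : Fin (n + 1)) (f : Spec n → ℂ) : Spec n → ℂ :=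
  wirtinger (i, false) (wirtinger (i, true) f)

theorem GaussSmooth.mixed {n : ℕ} {f : Spec n → ℂ} (hf : GaussSmooth f) (i : Fin (n + 1)) :
    GaussSmooth (mixed i f) := (hf.wirtinger _).wirtinger _

theorem mixed_wirtinger {n : ℕ} {f : Spec n → ℂ} (hf : ContDiff ℝ ∞ f) (i : Fin (n + 1))
    (p : Fin (n + 1) × Bool) : mixed i (wirtinger p f) = wirtinger p (mixed i f) := by
  rw [mixed, mixed, wirtinger_comm hf, wirtinger_comm (contDiff_wirtinger hf _)]

theorem mixed_mixed {n : ℕ} {f : Spec n → ℂ} (hf : ContDiff ℝ ∞ f) (i j : Fin (n + 1)) :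
    mixed i (mixed j f) = mixed j (mixed i f) := by
  rw [mixed.eq_def j f, mixed_wirtinger (contDiff_wirtinger hf _), mixed_wirtinger hf]
  rfl

theorem mixed_add {n : ℕ} {f g : Spec n → ℂ} (hf : GaussSmooth f) (hg : GaussSmooth g)
    (i : Fin (n + 1)) : mixed i (fun d => f d + g d) = fun d => mixed i f d + mixed i g d := by
  rw [mixed, wirtinger_add hf.differentiable hg.differentiable,
    wirtinger_add (hf.wirtinger _).differentiable (hg.wirtinger _).differentiable]
  rfl

theorem mixed_const_mul {n : ℕ} {f : Spec n → ℂ} (hf : GaussSmooth f) (a : ℂ) (i : Fin (n + 1)) :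
    mixed i (fun d => a * f d) = fun d => a * mixed i f d := by
  rw [mixed, wirtinger_const_mul hf.differentiable,
    wirtinger_const_mul (hf.wirtinger _).differentiable]
  rfl

theorem mixed_sum {n : ℕ} {ι : Type*} {s : Finset ι} {f : ι → Spec n → ℂ}
    (hf : ∀ j ∈ s, GaussSmooth (f j)) (i : Fin (n + 1)) :
    mixed i (fun d => ∑ j ∈ s, f j d) = fun d => ∑ j ∈ s, mixed i (f j) d := by
  rw [mixed, wirtinger_sum fun j hj => (hf j hj).differentiable,
    wirtinger_sum fun j hj => ((hf j hj).wirtinger _).differentiable]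
  rfl

theorem mixed_mul {n : ℕ} {f g : Spec n → ℂ} (hf : GaussSmooth f) (hg : GaussSmooth g)
    (i : Fin (n + 1)) : mixed i (fun d => f d * g d) = fun d =>
      mixed i f d * g d + f d * mixed i g d + wirtinger (i, false) f d * wirtinger (i, true) g d +
        wirtinger (i, true) f d * wirtinger (i, false) g d := by
  have hf' := hf.wirtinger (i, true)
  have hg' := hg.wirtinger (i, true)
  rw [mixed, wirtinger_mul hf.differentiable hg.differentiable,
    wirtinger_add (hf'.mul hg).differentiable (hf.mul hg').differentiable,
    wirtinger_mul hf'.differentiable hg.differentiable,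
    wirtinger_mul hf.differentiable hg'.differentiable]
  funext d
  simp only [mixed]
  ring

theorem mixed_const {n : ℕ} (a : ℂ) (i : Fin (n + 1)) :
    mixed i (fun _ : Spec n => a) = fun _ => 0 := by
  rw [mixed, wirtinger_const, wirtinger_const]

/-- The differential in terms of Wirtinger derivatives. -/
theorem fderiv_eq_sum_wirtinger {n : ℕ} (f : Spec n → ℂ) (d v : Spec n) :
    fderiv ℝ f d v = ∑ i, (v i * wirtinger (i, false) f d +
      (starRingEnd ℂ) (v i) * wirtinger (i, true) f d) := by
  have hv : v = ∑ i, ((v i).re • (Pi.single i 1 : Spec n) +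
      (v i).im • (Pi.single i Complex.I : Spec n)) := by
    funext j
    simp only [Finset.sum_apply, Pi.add_apply, Pi.smul_apply, Pi.single_apply]
    simp [Finset.sum_add_distrib]
  conv_lhs => rw [hv, map_sum]
  refine Finset.sum_congr rfl fun i _ => ?_
  have hc : (starRingEnd ℂ) (v i) = (v i).re - (v i).im * Complex.I := by
    apply Complex.ext <;> simp
  have hv' := (Complex.re_add_im (v i)).symm
  rw [map_add, map_smul, map_smul, wirtinger, wirtinger, hc]
  generalize (v i).re = a at *
  generalize (v i).im = b at *
  rw [hv']
  simp only [Complex.real_smul, if_true, Bool.false_eq_true, if_false]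
  linear_combination ((b : ℂ) * fderiv ℝ f d (Pi.single i Complex.I)) * Complex.I_sq

/-! ### Derivatives of the rescaled Gaussian integrals -/

theorem nsq_add_le {n : ℕ} (a b : Spec n) : nsq (a + b) ≤ 2 * nsq a + 2 * nsq b := by
  simp only [nsq, Finset.mul_sum, ← Finset.sum_add_distrib]
  refine Finset.sum_le_sum fun i _ => ?_
  have h1 := norm_add_le (a i) (b i)
  have h2 := norm_nonneg (a i + b i)
  rw [Pi.add_apply]
  nlinarith [sq_nonneg (‖a i‖ - ‖b i‖)]

/-- The dominating function for the integrals against `rho`. -/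
def rhoBound {n : ℕ} (z : Spec n × Spec n) : ℝ :=
  ((Real.pi ^ (n + 1)) ^ 2)⁻¹ * Real.exp (-(3 / 8) * (nsq z.1 + nsq z.2))

theorem integrable_rhoBound {n : ℕ} : Integrable (rhoBound (n := n)) := by
  have h : Integrable fun d : Spec n => Real.exp (-(3 / 8) * nsq d) :=
    integrable_exp_nsq (by norm_num)
  refine ((h.mul_prod h).const_mul ((Real.pi ^ (n + 1)) ^ 2)⁻¹).congr (ae_of_all _ fun z => ?_)
  simp only [rhoBound, mul_add, Real.exp_add]

theorem rhoBound_nonneg {n : ℕ} (z : Spec n × Spec n) : 0 ≤ rhoBound z := by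
  have := Real.pi_pos
  rw [rhoBound]
  positivity

@[fun_prop] theorem continuous_rho {n : ℕ} : Continuous (rho (n := n)) := by
  unfold rho
  fun_prop

/-- The cross term is at most `(|p_1|² + |q_1|²)/2`, which leaves the rate `1/2 = 3/8 + 1/8`. The
`1/8` is reserved for the symbols and a linear weight, the `3/8` for integrability. -/
theorem norm_rho_le {n : ℕ} (z : Spec n × Spec n) :
    ‖rho z‖ ≤ rhoBound z * Real.exp (-(1 / 8) * (nsq z.1 + nsq z.2)) := by
  have hpi := Real.pi_pos
  rw [rho, rhoBound, norm_mul, Complex.norm_real, Complex.norm_exp, Real.norm_eq_abs,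
    abs_of_nonneg (by positivity), mul_assoc, ← Real.exp_add]
  gcongr
  have h1 : (z.1 0 * (starRingEnd ℂ) (z.2 0)).re ≤ ‖z.1 0‖ * ‖z.2 0‖ := by
    simpa using Complex.re_le_norm (z.1 0 * (starRingEnd ℂ) (z.2 0))
  have h2 := sq_norm_le_nsq z.1 0
  have h3 := sq_norm_le_nsq z.2 0
  simp only [Complex.sub_re, Complex.ofReal_re]
  nlinarith [sq_nonneg (‖z.1 0‖ - ‖z.2 0‖)]

/-- The function `u` is dominated by a small Gaussian after rescaling by `t` around `x̂`. -/
def ScaledBound {n : ℕ} (x : ℂ) (u : Spec n → ℂ) (C t : ℝ) : Prop :=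
  ∀ p, ‖u (base n x + t • p)‖ ≤ C * Real.exp (1 / 16 * nsq p)

/-- Rescaling turns the growth rate `c` into at most `2ct²`, which is below `1/16` for small `t`
however large `c` is. -/
theorem GaussSmooth.exists_scaledBound {n : ℕ} {u : Spec n → ℂ} (hu : GaussSmooth u) (x : ℂ) :
    ∃ C, 0 ≤ C ∧ ∀ᶠ t in 𝓝 (0 : ℝ), ScaledBound x u C t := by
  obtain ⟨c, hc, hG⟩ := hu.growth
  obtain ⟨C, hC0, hC⟩ := hG.exists_nonneg
  refine ⟨C * Real.exp (c * (2 * nsq (base n x))), by positivity, ?_⟩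
  have h1 : ∀ᶠ t in 𝓝 (0 : ℝ), 2 * c * t ^ 2 < 1 / 16 := by
    have : ContinuousAt (fun t : ℝ => 2 * c * t ^ 2) 0 := by fun_prop
    exact this.eventually_lt continuousAt_const (by norm_num)
  filter_upwards [h1] with t ht p
  refine (hC _).trans ?_
  rw [mul_assoc, ← Real.exp_add]
  gcongr
  have h2 := nsq_add_le (base n x) (t • p)
  rw [nsq_smul] at h2
  nlinarith [nsq_nonneg p]

/-- With `s = |p|² + |q|²`, the two symbols contribute `exp(s/16)` in total and the weight satisfies
`|a| ≤ (|a|² + 1)/2 ≤ 8 exp(s/16)`; together they use up the reserve `exp(-s/8)` exactly. The bound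
does not depend on `t`. -/
theorem norm_mul_rho_le {n : ℕ} {x : ℂ} {u w : Spec n → ℂ} {C D t : ℝ} (hC : 0 ≤ C)
    (hu : ScaledBound x u C t) (hw : ScaledBound x w D t) (z : Spec n × Spec n) {a : ℂ}
    (ha : ‖a‖ ^ 2 ≤ nsq z.1 + nsq z.2 + 1) :
    ‖a * (u (base n x + t • z.1) * w (base n x + t • z.2) * rho z)‖ ≤
      8 * C * D * rhoBound z := by
  have hs := add_nonneg (nsq_nonneg z.1) (nsq_nonneg z.2)
  have h1 : ‖a‖ ≤ 8 * Real.exp (1 / 16 * (nsq z.1 + nsq z.2)) := by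
    have := Real.add_one_le_exp (1 / 16 * (nsq z.1 + nsq z.2))
    nlinarith [sq_nonneg (‖a‖ - 1)]
  have h2 := hu z.1
  have h3 := hw z.2
  rw [norm_mul, norm_mul, norm_mul]
  have e : Real.exp (1 / 16 * (nsq z.1 + nsq z.2)) * (Real.exp (1 / 16 * nsq z.1) *
      Real.exp (1 / 16 * nsq z.2) * Real.exp (-(1 / 8) * (nsq z.1 + nsq z.2))) = 1 := by
    rw [← Real.exp_add, ← Real.exp_add, ← Real.exp_add, Real.exp_eq_one_iff]
    ring
  calc ‖a‖ * (‖u (base n x + t • z.1)‖ * ‖w (base n x + t • z.2)‖ * ‖rho z‖)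
      ≤ (8 * Real.exp (1 / 16 * (nsq z.1 + nsq z.2))) * ((C * Real.exp (1 / 16 * nsq z.1)) *
        (D * Real.exp (1 / 16 * nsq z.2)) *
        (rhoBound z * Real.exp (-(1 / 8) * (nsq z.1 + nsq z.2)))) := by
        have := rhoBound_nonneg z
        have hD := (norm_nonneg _).trans h3
        gcongr
        exact norm_rho_le z
    _ = 8 * C * D * rhoBound z * (Real.exp (1 / 16 * (nsq z.1 + nsq z.2)) *
        (Real.exp (1 / 16 * nsq z.1) * Real.exp (1 / 16 * nsq z.2) *
          Real.exp (-(1 / 8) * (nsq z.1 + nsq z.2)))) := by ring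
    _ = _ := by rw [e, mul_one]

theorem integrable_mul_rho {n : ℕ} {x : ℂ} {u w : Spec n → ℂ} {C D t : ℝ} (hC : 0 ≤ C)
    (huc : Continuous u) (hwc : Continuous w)
    (hu : ScaledBound x u C t) (hw : ScaledBound x w D t) {a : Spec n × Spec n → ℂ}
    (hac : Continuous a) (ha : ∀ z, ‖a z‖ ^ 2 ≤ nsq z.1 + nsq z.2 + 1) :
    Integrable fun z => a z * (u (base n x + t • z.1) * w (base n x + t • z.2) * rho z) :=
  (integrable_rhoBound.const_mul (8 * C * D)).mono'
    (Continuous.aestronglyMeasurable (by fun_prop))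
    (ae_of_all _ fun z => norm_mul_rho_le hC hu hw z (ha z))

theorem sq_norm_fst_le {n : ℕ} (z : Spec n × Spec n) (i : Fin (n + 1)) :
    ‖z.1 i‖ ^ 2 ≤ nsq z.1 + nsq z.2 + 1 := by
  linarith [sq_norm_le_nsq z.1 i, nsq_nonneg z.2]

theorem sq_norm_snd_le {n : ℕ} (z : Spec n × Spec n) (i : Fin (n + 1)) :
    ‖z.2 i‖ ^ 2 ≤ nsq z.1 + nsq z.2 + 1 := by
  linarith [sq_norm_le_nsq z.2 i, nsq_nonneg z.1]

theorem sq_norm_conj_fst_le {n : ℕ} (z : Spec n × Spec n) (i : Fin (n + 1)) :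
    ‖(starRingEnd ℂ) (z.1 i)‖ ^ 2 ≤ nsq z.1 + nsq z.2 + 1 := by
  rw [RCLike.norm_conj]
  exact sq_norm_fst_le z i

theorem sq_norm_conj_snd_le {n : ℕ} (z : Spec n × Spec n) (i : Fin (n + 1)) :
    ‖(starRingEnd ℂ) (z.2 i)‖ ^ 2 ≤ nsq z.1 + nsq z.2 + 1 := by
  rw [RCLike.norm_conj]
  exact sq_norm_snd_le z i

theorem sq_norm_one_le {n : ℕ} (z : Spec n × Spec n) :
    ‖(1 : ℂ)‖ ^ 2 ≤ nsq z.1 + nsq z.2 + 1 := by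
  rw [norm_one]
  linarith [nsq_nonneg z.1, nsq_nonneg z.2]

/-- `Psi` with an additional weight `a`. -/
def wPsi {n : ℕ} (x : ℂ) (a : Spec n × Spec n → ℂ) (f g : Spec n → ℂ) (t : ℝ) : ℂ :=
  ∫ z : Spec n × Spec n, a z * (f (base n x + t • z.1) * g (base n x + t • z.2) * rho z)

theorem isAddHaarMeasure_volume_prod {n : ℕ} :
    (volume : Measure (Spec n × Spec n)).IsAddHaarMeasure := Measure.prod.instIsAddHaarMeasure _ _

/-- Integration by parts against the constant `1`; only the products with it have to be integrable.
-/
theorem integral_hasLineDerivAt_eq_zero {n : ℕ} {H H' : Spec n × Spec n → ℂ}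
    {v : Spec n × Spec n} (h : ∀ z, HasLineDerivAt ℝ H (H' z) z v) (hH : Integrable H)
    (hH' : Integrable H') : ∫ z, H' z = 0 := by
  have := isAddHaarMeasure_volume_prod (n := n)
  have h1 := integral_bilinear_hasLineDerivAt_right_eq_neg_left_of_integrable
    (μ := (volume : Measure (Spec n × Spec n))) (f := fun _ => (1 : ℂ)) (f' := fun _ => 0)
    (g := H) (g' := H') (v := v) (B := ContinuousLinearMap.mul ℝ ℂ) (by simp) (by simpa using hH')
    (by simpa using hH) (fun z _ => by simpa [HasLineDerivAt] using hasDerivAt_const (0 : ℝ) (1 : ℂ))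
    (fun z _ => h z)
  simpa using h1

theorem hasDerivAt_add_smul {n : ℕ} (p v : Spec n) (i : Fin (n + 1)) (s : ℝ) :
    HasDerivAt (fun s : ℝ => (p + s • v) i) (v i) s := by
  have h := ((hasDerivAt_id s).smul_const (v i)).const_add (p i)
  simpa using h

theorem hasDerivAt_conj_add_smul {n : ℕ} (p v : Spec n) (i : Fin (n + 1)) (s : ℝ) :
    HasDerivAt (fun s : ℝ => (starRingEnd ℂ) ((p + s • v) i)) ((starRingEnd ℂ) (v i)) s :=
  HasFDerivAt.comp_hasDerivAt s
    (Complex.conjCLE.toContinuousLinearMap.hasFDerivAt) (hasDerivAt_add_smul p v i s)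

theorem hasDerivAt_nsq {n : ℕ} (p v : Spec n) :
    HasDerivAt (fun s : ℝ => ((nsq (p + s • v) : ℝ) : ℂ))
      (∑ i, (v i * (starRingEnd ℂ) (p i) + p i * (starRingEnd ℂ) (v i))) 0 := by
  have e : (fun s : ℝ => ((nsq (p + s • v) : ℝ) : ℂ)) =
      fun s : ℝ => ∑ i, (p + s • v) i * (starRingEnd ℂ) ((p + s • v) i) := by
    funext s
    simp only [nsq, Complex.ofReal_sum, Complex.ofReal_pow, Complex.mul_conj']
  rw [e]
  refine HasDerivAt.fun_sum fun i _ => ?_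
  have h := (hasDerivAt_add_smul p v i 0).mul (hasDerivAt_conj_add_smul p v i 0)
  rw [zero_smul, add_zero] at h
  exact h

theorem hasLineDerivAt_rho {n : ℕ} (z v : Spec n × Spec n) :
    HasLineDerivAt ℝ rho (rho z * (v.1 0 * (starRingEnd ℂ) (z.2 0) +
      z.1 0 * (starRingEnd ℂ) (v.2 0) -
      (∑ i, (v.1 i * (starRingEnd ℂ) (z.1 i) + z.1 i * (starRingEnd ℂ) (v.1 i))) -
      (∑ i, (v.2 i * (starRingEnd ℂ) (z.2 i) + z.2 i * (starRingEnd ℂ) (v.2 i))))) z v := by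
  have h := ((((((hasDerivAt_add_smul z.1 v.1 0 0).mul
    (hasDerivAt_conj_add_smul z.2 v.2 0 0)).sub (hasDerivAt_nsq z.1 v.1)).sub
    (hasDerivAt_nsq z.2 v.2)).cexp).const_mul ((((Real.pi ^ (n + 1)) ^ 2)⁻¹ : ℝ) : ℂ))
  refine h.congr_deriv ?_
  simp only [zero_smul, add_zero, Pi.sub_apply, Pi.mul_apply]
  rw [rho, mul_assoc]

theorem hasDerivAt_comp_base {n : ℕ} {u : Spec n → ℂ} (hu : Differentiable ℝ u) (b p v : Spec n)
    (t : ℝ) : HasDerivAt (fun s : ℝ => u (b + t • (p + s • v)))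
      (t * fderiv ℝ u (b + t • p) v) 0 := by
  have h1 : HasDerivAt (fun s : ℝ => b + t • (p + s • v)) (t • v) 0 := by
    simpa using ((((hasDerivAt_id (0 : ℝ)).smul_const v).const_add p).const_smul t).const_add b
  have h2 : HasFDerivAt u (fderiv ℝ u (b + t • p)) (b + t • (p + (0 : ℝ) • v)) := by
    simpa using (hu (b + t • p)).hasFDerivAt
  have h := h2.comp_hasDerivAt (0 : ℝ) h1
  rw [map_smul, Complex.real_smul] at h
  exact h

theorem fderiv_single {n : ℕ} (u : Spec n → ℂ) (d : Spec n) (i : Fin (n + 1)) (c : ℂ) :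
    fderiv ℝ u d (Pi.single i c) =
      c * wirtinger (i, false) u d + (starRingEnd ℂ) c * wirtinger (i, true) u d := by
  rw [fderiv_eq_sum_wirtinger, Finset.sum_eq_single i]
  · simp
  · intro j _ hj
    simp [hj]
  · simp

/-- It splits one identity for derivatives along all real directions `c` into its `∂` and `∂̄`
parts. -/
theorem eq_zero_of_forall_conj {X Y : ℂ} (h : ∀ c : ℂ, c * X + (starRingEnd ℂ) c * Y = 0) :
    X = 0 ∧ Y = 0 := by
  have h1 := h 1
  have h2 := h Complex.I
  simp only [map_one, one_mul, Complex.conj_I] at h1 h2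
  have h3 : X - Y = 0 := by
    have : Complex.I * (X - Y) = 0 := by linear_combination h2
    exact (mul_eq_zero.1 this).resolve_left Complex.I_ne_zero
  exact ⟨by linear_combination (h1 + h3) / 2, by linear_combination (h1 - h3) / 2⟩

theorem integral_combination {α : Type*} [MeasurableSpace α] {μ : Measure α}
    {f₁ f₂ f₃ f₄ f₅ : α → ℂ} (h₁ : Integrable f₁ μ) (h₂ : Integrable f₂ μ) (h₃ : Integrable f₃ μ)
    (h₄ : Integrable f₄ μ) (h₅ : Integrable f₅ μ) {a b c d : ℂ} :
    ∫ z, (a * (b * f₁ z + c * f₂ z - f₃ z) + d * (b * f₄ z - f₅ z)) ∂μ =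
      a * (b * ∫ z, f₁ z ∂μ + c * ∫ z, f₂ z ∂μ - ∫ z, f₃ z ∂μ) +
        d * (b * ∫ z, f₄ z ∂μ - ∫ z, f₅ z ∂μ) := by
  have i₁ : Integrable (fun z => b * f₁ z + c * f₂ z) μ := (h₁.const_mul b).add (h₂.const_mul c)
  have i₂ : Integrable (fun z => b * f₁ z + c * f₂ z - f₃ z) μ := i₁.sub h₃
  have i₃ : Integrable (fun z => b * f₄ z - f₅ z) μ := (h₄.const_mul b).sub h₅
  rw [integral_add (i₂.const_mul a) (i₃.const_mul d), integral_const_mul, integral_const_mul,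
    integral_sub i₁ h₃, integral_sub (h₄.const_mul b) h₅,
    integral_add (h₁.const_mul b) (h₂.const_mul c), integral_const_mul, integral_const_mul,
    integral_const_mul]

/-- Integration by parts in the first variable. -/
theorem integral_by_parts_fst {n : ℕ} {x : ℂ} {u w : Spec n → ℂ} (hu : GaussSmooth u)
    (hw : GaussSmooth w) (i : Fin (n + 1)) {t C D : ℝ} {E : Bool → ℝ} (hC : 0 ≤ C)
    (hE : ∀ b, 0 ≤ E b) (bu : ScaledBound x u C t) (bw : ScaledBound x w D t)
    (bd : ∀ b, ScaledBound x (wirtinger (i, b) u) (E b) t) :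
    wPsi x (fun z => z.1 i) u w t = t * Psi x (wirtinger (i, true) u) w t ∧
    wPsi x (fun z => (starRingEnd ℂ) (z.1 i)) u w t = t * Psi x (wirtinger (i, false) u) w t +
      if i = 0 then wPsi x (fun z => (starRingEnd ℂ) (z.2 0)) u w t else 0 := by
  have i0 := integrable_mul_rho hC hu.continuous hw.continuous bu bw (a := fun _ => 1)
    (by fun_prop) sq_norm_one_le
  have i1 := integrable_mul_rho hC hu.continuous hw.continuous bu bw (a := fun z => z.1 i)
    (by fun_prop) fun z => sq_norm_fst_le z i
  have i2 := integrable_mul_rho hC hu.continuous hw.continuous bu bw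
    (a := fun z => (starRingEnd ℂ) (z.1 i)) (by fun_prop) fun z => sq_norm_conj_fst_le z i
  have i3 := integrable_mul_rho hC hu.continuous hw.continuous bu bw
    (a := fun z => (starRingEnd ℂ) (z.2 0)) (by fun_prop) fun z => sq_norm_conj_snd_le z 0
  have i4 := fun b => integrable_mul_rho (hE b) (hu.wirtinger (i, b)).continuous hw.continuous
    (bd b) bw (a := fun _ => 1) (by fun_prop) sq_norm_one_le
  simp only [one_mul] at i0 i4
  -- Differentiation along `(c e_i, 0)`: the `∂` of `ρ` in `p_i` produces `-conj(p_i)`, plus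
  -- `conj(q_1)` from the cross term if `i` is the distinguished index, while the `∂̄` produces
  -- `-p_i` only.
  have key : ∀ c : ℂ, c * (t * Psi x (wirtinger (i, false) u) w t +
      (if i = 0 then wPsi x (fun z => (starRingEnd ℂ) (z.2 0)) u w t else 0) -
        wPsi x (fun z => (starRingEnd ℂ) (z.1 i)) u w t) +
      (starRingEnd ℂ) c * (t * Psi x (wirtinger (i, true) u) w t -
        wPsi x (fun z => z.1 i) u w t) = 0 := by
    intro c
    have hL : ∀ z : Spec n × Spec n, HasLineDerivAt ℝ
        (fun z : Spec n × Spec n => u (base n x + t • z.1) * w (base n x + t • z.2) * rho z)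
        (c * (t * (wirtinger (i, false) u (base n x + t • z.1) * w (base n x + t • z.2) * rho z) +
          (if i = 0 then 1 else 0) * ((starRingEnd ℂ) (z.2 0) *
            (u (base n x + t • z.1) * w (base n x + t • z.2) * rho z)) -
          (starRingEnd ℂ) (z.1 i) * (u (base n x + t • z.1) * w (base n x + t • z.2) * rho z)) +
        (starRingEnd ℂ) c *
          (t * (wirtinger (i, true) u (base n x + t • z.1) * w (base n x + t • z.2) * rho z) -
            z.1 i * (u (base n x + t • z.1) * w (base n x + t • z.2) * rho z)))
        z (Pi.single i c, 0) := by
      intro z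
      have h := ((hasDerivAt_comp_base hu.differentiable (base n x) z.1 (Pi.single i c) t).mul
        (hasDerivAt_comp_base hw.differentiable (base n x) z.2 0 t)).mul
        (hasLineDerivAt_rho z (Pi.single i c, 0))
      refine HasDerivAt.congr_deriv h ?_
      have e1 : ∑ j, ((Pi.single i c : Spec n) j * (starRingEnd ℂ) (z.1 j) +
          z.1 j * (starRingEnd ℂ) ((Pi.single i c : Spec n) j)) =
          c * (starRingEnd ℂ) (z.1 i) + z.1 i * (starRingEnd ℂ) c := by
        rw [Finset.sum_eq_single i]
        · simp
        · intro j _ hj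
          simp [hj]
        · simp
      have e2 : (Pi.single i c : Spec n) 0 = if i = 0 then c else 0 := by
        rw [Pi.single_apply]
        simp only [eq_comm]
      simp only [e1, e2, fderiv_single, zero_smul, add_zero, Pi.zero_apply, map_zero, mul_zero,
        zero_mul, Finset.sum_const_zero, sub_zero, Pi.mul_apply]
      split_ifs <;> ring
    have h := integral_hasLineDerivAt_eq_zero hL i0
      ((((((i4 false).const_mul _).add (i3.const_mul _)).sub i2).const_mul _).add
        ((((i4 true).const_mul _).sub i1).const_mul _))
    rw [integral_combination (i4 false) i3 i2 (i4 true) i1] at h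
    refine Eq.trans ?_ h
    simp only [wPsi, Psi, ite_mul, one_mul, zero_mul]
  obtain ⟨h1, h2⟩ := eq_zero_of_forall_conj key
  exact ⟨(sub_eq_zero.1 h2).symm, (sub_eq_zero.1 h1).symm⟩

/-- Integration by parts in the second variable. -/
theorem integral_by_parts_snd {n : ℕ} {x : ℂ} {u w : Spec n → ℂ} (hu : GaussSmooth u)
    (hw : GaussSmooth w) (i : Fin (n + 1)) {t C D : ℝ} {E : Bool → ℝ} (hC : 0 ≤ C)
    (bu : ScaledBound x u C t) (bw : ScaledBound x w D t)
    (bd : ∀ b, ScaledBound x (wirtinger (i, b) w) (E b) t) :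
    wPsi x (fun z => (starRingEnd ℂ) (z.2 i)) u w t = t * Psi x u (wirtinger (i, false) w) t ∧
    wPsi x (fun z => z.2 i) u w t = t * Psi x u (wirtinger (i, true) w) t +
      if i = 0 then wPsi x (fun z => z.1 0) u w t else 0 := by
  have i0 := integrable_mul_rho hC hu.continuous hw.continuous bu bw (a := fun _ => 1)
    (by fun_prop) sq_norm_one_le
  have i1 := integrable_mul_rho hC hu.continuous hw.continuous bu bw (a := fun z => z.2 i)
    (by fun_prop) fun z => sq_norm_snd_le z i
  have i2 := integrable_mul_rho hC hu.continuous hw.continuous bu bw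
    (a := fun z => (starRingEnd ℂ) (z.2 i)) (by fun_prop) fun z => sq_norm_conj_snd_le z i
  have i3 := integrable_mul_rho hC hu.continuous hw.continuous bu bw
    (a := fun z => z.1 0) (by fun_prop) fun z => sq_norm_fst_le z 0
  have i4 := fun b => integrable_mul_rho hC hu.continuous (hw.wirtinger (i, b)).continuous
    bu (bd b) (a := fun _ => 1) (by fun_prop) sq_norm_one_le
  simp only [one_mul] at i0 i4
  -- In the second variable the roles are exchanged: the cross term `p_1 conj(q_1)` is
  -- antiholomorphic in `q`, so the extra term now belongs to `∂̄`.
  have key : ∀ c : ℂ, c * (t * Psi x u (wirtinger (i, false) w) t -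
        wPsi x (fun z => (starRingEnd ℂ) (z.2 i)) u w t) +
      (starRingEnd ℂ) c * (t * Psi x u (wirtinger (i, true) w) t +
      (if i = 0 then wPsi x (fun z => z.1 0) u w t else 0) -
        wPsi x (fun z => z.2 i) u w t) = 0 := by
    intro c
    have hL : ∀ z : Spec n × Spec n, HasLineDerivAt ℝ
        (fun z : Spec n × Spec n => u (base n x + t • z.1) * w (base n x + t • z.2) * rho z)
        ((starRingEnd ℂ) c *
          (t * (u (base n x + t • z.1) * wirtinger (i, true) w (base n x + t • z.2) * rho z) +
          (if i = 0 then 1 else 0) * (z.1 0 *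
            (u (base n x + t • z.1) * w (base n x + t • z.2) * rho z)) -
            z.2 i * (u (base n x + t • z.1) * w (base n x + t • z.2) * rho z)) +
        c * (t * (u (base n x + t • z.1) * wirtinger (i, false) w (base n x + t • z.2) * rho z) -
          (starRingEnd ℂ) (z.2 i) * (u (base n x + t • z.1) * w (base n x + t • z.2) * rho z)))
        z (0, Pi.single i c) := by
      intro z
      have h := ((hasDerivAt_comp_base hu.differentiable (base n x) z.1 0 t).mul
        (hasDerivAt_comp_base hw.differentiable (base n x) z.2 (Pi.single i c) t)).mul
        (hasLineDerivAt_rho z (0, Pi.single i c))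
      refine HasDerivAt.congr_deriv h ?_
      have e1 : ∑ j, ((Pi.single i c : Spec n) j * (starRingEnd ℂ) (z.2 j) +
          z.2 j * (starRingEnd ℂ) ((Pi.single i c : Spec n) j)) =
          c * (starRingEnd ℂ) (z.2 i) + z.2 i * (starRingEnd ℂ) c := by
        rw [Finset.sum_eq_single i]
        · simp
        · intro j _ hj
          simp [hj]
        · simp
      have e2 : (Pi.single i c : Spec n) 0 = if i = 0 then c else 0 := by
        rw [Pi.single_apply]
        simp only [eq_comm]
      simp only [e1, e2, fderiv_single, zero_smul, add_zero, Pi.zero_apply, map_zero, mul_zero,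
        zero_mul, zero_add, Finset.sum_const_zero, sub_zero, Pi.mul_apply]
      split_ifs
      · ring
      · simp only [map_zero]
        ring
    have h := integral_hasLineDerivAt_eq_zero hL i0
      ((((((i4 true).const_mul _).add (i3.const_mul _)).sub i1).const_mul _).add
        ((((i4 false).const_mul _).sub i2).const_mul _))
    rw [integral_combination (i4 true) i3 i1 (i4 false) i2] at h
    rw [add_comm]
    refine Eq.trans ?_ h
    simp only [wPsi, Psi, ite_mul, one_mul, zero_mul]
  obtain ⟨h1, h2⟩ := eq_zero_of_forall_conj key
  exact ⟨(sub_eq_zero.1 h1).symm, (sub_eq_zero.1 h2).symm⟩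

theorem hasDerivAt_comp_smul {n : ℕ} {u : Spec n → ℂ} (hu : Differentiable ℝ u) (b p : Spec n)
    (t : ℝ) : HasDerivAt (fun t : ℝ => u (b + t • p))
      (∑ i, (p i * wirtinger (i, false) u (b + t • p) +
        (starRingEnd ℂ) (p i) * wirtinger (i, true) u (b + t • p))) t := by
  have h1 : HasDerivAt (fun t : ℝ => b + t • p) p t := by
    simpa using ((hasDerivAt_id t).smul_const p).const_add b
  have h := (hu (b + t • p)).hasFDerivAt.comp_hasDerivAt t h1
  rw [fderiv_eq_sum_wirtinger] at h
  exact h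

/-- The derivative of `Psi`, before integration by parts. -/
theorem hasDerivAt_Psi_aux {n : ℕ} {f g : Spec n → ℂ} (hf : GaussSmooth f)
    (hg : GaussSmooth g) (x : ℂ) : ∀ᶠ t in 𝓝 (0 : ℝ), HasDerivAt (Psi x f g)
      (∑ i, (wPsi x (fun z => z.1 i) (wirtinger (i, false) f) g t +
        wPsi x (fun z => (starRingEnd ℂ) (z.1 i)) (wirtinger (i, true) f) g t +
        wPsi x (fun z => z.2 i) f (wirtinger (i, false) g) t +
        wPsi x (fun z => (starRingEnd ℂ) (z.2 i)) f (wirtinger (i, true) g) t)) t := by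
  obtain ⟨A, hA, bf⟩ := hf.exists_scaledBound x
  obtain ⟨B, hB, bg⟩ := hg.exists_scaledBound x
  choose A' hA' bf' using fun p => (hf.wirtinger p).exists_scaledBound x
  choose B' hB' bg' using fun p => (hg.wirtinger p).exists_scaledBound x
  have hall := (bf.and bg).and ((eventually_all.2 bf').and (eventually_all.2 bg'))
  -- Differentiation under the integral at `t` needs the bounds on a whole neighbourhood of `t`.
  filter_upwards [hall.eventually_nhds] with t ht
  have ht0 := ht.self_of_nhds
  let F' : ℝ → Spec n × Spec n → ℂ := fun t z => ∑ i,
    (z.1 i * (wirtinger (i, false) f (base n x + t • z.1) * g (base n x + t • z.2) * rho z) +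
    (starRingEnd ℂ) (z.1 i) *
      (wirtinger (i, true) f (base n x + t • z.1) * g (base n x + t • z.2) * rho z) +
    z.2 i * (f (base n x + t • z.1) * wirtinger (i, false) g (base n x + t • z.2) * rho z) +
    (starRingEnd ℂ) (z.2 i) *
      (f (base n x + t • z.1) * wirtinger (i, true) g (base n x + t • z.2) * rho z))
  have hfc := hf.continuous
  have hgc := hg.continuous
  have hfc' := fun p => (hf.wirtinger p).continuous
  have hgc' := fun p => (hg.wirtinger p).continuous
  have i0 := integrable_mul_rho hA hfc hgc ht0.1.1 ht0.1.2 (a := fun _ => 1) (by fun_prop)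
    sq_norm_one_le
  simp only [one_mul] at i0
  refine (hasDerivAt_integral_of_dominated_loc_of_deriv_le (μ := volume) (x₀ := t)
    (F := fun t (z : Spec n × Spec n) =>
      f (base n x + t • z.1) * g (base n x + t • z.2) * rho z) (F' := F')
    (bound := fun z => ∑ i, (8 * A' (i, false) * B * rhoBound z + 8 * A' (i, true) * B * rhoBound z +
      8 * A * B' (i, false) * rhoBound z + 8 * A * B' (i, true) * rhoBound z)) ht
    (Eventually.of_forall fun t => Continuous.aestronglyMeasurable (by fun_prop))
    i0 (Continuous.aestronglyMeasurable (by fun_prop))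
    (ae_of_all _ fun z t ht => ?_)
    (integrable_finsetSum _ fun i _ => (((integrable_rhoBound.const_mul _).add
      (integrable_rhoBound.const_mul _)).add (integrable_rhoBound.const_mul _)).add
      (integrable_rhoBound.const_mul _))
    (ae_of_all _ fun z t _ => ?_)).2.congr_deriv ?_
  rotate_left 2
  · dsimp only [F']
    have j1 := fun i => integrable_mul_rho (hA' (i, false)) (hfc' _) hgc (ht0.2.1 (i, false)) ht0.1.2
      (a := fun z => z.1 i) (by fun_prop) fun z => sq_norm_fst_le z i
    have j2 := fun i => integrable_mul_rho (hA' (i, true)) (hfc' _) hgc (ht0.2.1 (i, true)) ht0.1.2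
      (a := fun z => (starRingEnd ℂ) (z.1 i)) (by fun_prop) fun z => sq_norm_conj_fst_le z i
    have j3 := fun i => integrable_mul_rho hA hfc (hgc' _) ht0.1.1 (ht0.2.2 (i, false))
      (a := fun z => z.2 i) (by fun_prop) fun z => sq_norm_snd_le z i
    have j4 := fun i => integrable_mul_rho hA hfc (hgc' _) ht0.1.1 (ht0.2.2 (i, true))
      (a := fun z => (starRingEnd ℂ) (z.2 i)) (by fun_prop) fun z => sq_norm_conj_snd_le z i
    refine (integral_finsetSum _ fun i _ => (((j1 i).add (j2 i)).add (j3 i)).add (j4 i)).trans ?_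
    refine Finset.sum_congr rfl fun i _ => ?_
    exact (integral_add (((j1 i).add (j2 i)).add (j3 i)) (j4 i)).trans (congrArg (· + _)
      ((integral_add ((j1 i).add (j2 i)) (j3 i)).trans (congrArg (· + _)
        (integral_add (j1 i) (j2 i)))))
  · refine (norm_sum_le _ _).trans (Finset.sum_le_sum fun i _ => ?_)
    obtain ⟨⟨c1, c2⟩, c3, c4⟩ := ht
    refine (norm_add_le _ _).trans (add_le_add ((norm_add_le _ _).trans (add_le_add
      ((norm_add_le _ _).trans (add_le_add ?_ ?_)) ?_)) ?_)
    · exact norm_mul_rho_le (hA' _) (c3 _) c2 z (sq_norm_fst_le z i)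
    · exact norm_mul_rho_le (hA' _) (c3 _) c2 z (sq_norm_conj_fst_le z i)
    · exact norm_mul_rho_le hA c1 (c4 _) z (sq_norm_snd_le z i)
    · exact norm_mul_rho_le hA c1 (c4 _) z (sq_norm_conj_snd_le z i)
  · have h2 := ((hasDerivAt_comp_smul hf.differentiable (base n x) z.1 t).mul
      (hasDerivAt_comp_smul hg.differentiable (base n x) z.2 t)).mul_const (rho z)
    refine h2.congr_deriv ?_
    simp only [F', Finset.mul_sum, Finset.sum_mul, ← Finset.sum_add_distrib]
    refine Finset.sum_congr rfl fun i _ => ?_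
    ring

theorem eventually_wPsi_fst {n : ℕ} {u w : Spec n → ℂ} (hu : GaussSmooth u)
    (hw : GaussSmooth w) (x : ℂ) (i : Fin (n + 1)) : ∀ᶠ t in 𝓝 (0 : ℝ),
    wPsi x (fun z => z.1 i) u w t = t * Psi x (wirtinger (i, true) u) w t ∧
    wPsi x (fun z => (starRingEnd ℂ) (z.1 i)) u w t = t * Psi x (wirtinger (i, false) u) w t +
      if i = 0 then wPsi x (fun z => (starRingEnd ℂ) (z.2 0)) u w t else 0 := by
  obtain ⟨C, hC, bu⟩ := hu.exists_scaledBound x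
  obtain ⟨D, hD, bw⟩ := hw.exists_scaledBound x
  choose E hE be using fun b => (hu.wirtinger (i, b)).exists_scaledBound x
  filter_upwards [bu, bw, eventually_all.2 be] with t h1 h2 h3
  exact integral_by_parts_fst hu hw i hC hE h1 h2 h3

theorem eventually_wPsi_snd {n : ℕ} {u w : Spec n → ℂ} (hu : GaussSmooth u)
    (hw : GaussSmooth w) (x : ℂ) (i : Fin (n + 1)) : ∀ᶠ t in 𝓝 (0 : ℝ),
    wPsi x (fun z => (starRingEnd ℂ) (z.2 i)) u w t = t * Psi x u (wirtinger (i, false) w) t ∧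
    wPsi x (fun z => z.2 i) u w t = t * Psi x u (wirtinger (i, true) w) t +
      if i = 0 then wPsi x (fun z => z.1 0) u w t else 0 := by
  obtain ⟨C, hC, bu⟩ := hu.exists_scaledBound x
  obtain ⟨D, hD, bw⟩ := hw.exists_scaledBound x
  choose E hE be using fun b => (hw.wirtinger (i, b)).exists_scaledBound x
  filter_upwards [bu, bw, eventually_all.2 be] with t h1 h2 h3
  exact integral_by_parts_snd hu hw i hC h1 h2 h3

/-- The derivative of `Psi`. -/
theorem hasDerivAt_Psi {n : ℕ} {f g : Spec n → ℂ} (hf : GaussSmooth f)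
    (hg : GaussSmooth g) (x : ℂ) : ∀ᶠ t in 𝓝 (0 : ℝ), HasDerivAt (Psi x f g)
      (2 * t * ((∑ i, (Psi x (mixed i f) g t + Psi x f (mixed i g) t)) +
        Psi x (wirtinger (0, true) f) (wirtinger (0, false) g) t)) t := by
  filter_upwards [hasDerivAt_Psi_aux hf hg x,
    eventually_all.2 fun i => eventually_wPsi_fst (hf.wirtinger (i, false)) hg x i,
    eventually_all.2 fun i => eventually_wPsi_fst (hf.wirtinger (i, true)) hg x i,
    eventually_all.2 fun i => eventually_wPsi_snd hf (hg.wirtinger (i, false)) x i,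
    eventually_all.2 fun i => eventually_wPsi_snd hf (hg.wirtinger (i, true)) x i,
    eventually_wPsi_snd (hf.wirtinger (0, true)) hg x 0,
    eventually_wPsi_snd hf (hg.wirtinger (0, true)) x 0,
    eventually_wPsi_fst hf (hg.wirtinger (0, false)) x 0] with t h0 h1 h2 h3 h4 h5 h6 h7
  refine h0.congr_deriv ?_
  -- Each of the four weights yields a factor `t` and a mixed derivative. For `i = 0` the cross term
  -- leaves the weights `conj(q_1)` and `p_1`; a second integration by parts turns both into `t ∂̄_1
  -- f ∂_1 g`, hence the factor `2`.
  have e : ∀ i : Fin (n + 1), wPsi x (fun z => z.1 i) (wirtinger (i, false) f) g t +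
        wPsi x (fun z => (starRingEnd ℂ) (z.1 i)) (wirtinger (i, true) f) g t +
        wPsi x (fun z => z.2 i) f (wirtinger (i, false) g) t +
        wPsi x (fun z => (starRingEnd ℂ) (z.2 i)) f (wirtinger (i, true) g) t =
      2 * t * (Psi x (mixed i f) g t + Psi x f (mixed i g) t) + if i = 0 then 2 * t *
        Psi x (wirtinger (0, true) f) (wirtinger (0, false) g) t else 0 := by
    intro i
    rw [(h1 i).1, (h2 i).2, (h3 i).2, (h4 i).1, wirtinger_comm hf.1, wirtinger_comm hg.1]
    simp only [← mixed.eq_def]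
    split_ifs with hi
    · subst hi
      rw [h5.1, h7.1]
      ring
    · ring
  rw [Finset.sum_congr rfl fun i _ => e i, Finset.sum_add_distrib, ← Finset.mul_sum]
  simp
  ring

theorem Psi_isBigO_one {n : ℕ} {f g : Spec n → ℂ} (hf : GaussSmooth f)
    (hg : GaussSmooth g) (x : ℂ) : Psi x f g =O[𝓝 0] fun _ => (1 : ℝ) := by
  obtain ⟨A, hA, bf⟩ := hf.exists_scaledBound x
  obtain ⟨B, hB, bg⟩ := hg.exists_scaledBound x
  refine IsBigO.of_bound (∫ z : Spec n × Spec n, 8 * A * B * rhoBound z) ?_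
  filter_upwards [bf, bg] with t h1 h2
  rw [norm_one, mul_one]
  refine norm_integral_le_of_norm_le (integrable_rhoBound.const_mul _) (ae_of_all _ fun z => ?_)
  simpa only [one_mul] using norm_mul_rho_le hA h1 h2 z (sq_norm_one_le z)

/-- The total mass of `ρ` is never evaluated: it is a common factor on both sides of the expansion
at `t = 0`. -/
theorem Psi_zero {n : ℕ} (x : ℂ) (f g : Spec n → ℂ) :
    Psi x f g 0 = f (base n x) * g (base n x) * ∫ z : Spec n × Spec n, rho z := by
  simp only [Psi, zero_smul, add_zero, integral_const_mul]

theorem Psi_add_left {n : ℕ} {f f' g : Spec n → ℂ} (hf : GaussSmooth f)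
    (hf' : GaussSmooth f') (hg : GaussSmooth g) (x : ℂ) : ∀ᶠ t in 𝓝 (0 : ℝ),
    Psi x (fun d => f d + f' d) g t = Psi x f g t + Psi x f' g t := by
  obtain ⟨A, hA, bf⟩ := hf.exists_scaledBound x
  obtain ⟨A', hA', bf'⟩ := hf'.exists_scaledBound x
  obtain ⟨B, hB, bg⟩ := hg.exists_scaledBound x
  filter_upwards [bf, bf', bg] with t h1 h2 h3
  have i1 := integrable_mul_rho hA hf.continuous hg.continuous h1 h3 (a := fun _ => 1)
    (by fun_prop) sq_norm_one_le
  have i2 := integrable_mul_rho hA' hf'.continuous hg.continuous h2 h3 (a := fun _ => 1)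
    (by fun_prop) sq_norm_one_le
  simp only [one_mul] at i1 i2
  simp only [Psi, add_mul]
  exact integral_add i1 i2

theorem Psi_sum_left {n : ℕ} {ι : Type*} {s : Finset ι} {f : ι → Spec n → ℂ}
    {g : Spec n → ℂ} (hf : ∀ i ∈ s, GaussSmooth (f i)) (hg : GaussSmooth g) (x : ℂ) :
    ∀ᶠ t in 𝓝 (0 : ℝ), Psi x (fun d => ∑ i ∈ s, f i d) g t = ∑ i ∈ s, Psi x (f i) g t := by
  classical
  induction s using Finset.induction_on with
  | empty => simp [Psi]
  | insert i s hi ih =>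
    have hs := fun j hj => hf j (Finset.mem_insert_of_mem hj)
    filter_upwards [ih hs, Psi_add_left (hf i (Finset.mem_insert_self _ _))
      (GaussSmooth.sum hs) hg x] with t h1 h2
    simp only [Finset.sum_insert hi]
    rw [h2, h1]

theorem Psi_const_mul_left {n : ℕ} (x a : ℂ) (f g : Spec n → ℂ) (t : ℝ) :
    Psi x (fun d => a * f d) g t = a * Psi x f g t := by
  simp only [Psi, mul_assoc, integral_const_mul]

/-! ### The bidifferential operators of the expansion -/

/-- The bidifferential operators `G_m`. -/
def coeff {n : ℕ} : ℕ → (Spec n → ℂ) → (Spec n → ℂ) → Spec n → ℂ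
  | 0, f, g => fun d => f d * g d
  | m + 1, f, g => fun d => ((m : ℂ) + 1)⁻¹ *
      ((∑ i : Fin n, (coeff m (mixed i.succ f) g d + coeff m f (mixed i.succ g) d)) +
        (-1) * coeff m (wirtinger (0, false) f) (wirtinger (0, true) g) d)

theorem GaussSmooth.coeff {n : ℕ} (m : ℕ) {f g : Spec n → ℂ} (hf : GaussSmooth f)
    (hg : GaussSmooth g) : GaussSmooth (coeff m f g) := by
  induction m generalizing f g with
  | zero => exact hf.mul hg
  | succ m ih =>
    exact ((GaussSmooth.sum fun i _ => (ih (hf.mixed _) hg).add (ih hf (hg.mixed _))).add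
      ((ih (hf.wirtinger _) (hg.wirtinger _)).const_mul _)).const_mul _

/-- The Leibniz rule for `Δ_1`, valid for every `G_m` because `G_m` is built from
constant-coefficient derivatives, which commute with `∂_1` and `∂̄_1`. -/
theorem mixed_zero_coeff {n : ℕ} (m : ℕ) {f g : Spec n → ℂ} (hf : GaussSmooth f)
    (hg : GaussSmooth g) : mixed 0 (coeff m f g) = fun d =>
      coeff m (mixed 0 f) g d + coeff m f (mixed 0 g) d +
        coeff m (wirtinger (0, false) f) (wirtinger (0, true) g) d +
        coeff m (wirtinger (0, true) f) (wirtinger (0, false) g) d := by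
  induction m generalizing f g with
  | zero => exact mixed_mul hf hg 0
  | succ m ih =>
    have h1 : ∀ i ∈ (Finset.univ : Finset (Fin n)), GaussSmooth fun d =>
        coeff m (mixed i.succ f) g d + coeff m f (mixed i.succ g) d := fun i _ =>
      (GaussSmooth.coeff m (hf.mixed _) hg).add (GaussSmooth.coeff m hf (hg.mixed _))
    have h2 := GaussSmooth.coeff m (hf.wirtinger (0, false)) (hg.wirtinger (0, true))
    have h3 : ∀ i : Fin n, mixed 0 (fun d =>
        coeff m (mixed i.succ f) g d + coeff m f (mixed i.succ g) d) = fun d =>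
        mixed 0 (coeff m (mixed i.succ f) g) d + mixed 0 (coeff m f (mixed i.succ g)) d := fun i =>
      mixed_add (GaussSmooth.coeff m (hf.mixed _) hg) (GaussSmooth.coeff m hf (hg.mixed _)) 0
    have e : mixed 0 (coeff (m + 1) f g) = fun d => ((m : ℂ) + 1)⁻¹ *
        ((∑ i : Fin n, (mixed 0 (coeff m (mixed i.succ f) g) d +
          mixed 0 (coeff m f (mixed i.succ g)) d)) +
        (-1) * mixed 0 (coeff m (wirtinger (0, false) f) (wirtinger (0, true) g)) d) := by
      simp only [NormalMatrixQuantization.coeff]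
      rw [mixed_const_mul ((GaussSmooth.sum h1).add (h2.const_mul (-1))),
        mixed_add (GaussSmooth.sum h1) (h2.const_mul (-1)), mixed_sum h1, mixed_const_mul h2]
      simp only [h3]
    rw [e]
    funext d
    simp only [ih (hf.mixed _) hg, ih hf (hg.mixed _), ih (hf.wirtinger _) (hg.wirtinger _),
      NormalMatrixQuantization.coeff, mixed_mixed hf.1 0 (Fin.succ _),
      mixed_mixed hg.1 0 (Fin.succ _), mixed_wirtinger hf.1, mixed_wirtinger hg.1,
      wirtinger_comm hf.1 (0, true) (0, false), wirtinger_comm hg.1 (0, true) (0, false),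
      Finset.sum_add_distrib]
    ring

/-- The recursion for `G_m` and the Leibniz rule combined. -/
theorem succ_mul_coeff_add_mixed {n : ℕ} (m : ℕ) {f g : Spec n → ℂ} (hf : GaussSmooth f)
    (hg : GaussSmooth g) (d : Spec n) :
    ((m : ℂ) + 1) * coeff (m + 1) f g d + mixed 0 (coeff m f g) d =
      (∑ i, (coeff m (mixed i f) g d + coeff m f (mixed i g) d)) +
        coeff m (wirtinger (0, true) f) (wirtinger (0, false) g) d := by
  have h0 : (m : ℂ) + 1 ≠ 0 := by exact_mod_cast m.succ_ne_zero
  -- The term `-∂_1 f ∂̄_1 g` of the recursion cancels one of the two cross terms of the Leibniz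
  -- rule; the other one is the cross term of `hasDerivAt_Psi`.
  rw [mixed_zero_coeff m hf hg, coeff, mul_inv_cancel_left₀ h0, Fin.sum_univ_succ]
  ring

theorem iterWirtinger_append {n : ℕ} (l : List (Fin (n + 1) × Bool)) (p : Fin (n + 1) × Bool)
    (f : Spec n → ℂ) : iterWirtinger (l ++ [p]) f = iterWirtinger l (wirtinger p f) := by
  simp [iterWirtinger]

/-- Finite sums over arbitrary index sets are bidifferential operators. -/
theorem isBidifferential_of_family {n : ℕ} {ι : Type*} (s : Finset ι)
    (key : ι → List (Fin (n + 1) × Bool) × List (Fin (n + 1) × Bool)) (c : ι → Spec n → ℂ)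
    (hc : ∀ i ∈ s, ContDiff ℝ ∞ (c i)) {G : (Spec n → ℂ) → (Spec n → ℂ) → Spec n → ℂ}
    (hG : ∀ f g : Spec n → ℂ, ContDiff ℝ ∞ f → ContDiff ℝ ∞ g → ∀ d,
      G f g d = ∑ i ∈ s, c i d * iterWirtinger (key i).1 f d * iterWirtinger (key i).2 g d) :
    IsBidifferential G := by
  classical
  refine ⟨s.image key, fun p d => ∑ i ∈ s with key i = p, c i d, fun p _ =>
    ContDiff.sum fun i hi => hc i (Finset.mem_of_mem_filter i hi), fun f g hf hg d => ?_⟩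
  rw [hG f g hf hg, ← Finset.sum_fiberwise_of_maps_to
    (g := key) (t := s.image key) fun i hi => Finset.mem_image_of_mem key hi]
  refine Finset.sum_congr rfl fun p _ => ?_
  rw [Finset.sum_mul, Finset.sum_mul]
  refine Finset.sum_congr rfl fun i hi => ?_
  rw [(Finset.mem_filter.1 hi).2]

theorem isBidifferential_mul {n : ℕ} :
    IsBidifferential fun (f g : Spec n → ℂ) d => f d * g d :=
  isBidifferential_of_family {()} (fun _ => ([], [])) (fun _ _ => 1) (fun _ _ => contDiff_const)
    fun f g _ _ d => by simp [iterWirtinger]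

theorem IsBidifferential.add {n : ℕ} {G G' : (Spec n → ℂ) → (Spec n → ℂ) → Spec n → ℂ}
    (h : IsBidifferential G) (h' : IsBidifferential G') :
    IsBidifferential fun f g d => G f g d + G' f g d := by
  obtain ⟨s, a, ha, hs⟩ := h
  obtain ⟨s', a', ha', hs'⟩ := h'
  refine isBidifferential_of_family (s.disjSum s') (Sum.elim id id) (Sum.elim a a') ?_ ?_
  · intro i hi
    rcases i with i | i
    · exact ha i (Finset.inl_mem_disjSum.1 hi)
    · exact ha' i (Finset.inr_mem_disjSum.1 hi)
  · intro f g hf hg d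
    rw [Finset.sum_disjSum, hs f g hf hg, hs' f g hf hg]
    rfl

theorem IsBidifferential.const_mul {n : ℕ} {G : (Spec n → ℂ) → (Spec n → ℂ) → Spec n → ℂ}
    (h : IsBidifferential G) (c : ℂ) : IsBidifferential fun f g d => c * G f g d := by
  obtain ⟨s, a, ha, hs⟩ := h
  refine ⟨s, fun p d => c * a p d, fun p hp => contDiff_const.mul (ha p hp),
    fun f g hf hg d => ?_⟩
  simp only [hs f g hf hg, Finset.mul_sum]
  simp only [mul_assoc]

theorem isBidifferential_sum {n : ℕ} {ι : Type*} {s : Finset ι}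
    {G : ι → (Spec n → ℂ) → (Spec n → ℂ) → Spec n → ℂ} (h : ∀ i ∈ s, IsBidifferential (G i)) :
    IsBidifferential fun f g d => ∑ i ∈ s, G i f g d := by
  classical
  induction s using Finset.induction_on with
  | empty => exact ⟨∅, fun _ _ => 0, by simp, by simp⟩
  | insert i s hi ih =>
    simp only [Finset.sum_insert hi]
    exact (h i (Finset.mem_insert_self _ _)).add
      (ih fun j hj => h j (Finset.mem_insert_of_mem hj))

theorem IsBidifferential.wirtinger_left {n : ℕ}
    {G : (Spec n → ℂ) → (Spec n → ℂ) → Spec n → ℂ} (h : IsBidifferential G)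
    (p : Fin (n + 1) × Bool) : IsBidifferential fun f g => G (wirtinger p f) g := by
  obtain ⟨s, a, ha, hs⟩ := h
  refine isBidifferential_of_family s (fun q => (q.1 ++ [p], q.2)) a ha fun f g hf hg d => ?_
  simp only [iterWirtinger_append]
  exact hs _ _ (contDiff_wirtinger hf p) hg d

theorem IsBidifferential.wirtinger_right {n : ℕ}
    {G : (Spec n → ℂ) → (Spec n → ℂ) → Spec n → ℂ} (h : IsBidifferential G)
    (p : Fin (n + 1) × Bool) : IsBidifferential fun f g => G f (wirtinger p g) := by
  obtain ⟨s, a, ha, hs⟩ := h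
  refine isBidifferential_of_family s (fun q => (q.1, q.2 ++ [p])) a ha fun f g hf hg d => ?_
  simp only [iterWirtinger_append]
  exact hs _ _ hf (contDiff_wirtinger hg p) d

theorem isBidifferential_coeff {n : ℕ} (m : ℕ) : IsBidifferential (coeff (n := n) m) := by
  induction m with
  | zero => exact isBidifferential_mul
  | succ m ih =>
    exact ((isBidifferential_sum fun i _ =>
      ((ih.wirtinger_left _).wirtinger_left _).add
        ((ih.wirtinger_right _).wirtinger_right _)).add
      (((ih.wirtinger_left _).wirtinger_right _).const_mul _)).const_mul _

/-! ### The asymptotic expansion of `Psi` -/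

theorem Psi_zero_right {n : ℕ} (x : ℂ) (f : Spec n → ℂ) (t : ℝ) :
    Psi x f (fun _ => 0) t = 0 := by simp [Psi]

theorem Psi_zero_left {n : ℕ} (x : ℂ) (g : Spec n → ℂ) (t : ℝ) :
    Psi x (fun _ => 0) g t = 0 := by simp [Psi]

/-- For a function of `d_1` alone, paired with `1`, only `Δ_1` survives in `hasDerivAt_Psi`. -/
theorem hasDerivAt_Psi_restrictHead {n : ℕ} {u : Spec n → ℂ} (hu : GaussSmooth u) (x : ℂ) :
    ∀ᶠ t : ℝ in 𝓝 0, HasDerivAt (Psi x (restrictHead u) fun _ => 1)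
      (2 * t * Psi x (restrictHead (mixed 0 u)) (fun _ => 1) t) t := by
  filter_upwards [hasDerivAt_Psi hu.restrictHead (gaussSmooth_const 1) x] with t ht
  refine ht.congr_deriv ?_
  have h0 : mixed 0 (restrictHead u) = restrictHead (mixed 0 u) := by
    rw [mixed, wirtinger_restrictHead_zero hu.differentiable,
      wirtinger_restrictHead_zero (hu.wirtinger _).differentiable]
    rfl
  have h1 : ∀ i : Fin n, mixed i.succ (restrictHead u) = fun _ => 0 := by
    intro i
    rw [mixed, wirtinger_restrictHead_succ hu.differentiable, wirtinger_const]
  simp only [mixed_const, wirtinger_const, Psi_zero_right, Fin.sum_univ_succ, h0, h1,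
    Psi_zero_left, add_zero, Finset.sum_const_zero]

/-- This is `succ_mul_coeff_add_mixed` integrated. The restriction to `t` near `0` provides the
integrability that additivity of `Psi` requires. -/
theorem eventually_Psi_restrictHead_coeff {n : ℕ} (m : ℕ) {f g : Spec n → ℂ} (hf : GaussSmooth f)
    (hg : GaussSmooth g) (x : ℂ) : ∀ᶠ t : ℝ in 𝓝 0,
    (∑ i, (Psi x (restrictHead (coeff m (mixed i f) g)) (fun _ => 1) t +
      Psi x (restrictHead (coeff m f (mixed i g))) (fun _ => 1) t)) +
      Psi x (restrictHead (coeff m (wirtinger (0, true) f) (wirtinger (0, false) g)))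
        (fun _ => 1) t =
    ((m : ℂ) + 1) * Psi x (restrictHead (coeff (m + 1) f g)) (fun _ => 1) t +
      Psi x (restrictHead (mixed 0 (coeff m f g))) (fun _ => 1) t := by
  have h1 := fun i => (GaussSmooth.coeff m (hf.mixed i) hg).restrictHead
  have h2 := fun i => (GaussSmooth.coeff m hf (hg.mixed i)).restrictHead
  have h3 := (GaussSmooth.coeff m (hf.wirtinger (0, true)) (hg.wirtinger (0, false))).restrictHead
  have h4 := (GaussSmooth.coeff (m + 1) hf hg).restrictHead
  have h5 := ((GaussSmooth.coeff m hf hg).mixed 0).restrictHead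
  have hc := gaussSmooth_const (n := n) 1
  have h6 : ∀ i ∈ (Finset.univ : Finset (Fin (n + 1))), GaussSmooth fun d =>
      restrictHead (coeff m (mixed i f) g) d + restrictHead (coeff m f (mixed i g)) d :=
    fun i _ => (h1 i).add (h2 i)
  filter_upwards [eventually_all.2 fun i => Psi_add_left (h1 i) (h2 i) hc x,
    Psi_sum_left h6 hc x, Psi_add_left (GaussSmooth.sum h6) h3 hc x,
    Psi_add_left (h4.const_mul ((m : ℂ) + 1)) h5 hc x] with t e1 e2 e3 e4
  simp only [← e1]
  rw [← e2, ← e3, ← Psi_const_mul_left, ← e4]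
  congr 1
  funext d
  exact (succ_mul_coeff_add_mixed m hf hg _).symm

/-- The remainder of the expansion of `Psi`. -/
def remainder {n : ℕ} (x : ℂ) (M : ℕ) (f g : Spec n → ℂ) (t : ℝ) : ℂ :=
  Psi x f g t -
    ∑ m ∈ Finset.range M, (t : ℂ) ^ (2 * m) * Psi x (restrictHead (coeff m f g)) (fun _ => 1) t

/-- The derivative of `t^{2(m+1)}` in one term and `Δ_1` in the preceding term combine by the
recursion. Only the last `Δ_1` term, of order `t^{2M}`, remains unpaired. -/
theorem hasDerivAt_sum_coeff {n : ℕ} (x : ℂ) (M : ℕ) {f g : Spec n → ℂ} (hf : GaussSmooth f)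
    (hg : GaussSmooth g) : ∀ᶠ t : ℝ in 𝓝 0,
    HasDerivAt (fun t : ℝ => ∑ m ∈ Finset.range (M + 1), (t : ℂ) ^ (2 * m) *
      Psi x (restrictHead (coeff m f g)) (fun _ => 1) t)
      (2 * t * ((∑ m ∈ Finset.range M, (t : ℂ) ^ (2 * m) *
        ((∑ i, (Psi x (restrictHead (coeff m (mixed i f) g)) (fun _ => 1) t +
          Psi x (restrictHead (coeff m f (mixed i g))) (fun _ => 1) t)) +
        Psi x (restrictHead (coeff m (wirtinger (0, true) f) (wirtinger (0, false) g)))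
          (fun _ => 1) t)) +
        (t : ℂ) ^ (2 * M) * Psi x (restrictHead (mixed 0 (coeff M f g))) (fun _ => 1) t)) t := by
  induction M with
  | zero =>
    filter_upwards [hasDerivAt_Psi_restrictHead (GaussSmooth.coeff 0 hf hg) x] with t ht
    simpa using ht
  | succ M ih =>
    filter_upwards [ih, hasDerivAt_Psi_restrictHead (GaussSmooth.coeff (M + 1) hf hg) x,
      eventually_Psi_restrictHead_coeff M hf hg x] with t h1 h2 h3
    have h4 : HasDerivAt (fun t : ℝ => (t : ℂ) ^ (2 * (M + 1)))
        ((2 * (M + 1) : ℕ) * (t : ℂ) ^ (2 * (M + 1) - 1)) t := by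
      simpa using (hasDerivAt_id t).ofReal_comp.fun_pow (2 * (M + 1))
    simp only [Finset.sum_range_succ _ (M + 1)]
    refine (h1.add (h4.mul h2)).congr_deriv ?_
    rw [Finset.sum_range_succ, h3]
    have e : 2 * (M + 1) - 1 = 2 * M + 1 := by omega
    rw [e]
    push_cast
    ring

/-- `Psi` and its partial expansion satisfy the same differential equation up to the unpaired term,
so the remainders reproduce themselves with one order less and derivatives of `f` and `g` as
arguments. -/
theorem hasDerivAt_remainder {n : ℕ} (x : ℂ) (M : ℕ) {f g : Spec n → ℂ} (hf : GaussSmooth f)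
    (hg : GaussSmooth g) : ∀ᶠ t : ℝ in 𝓝 0, HasDerivAt (remainder x (M + 1) f g)
      (2 * t * (((∑ i, (remainder x M (mixed i f) g t + remainder x M f (mixed i g) t)) +
        remainder x M (wirtinger (0, true) f) (wirtinger (0, false) g) t) -
        (t : ℂ) ^ (2 * M) * Psi x (restrictHead (mixed 0 (coeff M f g))) (fun _ => 1) t)) t := by
  filter_upwards [hasDerivAt_Psi hf hg x, hasDerivAt_sum_coeff x M hf hg] with t h1 h2
  refine (h1.sub h2).congr_deriv ?_
  simp only [remainder, mul_add, Finset.sum_add_distrib, Finset.sum_sub_distrib, Finset.mul_sum]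
  rw [Finset.sum_comm (s := Finset.range M), Finset.sum_comm (s := Finset.range M)]
  simp only [← Finset.mul_sum]
  ring

/-- Integration of an estimate for the derivative. -/
theorem isBigO_of_hasDerivAt {F Q : ℝ → ℂ} {M : ℕ} (h0 : F 0 = 0)
    (hF : ∀ᶠ t : ℝ in 𝓝 0, HasDerivAt F (2 * t * Q t) t)
    (hQ : Q =O[𝓝 0] fun t : ℝ => t ^ (2 * M)) : F =O[𝓝 0] fun t : ℝ => t ^ (2 * (M + 1)) := by
  obtain ⟨C, hC0, hC⟩ := hQ.exists_nonneg
  obtain ⟨ε, hε, H⟩ := Metric.eventually_nhds_iff_ball.1 (hF.and hC.bound)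
  refine IsBigO.of_bound (2 * C) ?_
  filter_upwards [Metric.ball_mem_nhds (0 : ℝ) hε] with t ht
  have hsub : ∀ s ∈ Metric.closedBall (0 : ℝ) |t|, |s| ≤ |t| ∧ s ∈ Metric.ball (0 : ℝ) ε := by
    intro s hs
    have h1 : |s| ≤ |t| := by simpa using hs
    have h2 : |t| < ε := by simpa using ht
    exact ⟨h1, by simpa using h1.trans_lt h2⟩
  -- Mean value inequality on `|s| ≤ |t|`, where the derivative is at most `2|t| · C|t|^{2M}`.
  have key := Convex.norm_image_sub_le_of_norm_hasDerivWithin_le (f := F)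
    (f' := fun t => 2 * t * Q t) (s := Metric.closedBall (0 : ℝ) |t|) (x := 0) (y := t)
    (C := 2 * |t| * (C * |t| ^ (2 * M)))
    (fun s hs => (H s (hsub s hs).2).1.hasDerivWithinAt) (fun s hs => ?_)
    (convex_closedBall _ _) (by simp) (by simp)
  · rw [h0, sub_zero, sub_zero, Real.norm_eq_abs] at key
    refine key.trans (le_of_eq ?_)
    rw [Real.norm_eq_abs, abs_pow]
    ring
  · obtain ⟨h1, h2⟩ := hsub s hs
    have h3 := (H s h2).2
    rw [Real.norm_eq_abs, abs_pow] at h3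
    rw [norm_mul, norm_mul, Complex.norm_real, Real.norm_eq_abs, Complex.norm_ofNat]
    have h4 : C * |s| ^ (2 * M) ≤ C * |t| ^ (2 * M) := by gcongr
    have := h3.trans h4
    gcongr

/-- The induction is over all `f` and `g` at once, since its step replaces them by derivatives. -/
theorem remainder_isBigO {n : ℕ} (x : ℂ) (M : ℕ) {f g : Spec n → ℂ} (hf : GaussSmooth f)
    (hg : GaussSmooth g) : remainder x M f g =O[𝓝 0] fun t : ℝ => t ^ (2 * M) := by
  induction M generalizing f g with
  | zero =>
    have h : remainder x 0 f g = Psi x f g := by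
      funext t
      simp [remainder]
    rw [h]
    simpa using Psi_isBigO_one hf hg x
  | succ M ih =>
    refine isBigO_of_hasDerivAt ?_ (hasDerivAt_remainder x M hf hg) ?_
    -- At `t = 0` only the term `m = 0` of the sum counts, and `G_0(f, g) = f g` makes it equal to
    -- `Psi x f g 0`.
    · rw [remainder, Finset.sum_range_succ', Psi_zero]
      simp only [Psi_zero, coeff, restrictHead, flat, base, Fin.cons_zero]
      simp
    · refine ((IsBigO.fun_sum (s := Finset.univ) (A := fun i t =>
          remainder x M (mixed i f) g t + remainder x M f (mixed i g) t)
        fun i _ => (ih (hf.mixed i) hg).add (ih hf (hg.mixed i))).add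
        (ih (hf.wirtinger _) (hg.wirtinger _))).sub ?_
      have h1 : (fun t : ℝ => (t : ℂ) ^ (2 * M)) =O[𝓝 0] fun t : ℝ => t ^ (2 * M) :=
        isBigO_of_le _ fun t => by simp
      simpa using h1.mul (Psi_isBigO_one ((GaussSmooth.coeff M hf hg).mixed 0).restrictHead
        (gaussSmooth_const 1) x)

/-! ### `U`-invariant functions -/

/-- Conjugation by the diagonal sign matrix with a single `-1` at `i` fixes `diag(d)` and changes
the sign of the entry `(i, j)`. -/
theorem IsUInvariant.apply_diagonal_of_ne {n : ℕ} {φ : Mat n → Mat n} (hφ : IsUInvariant φ)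
    (d : Spec n) {i j : Fin (n + 1)} (hij : i ≠ j) : φ (Matrix.diagonal d) i j = 0 := by
  let e : Spec n := Function.update 1 i (-1)
  have he : ∀ k, e k * (starRingEnd ℂ) (e k) = 1 := by
    intro k
    by_cases hk : k = i
    · subst hk
      simp [e]
    · simp [e, hk]
  have hW : Matrix.diagonal e ∈ Matrix.unitaryGroup (Fin (n + 1)) ℂ := by
    rw [Matrix.mem_unitaryGroup_iff, Matrix.star_eq_conjTranspose, Matrix.diagonal_conjTranspose,
      Matrix.diagonal_mul_diagonal, ← Matrix.diagonal_one]
    congr 1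
    funext k
    exact he k
  have hd : Matrix.diagonal e * Matrix.diagonal d * (Matrix.diagonal e)ᴴ = Matrix.diagonal d := by
    rw [Matrix.diagonal_conjTranspose, Matrix.diagonal_mul_diagonal, Matrix.diagonal_mul_diagonal]
    congr 1
    funext k
    simp only [Pi.star_apply, Complex.star_def]
    rw [mul_right_comm, he, one_mul]
  have hn : Matrix.diagonal d ∈ normalMatrices n := by
    simpa using conj_diagonal_mem_normalMatrices (1 : UN n) d
  have h := congrFun (congrFun (hφ ⟨_, hW⟩ _ hn) i) j
  dsimp only at h
  rw [hd, Matrix.diagonal_conjTranspose, Matrix.mul_diagonal, Matrix.diagonal_mul] at h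
  have h1 : φ (Matrix.diagonal d) i j = -φ (Matrix.diagonal d) i j := by
    simpa [e, hij.symm] using h
  exact self_eq_neg.1 h1

theorem IsUInvariant.apply_diagonal_comp {n : ℕ} {φ : Mat n → Mat n} (hφ : IsUInvariant φ)
    (d : Spec n) (σ : Equiv.Perm (Fin (n + 1))) (i : Fin (n + 1)) :
    φ (Matrix.diagonal (d ∘ σ)) i i = φ (Matrix.diagonal d) (σ i) (σ i) := by
  let P : Mat n := σ.permMatrix ℂ
  have hP : P ∈ Matrix.unitaryGroup (Fin (n + 1)) ℂ := by
    rw [Matrix.mem_unitaryGroup_iff, Matrix.star_eq_conjTranspose, Matrix.conjTranspose_permMatrix,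
      ← Matrix.permMatrix_mul]
    simp
  have hc : ∀ A : Mat n, P * A * Pᴴ = A.submatrix σ σ := by
    intro A
    ext a b
    simp [P, Matrix.conjTranspose_permMatrix, Equiv.Perm.permMatrix, PEquiv.toMatrix_toPEquiv_mul,
      PEquiv.mul_toMatrix_toPEquiv, Equiv.Perm.inv_def]
  have hn : Matrix.diagonal d ∈ normalMatrices n := by
    simpa using conj_diagonal_mem_normalMatrices (1 : UN n) d
  have h := hφ ⟨P, hP⟩ _ hn
  dsimp only at h
  rw [hc, hc, Matrix.submatrix_diagonal_equiv] at h
  rw [h]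
  rfl

/-- Invariance under diagonal signs makes `φ(diag d)` diagonal, and invariance under permutation
matrices expresses each diagonal entry through the corner entry at permuted eigenvalues. -/
theorem IsUInvariant.isSharp {n : ℕ} {φ : Mat n → Mat n} (hφ : IsUInvariant φ) :
    IsSharp φ fun d => φ (Matrix.diagonal d) 0 0 := by
  intro p
  have hn : Matrix.diagonal p.2 ∈ normalMatrices n := by
    simpa using conj_diagonal_mem_normalMatrices (1 : UN n) p.2
  have h := hφ p.1⁻¹ _ hn
  rw [coe_inv_UN, Matrix.conjTranspose_conjTranspose] at h
  rw [diagMap, h]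
  congr 2
  ext i j
  rw [sharpDiag_eq]
  by_cases hij : i = j
  · subst hij
    rw [Matrix.diagonal_apply_eq, hφ.apply_diagonal_comp, Fin.cycleRange_symm_zero]
  · rw [Matrix.diagonal_apply_ne _ hij, hφ.apply_diagonal_of_ne _ hij]

theorem IsSmoothOfGaussianGrowth.gaussSmooth {n : ℕ} {φ : Mat n → Mat n}
    (hφ : IsSmoothOfGaussianGrowth φ) : GaussSmooth fun d => φ (Matrix.diagonal d) 0 0 :=
  ⟨(hφ 0 0).1, (hφ 0 0).2⟩

/-- The symbol is recovered from the corner entry on diagonal matrices, so it is unique. -/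
theorem IsSharp.eq_of_eq_sharp {n : ℕ} {φ : Mat n → Mat n} {f g : Spec n → ℂ} (hφ : IsSharp φ f)
    (hg : IsSymmetricTail g) (h : ∀ Z ∈ normalMatrices n, φ Z = sharp g Z) : g = f := by
  funext d
  have hn : Matrix.diagonal d ∈ normalMatrices n := by
    simpa using conj_diagonal_mem_normalMatrices (1 : UN n) d
  rw [← hφ.apply_diagonal d, h _ hn, (isSharp_sharp hg).apply_diagonal d]

theorem isSharp_spectral {n : ℕ} (u : ℂ → ℂ) : IsSharp (spectral n u) fun d => u (d 0) :=
  isSharp_sharp fun σ z w => by simp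

/-! ### The expansion of the Berezin transform -/

theorem eventually_le_inv (c : ℝ) : ∀ᶠ h in 𝓝[>] (0 : ℝ), 0 < h ∧ c ≤ h⁻¹ / 16 := by
  have h1 : Tendsto (fun h : ℝ => h⁻¹ / 16) (𝓝[>] 0) atTop :=
    tendsto_inv_nhdsGT_zero.atTop_div_const (by norm_num)
  exact eventually_mem_nhdsWithin.and (h1.eventually_ge_atTop c)

theorem toeplitzDefined_of_gaussSmooth {n : ℕ} {φ : Mat n → Mat n} {f : Spec n → ℂ}
    (hφ : IsSharp φ f) (hf : GaussSmooth f) : ToeplitzDefined φ := by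
  obtain ⟨c, -, hc⟩ := hf.growth
  filter_upwards [eventually_le_inv c] with h hh X hX χ
  exact inDomain_coherent hh.1 hh.2 hφ hf.continuous hc hX χ

theorem toeplitzProductDefined_of_gaussSmooth {n : ℕ} {φ ψ : Mat n → Mat n} {f g : Spec n → ℂ}
    (hφ : IsSharp φ f) (hψ : IsSharp ψ g) (hf : GaussSmooth f) (hg : GaussSmooth g) :
    ToeplitzProductDefined φ ψ := by
  obtain ⟨c, -, hc⟩ := hf.growth
  obtain ⟨c', -, hc'⟩ := hg.growth
  filter_upwards [eventually_le_inv (max c c')] with h hh X hX χ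
  have hc1 := hc.mono (le_max_left c c')
  have hc2 := hc'.mono (le_max_right c c')
  exact ⟨inDomain_coherent hh.1 hh.2 hψ hg.continuous hc2 hX χ,
    inDomain_toeplitz_coherent hh.1 hh.2 hφ hψ hf.continuous hg.continuous hc1 hc2 hX χ⟩

theorem eventually_berezin_toeplitz_toeplitz {n : ℕ} {φ ψ : Mat n → Mat n} {f g : Spec n → ℂ}
    (hφ : IsSharp φ f) (hψ : IsSharp ψ g) (hf : GaussSmooth f) (hg : GaussSmooth g) (V : UN n)
    (x : Spec n) : ∀ᶠ h in 𝓝[>] (0 : ℝ),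
    berezin h (toeplitz h φ ∘ toeplitz h ψ) ((V : Mat n) * Matrix.diagonal x * (V : Mat n)ᴴ) =
      (V : Mat n) * Matrix.diagonal (fun j => Psi (x j) f g (√h)) * (V : Mat n)ᴴ := by
  obtain ⟨c, -, hc⟩ := hf.growth
  obtain ⟨c', -, hc'⟩ := hg.growth
  filter_upwards [eventually_le_inv (max c c')] with h hh
  rw [berezin_toeplitz_toeplitz hh.1 hh.2 hφ hψ hf.continuous hg.continuous
    (hc.mono (le_max_left c c')) (hc'.mono (le_max_right c c')) V x]
  simp only [exp_mul_integral_gaussianSpec_prod hh.1]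

theorem eventually_berezin_toeplitz {n : ℕ} {φ : Mat n → Mat n} {f : Spec n → ℂ}
    (hφ : IsSharp φ f) (hf : GaussSmooth f) (V : UN n) (x : Spec n) : ∀ᶠ h in 𝓝[>] (0 : ℝ),
    berezin h (toeplitz h φ) ((V : Mat n) * Matrix.diagonal x * (V : Mat n)ᴴ) =
      (V : Mat n) * Matrix.diagonal (fun j => Psi (x j) f (fun _ => 1) (√h)) * (V : Mat n)ᴴ := by
  filter_upwards [eventually_berezin_toeplitz_toeplitz hφ isSharp_one hf (gaussSmooth_const 1) V x]
    with h hh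
  rw [← hh]
  congr 1
  funext F
  rw [Function.comp, toeplitz_one]

theorem conj_diagonal_apply {n : ℕ} (V : UN n) (s : Spec n) (a b : Fin (n + 1)) :
    ((V : Mat n) * Matrix.diagonal s * (V : Mat n)ᴴ) a b =
      ∑ j, ((V : Mat n) a j * (starRingEnd ℂ) ((V : Mat n) b j)) * s j := by
  rw [Matrix.mul_apply]
  refine Finset.sum_congr rfl fun j _ => ?_
  rw [Matrix.mul_diagonal, Matrix.conjTranspose_apply, Complex.star_def]
  ring

/-- In the eigenbasis of `X` the difference to be estimated is diagonal, with entries the remainders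
of `Psi` at `t = √h`; a matrix entry is a fixed finite combination of them. -/
theorem hasExpansion_coeff {n : ℕ} {φ ψ : Mat n → Mat n} {f g : Spec n → ℂ}
    (hφ : IsSharp φ f) (hψ : IsSharp ψ g) (hf : GaussSmooth f) (hg : GaussSmooth g) :
    HasExpansion φ ψ fun m => flat (coeff m f g) := by
  intro X hX a b M
  obtain ⟨V, x, rfl⟩ := exists_unitary_diagonal hX
  have h1 : Tendsto (fun h : ℝ => √h) (𝓝[>] 0) (𝓝 0) := by
    have := (Real.continuous_sqrt.tendsto 0).mono_left (nhdsWithin_le_nhds (s := Set.Ioi 0))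
    rwa [Real.sqrt_zero] at this
  have h2 : ∀ j, (fun h : ℝ => remainder (x j) (M + 1) f g (√h)) =O[𝓝[>] 0]
      fun h : ℝ => h ^ (M + 1) := by
    intro j
    refine ((remainder_isBigO (x j) (M + 1) hf hg).comp_tendsto h1).congr' (EventuallyEq.refl _ _)
      ?_
    filter_upwards [self_mem_nhdsWithin] with h hh
    rw [Function.comp, pow_mul, Real.sq_sqrt (le_of_lt hh)]
  have h3 : (fun h : ℝ => ∑ j, ((V : Mat n) a j * (starRingEnd ℂ) ((V : Mat n) b j)) *
      remainder (x j) (M + 1) f g (√h)) =O[𝓝[>] 0] fun h : ℝ => h ^ (M + 1) :=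
    IsBigO.fun_sum fun j _ => (h2 j).const_mul_left _
  refine h3.congr' ?_ (EventuallyEq.refl _ _)
  have h4 : ∀ᶠ h in 𝓝[>] (0 : ℝ), ∀ m ∈ Finset.range (M + 1),
      berezin h (toeplitz h (spectral n (flat (coeff m f g))))
        ((V : Mat n) * Matrix.diagonal x * (V : Mat n)ᴴ) = (V : Mat n) * Matrix.diagonal
        (fun j => Psi (x j) (restrictHead (coeff m f g)) (fun _ => 1) (√h)) * (V : Mat n)ᴴ :=
    (eventually_all_finset _).2 fun m _ =>
      eventually_berezin_toeplitz (isSharp_spectral _) (GaussSmooth.coeff m hf hg).restrictHead V x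
  filter_upwards [eventually_berezin_toeplitz_toeplitz hφ hψ hf hg V x, h4, self_mem_nhdsWithin]
    with h e1 e2 hh
  have e3 : ((√h : ℝ) : ℂ) ^ 2 = (h : ℂ) := by
    rw [← Complex.ofReal_pow, Real.sq_sqrt (le_of_lt hh)]
  have e4 : ∑ m ∈ Finset.range (M + 1), (h : ℂ) ^ m •
      berezin h (toeplitz h (spectral n (flat (coeff m f g))))
        ((V : Mat n) * Matrix.diagonal x * (V : Mat n)ᴴ) =
      ∑ m ∈ Finset.range (M + 1), (h : ℂ) ^ m • ((V : Mat n) * Matrix.diagonal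
        (fun j => Psi (x j) (restrictHead (coeff m f g)) (fun _ => 1) (√h)) * (V : Mat n)ᴴ) :=
    Finset.sum_congr rfl fun m hm => by rw [e2 m hm]
  rw [e1, e4, Matrix.sub_apply, Matrix.sum_apply]
  simp only [Matrix.smul_apply, conj_diagonal_apply, remainder, pow_mul, e3, smul_eq_mul,
    mul_sub, Finset.sum_sub_distrib, Finset.mul_sum]
  rw [Finset.sum_comm]
  congr 1
  refine Finset.sum_congr rfl fun j _ => Finset.sum_congr rfl fun m _ => ?_
  ring

/-! ### Uniqueness of the expansion -/

/-- Gaussian averages of a function that is square integrable for one Gaussian measure converge to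
the value at the centre. -/
theorem tendsto_integral_gaussDensity {n : ℕ} {h₁ : ℝ} (hh₁ : 0 < h₁) {g : Spec n → ℂ}
    (hg : Continuous g) (hi : Integrable fun v => gaussDensity n h₁ v • g v) :
    Tendsto (fun h => ∫ v, gaussDensity n h v • g v) (𝓝[>] 0) (𝓝 (g 0)) := by
  have hpi := Real.pi_pos
  have hlim : Tendsto (fun d : Spec n => ‖d‖ ^ Module.finrank ℝ (Spec n) * gaussDensity n 1 d)
      (Bornology.cobounded (Spec n)) (𝓝 0) := by
    have h1 : Tendsto (fun d : Spec n => ‖d‖ ^ Module.finrank ℝ (Spec n) * Real.exp (-‖d‖))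
        (Bornology.cobounded (Spec n)) (𝓝 0) :=
      (Real.tendsto_pow_mul_exp_neg_atTop_nhds_zero _).comp tendsto_norm_cobounded_atTop
    have h2 := h1.const_mul ((Real.pi * 1) ^ (n + 1))⁻¹
    rw [mul_zero] at h2
    refine squeeze_zero' (Eventually.of_forall fun d =>
      mul_nonneg (by positivity) (gaussDensity_nonneg one_pos d)) ?_ h2
    filter_upwards [tendsto_norm_cobounded_atTop.eventually_ge_atTop 1] with d hd
    have h3 : ‖d‖ ≤ nsq d := by
      have h4 : ‖d‖ ^ 2 ≤ nsq d := by
        have h5 : ‖d‖ ≤ √(nsq d) := (pi_norm_le_iff_of_nonneg (Real.sqrt_nonneg _)).2 fun i =>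
          Real.le_sqrt_of_sq_le (sq_norm_le_nsq d i)
        calc ‖d‖ ^ 2 ≤ √(nsq d) ^ 2 := by gcongr
          _ = nsq d := Real.sq_sqrt (nsq_nonneg d)
      nlinarith
    rw [gaussDensity, mul_left_comm]
    gcongr
    rw [inv_one]
    linarith
  -- For `h < h₁` the Gaussian of width `h` is, up to the factor `(1 - h/h₁)^{-N} → 1`, this fixed
  -- one times the kernel `c^{2N} gaussDensity n 1 (c v)`, `c² = h⁻¹ - h₁⁻¹`. As `c → ∞` the latter
  -- is an approximate identity acting on the integrable function `G`.
  let G : Spec n → ℂ := fun v => Real.exp (-h₁⁻¹ * nsq v) • g v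
  have hG : Integrable G := by
    refine (hi.const_mul (((Real.pi * h₁) ^ (n + 1) : ℝ) : ℂ)).congr (ae_of_all _ fun v => ?_)
    have h0 : (Real.pi * h₁) ^ (n + 1) ≠ 0 := by positivity
    simp only [G, gaussDensity, ← Complex.real_smul, smul_smul, mul_inv_cancel_left₀ h0]
  have hpeak := tendsto_integral_comp_smul_smul_of_integrable
    (fun d => gaussDensity_nonneg one_pos d) (integral_gaussDensity (n := n) one_pos) hlim hG
    (by fun_prop : Continuous G).continuousAt
  have hc : Tendsto (fun h : ℝ => √(h⁻¹ - h₁⁻¹)) (𝓝[>] 0) atTop :=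
    Real.tendsto_sqrt_atTop.comp (tendsto_atTop_add_const_right _ _ tendsto_inv_nhdsGT_zero)
  have hr : Tendsto (fun h : ℝ => ((1 - h * h₁⁻¹) ^ (n + 1))⁻¹) (𝓝[>] 0) (𝓝 1) := by
    have : ContinuousAt (fun h : ℝ => ((1 - h * h₁⁻¹) ^ (n + 1))⁻¹) 0 :=
      ContinuousAt.inv₀ (by fun_prop) (by simp)
    have h1 := this.tendsto.mono_left (nhdsWithin_le_nhds (s := Set.Ioi 0))
    simpa using h1
  have hfin := hr.smul (hpeak.comp hc)
  have hG0 : (1 : ℝ) • G 0 = g 0 := by simp [G, nsq]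
  rw [hG0] at hfin
  refine hfin.congr' ?_
  filter_upwards [Ioo_mem_nhdsGT hh₁] with h hh
  have hpos : 0 < h⁻¹ - h₁⁻¹ := sub_pos.2 ((inv_lt_inv₀ hh₁ hh.1).2 hh.2)
  rw [Function.comp, ← integral_smul]
  refine integral_congr_ae (ae_of_all _ fun v => ?_)
  dsimp only [G]
  rw [smul_smul, smul_smul, finrank_spec, pow_mul, Real.sq_sqrt hpos.le]
  congr 1
  rw [gaussDensity, gaussDensity, nsq_smul, Real.sq_sqrt hpos.le]
  have hh0 := hh.1
  have e1 : Real.exp (-h⁻¹ * nsq v) =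
      Real.exp (-1⁻¹ * ((h⁻¹ - h₁⁻¹) * nsq v)) * Real.exp (-h₁⁻¹ * nsq v) := by
    rw [← Real.exp_add]
    congr 1
    ring
  have e2 : 1 - h * h₁⁻¹ = h * (h⁻¹ - h₁⁻¹) := by
    rw [mul_sub, mul_inv_cancel₀ hh0.ne']
  rw [e1, e2]
  generalize h⁻¹ - h₁⁻¹ = c at hpos
  rw [mul_one, mul_pow, mul_pow, mul_inv, mul_inv]
  field_simp

/-- At `X = x · 1` every vector is an eigenvector, so each `K_{X,v}` is the field of the same
exponential and `memLp_of_memLp_sfield` applies. -/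
theorem memLp_of_toeplitzDefined {n : ℕ} {h : ℝ} (hh : 0 < h) {φ : Mat n → Mat n} {f : Spec n → ℂ}
    (hφ : IsSharp φ f) (hf : Continuous f) (x : ℂ)
    (hd : ∀ X ∈ normalMatrices n, ∀ χ : Vec n, InDomain h φ (coherent h X χ)) :
    MemLp (fun d => f d * kexp ((starRingEnd ℂ) x / h) d) 2 (gaussianSpec n h) := by
  refine memLp_of_memLp_sfield (hf.mul (continuous_kexp _)) fun v => ?_
  have hX := conj_diagonal_mem_normalMatrices (1 : UN n) fun _ => x
  have h1 := hd _ hX v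
  refine (memLp_congr_ae ?_).1 (h1.comp_measurePreserving
    (measurable_diagMap.measurePreserving (nu n h)))
  have h2 := ae_of_ae_map measurable_diagMap.aemeasurable (coherent_coeFn hh hX v)
  filter_upwards [h2] with p hp
  rw [Function.comp, hp, ← act_sfield hφ]
  congr 1
  conv_lhs => rw [sum_column 1 v, act_sum]
  simp only [act_smul, act_kernel_column]
  conv_rhs => rw [sum_column 1 v, sfield, act_sum]
  simp only [act_smul]
  rfl

/-- The transform is a Gaussian average of `u` around `x`. Its existence for one `h₁` gives the
integrability needed for convergence to `u(x)`. -/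
theorem tendsto_berezin_spectral {n : ℕ} {u : ℂ → ℂ} (hu : IsSpectralSymbol n u) (x : ℂ) :
    Tendsto (fun h => berezin h (toeplitz h (spectral n u))
      (((1 : UN n) : Mat n) * Matrix.diagonal (fun _ => x) * ((1 : UN n) : Mat n)ᴴ) 0 0)
      (𝓝[>] 0) (𝓝 (u x)) := by
  have hc : Continuous fun d : Spec n => u (d 0) := hu.1.continuous.comp (continuous_apply 0)
  have hev : ∀ᶠ h : ℝ in 𝓝[>] 0, 0 < h ∧ MemLp (fun d : Spec n => u (d 0) *
      kexp ((starRingEnd ℂ) x / h) d) 2 (gaussianSpec n h) := by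
    filter_upwards [hu.2, self_mem_nhdsWithin] with h h1 h2
    exact ⟨h2, memLp_of_toeplitzDefined h2 (isSharp_spectral u) hc x h1⟩
  obtain ⟨h₁, hh₁, hm₁⟩ := hev.exists
  have hi : Integrable fun v => gaussDensity n h₁ v • u ((base n x + v) 0) := by
    have i1 := integrable_conj_mul (memLp_kexp hh₁ ((starRingEnd ℂ) x / h₁)) hm₁
    rw [integrable_gaussianSpec hh₁] at i1
    have i2 := (i1.const_mul ((Real.exp (-(‖x‖ ^ 2 / h₁)) : ℝ) : ℂ)).comp_add_left (base n x)
    refine i2.congr (ae_of_all _ fun v => ?_)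
    dsimp only
    rw [← gaussDensity_sub_base_smul hh₁ x fun d => u (d 0), add_sub_cancel_left]
  have hc' : Continuous fun v : Spec n => u ((base n x + v) 0) :=
    hc.comp (continuous_const.add continuous_id)
  have hl := tendsto_integral_gaussDensity hh₁ hc' hi
  have h0 : u ((base n x + 0) 0) = u x := by simp [base]
  rw [h0] at hl
  refine hl.congr' ?_
  filter_upwards [hev] with h hh
  rw [berezin_toeplitz hh.1 (isSharp_spectral u) hc 1 _ fun _ => hh.2]
  simp only [exp_mul_integral_gaussianSpec hh.1 x fun d => u (d 0)]
  simp

/-- If the coefficients below `M` agree, subtraction of the expansions and division by `h^M` leave a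
difference of two Berezin transforms that is `O(h)`; its limit is `γ' M x - γ M x`. -/
theorem HasExpansion.unique {n : ℕ} {φ ψ : Mat n → Mat n} {γ γ' : ℕ → ℂ → ℂ}
    (hγ : ∀ m, IsSpectralSymbol n (γ m)) (hγ' : ∀ m, IsSpectralSymbol n (γ' m))
    (h : HasExpansion φ ψ γ) (h' : HasExpansion φ ψ γ') : γ' = γ := by
  funext M
  induction M using Nat.strong_induction_on with
  | _ M ih =>
    funext x
    have hX := conj_diagonal_mem_normalMatrices (1 : UN n) fun _ => x
    have h1 := (h _ hX 0 0 M).sub (h' _ hX 0 0 M)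
    set B : (ℂ → ℂ) → ℝ → ℂ := fun u h => berezin h (toeplitz h (spectral n u))
      (((1 : UN n) : Mat n) * Matrix.diagonal (fun _ => x) * ((1 : UN n) : Mat n)ᴴ) 0 0 with hB
    have h2 : (fun h : ℝ => (h : ℂ) ^ M * (B (γ' M) h - B (γ M) h)) =O[𝓝[>] 0]
        fun h : ℝ => h ^ (M + 1) := by
      refine h1.congr_left fun h => ?_
      have e : ∑ m ∈ Finset.range M, (h : ℂ) ^ m • berezin h (toeplitz h (spectral n (γ' m)))
          (((1 : UN n) : Mat n) * Matrix.diagonal (fun _ => x) * ((1 : UN n) : Mat n)ᴴ) =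
          ∑ m ∈ Finset.range M, (h : ℂ) ^ m • berezin h (toeplitz h (spectral n (γ m)))
          (((1 : UN n) : Mat n) * Matrix.diagonal (fun _ => x) * ((1 : UN n) : Mat n)ᴴ) :=
        Finset.sum_congr rfl fun m hm => by rw [ih m (Finset.mem_range.1 hm)]
      simp only [Finset.sum_range_succ, e, Matrix.sub_apply, Matrix.add_apply, Matrix.smul_apply,
        smul_eq_mul, hB]
      ring
    have h3 : (fun h : ℝ => B (γ' M) h - B (γ M) h) =O[𝓝[>] 0] fun h : ℝ => h := by
      obtain ⟨C, hC⟩ := h2.bound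
      refine IsBigO.of_bound C ?_
      filter_upwards [hC, self_mem_nhdsWithin] with h hC hh
      have hp : 0 < ‖h‖ ^ M := pow_pos (norm_pos_iff.2 (ne_of_gt hh)) M
      rw [norm_mul, norm_pow, norm_pow, Complex.norm_real, pow_succ, mul_left_comm] at hC
      exact le_of_mul_le_mul_left hC hp
    have h4 : Tendsto (fun h : ℝ => B (γ' M) h - B (γ M) h) (𝓝[>] 0) (𝓝 0) :=
      h3.trans_tendsto (tendsto_id.mono_left nhdsWithin_le_nhds)
    have h5 := (tendsto_berezin_spectral (hγ' M) x).sub (tendsto_berezin_spectral (hγ M) x)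
    exact sub_eq_zero.1 (tendsto_nhds_unique h5 h4)

/-! ### The first two terms -/

theorem flat_eq_comp {n : ℕ} (f : Spec n → ℂ) :
    flat f = f ∘ ContinuousLinearMap.single ℝ (fun _ : Fin (n + 1) => ℂ) 0 := by
  funext z
  simp only [flat, Function.comp]
  congr 1
  funext i
  refine Fin.cases ?_ (fun i => ?_) i <;> simp

theorem contDiff_flat {n : ℕ} {f : Spec n → ℂ} (hf : ContDiff ℝ ∞ f) : ContDiff ℝ ∞ (flat f) := by
  rw [flat_eq_comp]
  exact hf.comp (ContinuousLinearMap.contDiff _)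

theorem fderiv_flat {n : ℕ} {f : Spec n → ℂ} (hf : Differentiable ℝ f) (z c : ℂ) :
    fderiv ℝ (flat f) z c = fderiv ℝ f (base n z) (Pi.single 0 c) := by
  have h2 : ContinuousLinearMap.single ℝ (fun _ : Fin (n + 1) => ℂ) 0 z = base n z := by
    funext i
    refine Fin.cases ?_ (fun i => ?_) i <;> simp [base]
  rw [flat_eq_comp, fderiv_comp _ (hf _) (ContinuousLinearMap.differentiableAt _),
    ContinuousLinearMap.fderiv, h2]
  rfl

/-- The part of `G_1` with the derivatives in `d_2, …, d_N` is symmetric in `f` and `g` and cancels.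
What remains is `∂̄_1 f ∂_1 g - ∂_1 f ∂̄_1 g`. -/
theorem flat_coeff_one_sub {n : ℕ} {f g : Spec n → ℂ} (hf : GaussSmooth f) (hg : GaussSmooth g)
    (z : ℂ) : flat (coeff 1 f g) z - flat (coeff 1 g f) z =
      Complex.I / (2 * (Real.pi : ℂ)) * poisson (flat f) (flat g) z := by
  have hpi : (Real.pi : ℂ) ≠ 0 := by exact_mod_cast Real.pi_ne_zero
  have h1 : (Fin.cons z 0 : Spec n) = base n z := rfl
  have h2 : ∑ i : Fin n, (mixed i.succ f (base n z) * g (base n z) +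
        f (base n z) * mixed i.succ g (base n z)) =
      ∑ i : Fin n, (mixed i.succ g (base n z) * f (base n z) +
        g (base n z) * mixed i.succ f (base n z)) :=
    Finset.sum_congr rfl fun i _ => by ring
  rw [poisson, fderiv_flat hf.differentiable, fderiv_flat hf.differentiable,
    fderiv_flat hg.differentiable, fderiv_flat hg.differentiable]
  simp only [flat, coeff, h1, h2, wirtinger, if_true, Bool.false_eq_true, if_false, Nat.cast_zero,
    zero_add, inv_one, one_mul]
  generalize ∑ i : Fin n, (mixed i.succ g (base n z) * f (base n z) +
    g (base n z) * mixed i.succ f (base n z)) = S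
  field_simp
  ring

end NormalMatrixQuantization

end

/-! ### The main theorem -/

theorem mainTheorem1 (n : ℕ) :
    ∃ G : ℕ → (Spec n → ℂ) → (Spec n → ℂ) → Spec n → ℂ,
      (∀ m, IsBidifferential (G m)) ∧
      ∀ φ ψ : Mat n → Mat n,
        IsUInvariant φ → IsUInvariant ψ →
        IsSmoothOfGaussianGrowth φ → IsSmoothOfGaussianGrowth ψ →
        ToeplitzProductDefined φ ψ ∧
        ∃ γ : ℕ → ℂ → ℂ,
          ((∀ m, IsSpectralSymbol n (γ m)) ∧ HasExpansion φ ψ γ) ∧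
          (∀ γ' : ℕ → ℂ → ℂ,
            (∀ m, IsSpectralSymbol n (γ' m)) → HasExpansion φ ψ γ' → γ' = γ) ∧
          ∀ f g : Spec n → ℂ, IsSymmetricTail f → IsSymmetricTail g →
            (∀ Z ∈ normalMatrices n, φ Z = sharp f Z) →
            (∀ Z ∈ normalMatrices n, ψ Z = sharp g Z) →
            (∀ m, γ m = flat (G m f g)) ∧
            (∀ z, flat (G 0 f g) z = flat f z * flat g z) ∧
            (∀ z, flat (G 1 f g) z - flat (G 1 g f) z =
              Complex.I / (2 * (Real.pi : ℂ)) * poisson (flat f) (flat g) z) := by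
  refine ⟨coeff, isBidifferential_coeff, fun φ ψ hφ hψ sφ sψ => ?_⟩
  have hf := sφ.gaussSmooth
  have hg := sψ.gaussSmooth
  set f : Spec n → ℂ := fun d => φ (Matrix.diagonal d) 0 0
  set g : Spec n → ℂ := fun d => ψ (Matrix.diagonal d) 0 0
  have hsymb : ∀ m, IsSpectralSymbol n (flat (coeff m f g)) := fun m =>
    ⟨contDiff_flat (GaussSmooth.coeff m hf hg).1,
      toeplitzDefined_of_gaussSmooth (isSharp_spectral _) (GaussSmooth.coeff m hf hg).restrictHead⟩
  have hexp := hasExpansion_coeff hφ.isSharp hψ.isSharp hf hg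
  refine ⟨toeplitzProductDefined_of_gaussSmooth hφ.isSharp hψ.isSharp hf hg,
    fun m => flat (coeff m f g), ⟨hsymb, hexp⟩,
    fun γ' hγ' h' => HasExpansion.unique hsymb hγ' hexp h', fun f' g' hf' hg' ef eg => ?_⟩
  -- Any symmetric symbol representing `φ` is the corner entry of `φ` on diagonal matrices, from
  -- which the coefficients were built.
  obtain rfl := hφ.isSharp.eq_of_eq_sharp hf' ef
  obtain rfl := hψ.isSharp.eq_of_eq_sharp hg' eg
  exact ⟨fun _ => rfl, fun _ => rfl, flat_coeff_one_sub hf hg⟩
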